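/- Let $\Bbbk$ be a field, $k$ a finite-dimensional semisimple $\Bbbk$-algebra (not necessarily commutative), and $E$ a $\Bbbk$-central $k$-bimodule that is finitely generated as a left and as a right $k$-module. Let $T=T_k(E)$, with the filtration $\mathbf F_pT=\bigoplus_{i\le p}E^{\otimes_k i}$, and let $U=T/J$ be a non-homogeneous Koszul algebra; that is, $J\subset T$ is a two-sided ideal generated by $J\cap\mathbf F_2T$, with $J\cap\mathbf F_1T=0$, and, writing $p_2$ for the projection to $E\otimes_kE$ and $Q=p_2(J\cap\mathbf F_2T)$, the associated quadratic algebra $A=T/(Q)$ is Koszul: the graded left $A$-module $k=A/A_{>0}$ has a graded projective resolution $\cdots\to P^{-1}\to P^0\to k\to0$ with each $P^{-i}$ generated by its piece of degree $i$. Write $J\cap\mathbf F_2T=\{q+\alpha(q)+\beta(q)\mid q\in Q\}$ with bimodule maps $\alpha\colon Q\to E$, $\beta\colon Q\to k$. Let $E^*=\mathrm{Hom}_{-k}(E,k)$ be the right dual, with bimodule structure $(afb)(x)=a f(bx)$; identify $E^*\otimes_kE^*=(E\otimes_kE)^*$ by $(f\otimes g)(x\otimes y)=f(g(x)y)$, and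 put $A^!=T_k(E^*)/(Q^\perp)$, so that $(A^!)^1=E^*$ and $(A^!)^2=Q^*$. Then there is a unique curved differential graded algebra structure $(d,c)$ on the graded algebra $A^!$ (a $k$-bilinear graded derivation $d$ of degree $1$ and $c\in(A^!)^2$ with $d^2=[c,\cdot\,]$ and $d(c)=0$) such that $d(f)=f\circ\alpha$ for all $f\in E^*$ and $c=\beta$. With this structure, a curved $A^!$-module is a $\mathbb Z$-graded left $A^!$-module $I$ with a $k$-linear map $d_I$ of degree $1$ such that $d_I^2(m)=cm$ and $d_I(am)=d(a)m+(-1)^{|a|}a\,d_I(m)$. Let $I$ be any object of $K(\mathrm{Inj}\,A^!)$, that is, a curved $A^!$-module which is isomorphic, in the homotopy category $K(A^!)$ of curved modules, to one whose underlying graded module is injective in the category of graded $A^!$-modules (for instance, one which itself has this property). Let $S(I)=\{m\in I\mid am=0 \text{ for all } a\in A^! \text{ of positive degree}\}$, a complex of $k$-modules with the differential $d_I|_{S(I)}$, and let $F(I)=U\otimes_kI$, $F(I)^n=U\otimes_kI^n$, with differential $$d(u\otimes m)=\sum_\alpha ux_\alpha\otimes\hat x_\alpha m+u\otimes d_I(m),$$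 where $\sum_\alpha x_\alpha\otimes\hat x_\alpha\in E\otimes_kE^*=\mathrm{Hom}_{-k}(E,E)$ corresponds to the identity of $E$. Then the morphism $$S(I)\longrightarrow F(I),\qquad m\longmapsto 1\otimes m,$$ is a quasi-isomorphism of complexes of $k$-modules. -/

import Mathlib

set_option linter.unusedSectionVars false

universe u v

namespace NHKoszul

open scoped TensorProduct

/-! ## Tensor products over a noncommutative ring -/

section BTensor

variable (k : Type u) [Ring k] (M N : Type u) [AddCommGroup M] [Module kᵐᵒᵖ M]
  [AddCommGroup N] [Module k N]

/-- The relations `(m r) ⊗ n - m ⊗ (r n)`. -/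
def balancedRel : AddSubgroup (M ⊗[ℤ] N) :=
  AddSubgroup.closure
    {x | ∃ (m : M) (r : k) (n : N), x = (MulOpposite.op r • m) ⊗ₜ[ℤ] n - m ⊗ₜ[ℤ] (r • n)}

/-- The tensor product `M ⊗_k N` of a right `k`-module `M` and a left `k`-module `N`. -/
def BTensor : Type u := (M ⊗[ℤ] N) ⧸ balancedRel k M N

namespace BTensor

instance : AddCommGroup (BTensor k M N) :=
  inferInstanceAs (AddCommGroup ((M ⊗[ℤ] N) ⧸ balancedRel k M N))

variable {M N}

variable (M N) in
/-- The quotient map from the tensor product over `ℤ`. -/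
def proj : (M ⊗[ℤ] N) →+ BTensor k M N := QuotientAddGroup.mk' (balancedRel k M N)

/-- The class of `m ⊗ n`. -/
def tmul (m : M) (n : N) : BTensor k M N := proj k M N (m ⊗ₜ[ℤ] n)

lemma add_tmul (m m' : M) (n : N) : tmul k (m + m') n = tmul k m n + tmul k m' n := by
  simp only [tmul, TensorProduct.add_tmul, map_add]

lemma tmul_add (m : M) (n n' : N) : tmul k m (n + n') = tmul k m n + tmul k m n' := by
  simp only [tmul, TensorProduct.tmul_add, map_add]

lemma smul_tmul (m : M) (r : k) (n : N) :
    tmul k (MulOpposite.op r • m) n = tmul k m (r • n) := by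
  rw [← sub_eq_zero, tmul, tmul, ← map_sub]
  exact (QuotientAddGroup.eq_zero_iff _).2 (AddSubgroup.subset_closure ⟨m, r, n, rfl⟩)

/-- `tmul` as a biadditive map. -/
def tmulHom : M →+ N →+ BTensor k M N :=
  AddMonoidHom.mk' (fun m => AddMonoidHom.mk' (tmul k m) (tmul_add k m))
    (fun m m' => by ext n; exact add_tmul k m m' n)

@[simp] lemma tmulHom_apply (m : M) (n : N) : tmulHom k m n = tmul k m n := rfl

lemma zero_tmul (n : N) : tmul k (0 : M) n = 0 := by
  rw [← tmulHom_apply, map_zero, AddMonoidHom.zero_apply]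

lemma tmul_zero (m : M) : tmul k m (0 : N) = 0 := by
  rw [← tmulHom_apply, map_zero]

@[elab_as_elim]
lemma induction_on {P : BTensor k M N → Prop} (x : BTensor k M N)
    (h0 : P 0) (ht : ∀ m n, P (tmul k m n)) (ha : ∀ x y, P x → P y → P (x + y)) : P x := by
  obtain ⟨y, rfl⟩ : ∃ y, proj k M N y = x :=
    QuotientAddGroup.mk'_surjective (balancedRel k M N) x
  induction y using TensorProduct.induction_on with
  | zero => rw [map_zero]; exact h0
  | tmul m n => exact ht m n
  | add a b iha ihb => rw [map_add]; exact ha _ _ iha ihb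

variable {k}

/-- The additive map out of `M ⊗_k N` given by a `k`-balanced biadditive map. -/
def lift {P : Type*} [AddCommGroup P] (f : M →+ N →+ P)
    (hf : ∀ m (r : k) n, f (MulOpposite.op r • m) n = f m (r • n)) : BTensor k M N →+ P :=
  QuotientAddGroup.lift (balancedRel k M N)
    (TensorProduct.liftAddHom f (fun r m n => by simp)) (by
      rw [balancedRel, AddSubgroup.closure_le]
      rintro _ ⟨m, r, n, rfl⟩
      simp [hf])

@[simp] lemma lift_tmul {P : Type*} [AddCommGroup P] (f : M →+ N →+ P)
    (hf : ∀ m (r : k) n, f (MulOpposite.op r • m) n = f m (r • n)) (m : M) (n : N) :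
    lift f hf (tmul k m n) = f m n := rfl

lemma hom_ext {P : Type*} [AddCommGroup P] {f g : BTensor k M N →+ P}
    (h : ∀ m n, f (tmul k m n) = g (tmul k m n)) : f = g := by
  ext x
  induction x using induction_on with
  | h0 => simp
  | ht m n => exact h m n
  | ha x y hx hy => simp [hx, hy]

/-- The left `k`-module structure on `M ⊗_k N` when `M` is a bimodule. -/
instance leftModule [Module k M] [SMulCommClass k kᵐᵒᵖ M] : Module k (BTensor k M N) :=
  let act (r : k) : BTensor k M N →+ BTensor k M N :=
    lift ((tmulHom k).comp (DistribSMul.toAddMonoidHom M r)) (fun m s n => by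
      simp [smul_comm r, smul_tmul])
  Module.compHom (BTensor k M N) (R := AddMonoid.End (BTensor k M N))
    { toFun := act
      map_one' := hom_ext fun m n => congrArg (tmul k · n) (one_smul k m)
      map_mul' := fun r s => hom_ext fun m n => congrArg (tmul k · n) (mul_smul r s m)
      map_zero' := hom_ext fun m n =>
        (congrArg (tmul k · n) (zero_smul k m)).trans (zero_tmul k n)
      map_add' := fun r s => hom_ext fun m n =>
        (congrArg (tmul k · n) (add_smul r s m)).trans (add_tmul k _ _ n) }

lemma left_smul_tmul [Module k M] [SMulCommClass k kᵐᵒᵖ M] (r : k) (m : M) (n : N) :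
    r • tmul k m n = tmul k (r • m) n := rfl

/-- The right `k`-module structure on `M ⊗_k N` when `N` is a bimodule. -/
instance rightModule [Module kᵐᵒᵖ N] [SMulCommClass k kᵐᵒᵖ N] :
    Module kᵐᵒᵖ (BTensor k M N) :=
  let act (r : kᵐᵒᵖ) : BTensor k M N →+ BTensor k M N :=
    lift (AddMonoidHom.mk' (fun m => (tmulHom k m).comp (DistribSMul.toAddMonoidHom N r))
      (fun m m' => by ext n; simp)) (fun m s n => by
      simp [smul_comm s r, smul_tmul])
  Module.compHom (BTensor k M N) (R := AddMonoid.End (BTensor k M N))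
    { toFun := act
      map_one' := hom_ext fun m n => congrArg (tmul k m) (one_smul kᵐᵒᵖ n)
      map_mul' := fun r s => hom_ext fun m n => congrArg (tmul k m) (mul_smul r s n)
      map_zero' := hom_ext fun m n =>
        (congrArg (tmul k m) (zero_smul kᵐᵒᵖ n)).trans (tmul_zero k m)
      map_add' := fun r s => hom_ext fun m n =>
        (congrArg (tmul k m) (add_smul r s n)).trans (tmul_add k m _ _) }

lemma right_smul_tmul [Module kᵐᵒᵖ N] [SMulCommClass k kᵐᵒᵖ N] (r : kᵐᵒᵖ) (m : M) (n : N) :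
    r • tmul k m n = tmul k m (r • n) := rfl

end BTensor

end BTensor

/-! ## Right duals, tensor algebras, quadratic duals -/

section Algebra

variable (k E : Type u) [Ring k] [AddCommGroup E] [Module kᵐᵒᵖ E]

/-- The right dual `E^* = Hom_{-k}(E, k)`, the right `k`-linear maps from `E` to `k`. -/
def RDual : Type u := E →ₗ[kᵐᵒᵖ] k

namespace RDual

instance : AddCommGroup (RDual k E) := inferInstanceAs (AddCommGroup (E →ₗ[kᵐᵒᵖ] k))

instance : FunLike (RDual k E) E k := inferInstanceAs (FunLike (E →ₗ[kᵐᵒᵖ] k) E k)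

instance : LinearMapClass (RDual k E) kᵐᵒᵖ E k :=
  inferInstanceAs (LinearMapClass (E →ₗ[kᵐᵒᵖ] k) kᵐᵒᵖ E k)

/-- The left action `(a f)(x) = a f(x)`. -/
instance : Module k (RDual k E) := inferInstanceAs (Module k (E →ₗ[kᵐᵒᵖ] k))

variable {k E}

@[ext] lemma ext {f g : RDual k E} (h : ∀ x, f x = g x) : f = g := DFunLike.ext f g h

@[simp] lemma add_apply (f g : RDual k E) (x : E) : (f + g) x = f x + g x := rfl
@[simp] lemma zero_apply (x : E) : (0 : RDual k E) x = 0 := rfl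
@[simp] lemma smul_apply (a : k) (f : RDual k E) (x : E) : (a • f) x = a * f x := rfl

lemma sum_apply {n : ℕ} (r : Fin n → k) (f : Fin n → RDual k E) (e : E) :
    (∑ a, r a • f a) e = ∑ a, r a * f a e := by
  let ev : RDual k E →+ k := AddMonoidHom.mk' (fun f => f e) (fun _ _ => rfl)
  exact map_sum ev _ _

lemma map_op_smul (f : RDual k E) (r : k) (x : E) : f (MulOpposite.op r • x) = f x * r :=
  map_smul f (MulOpposite.op r) x

variable [Module k E] [SMulCommClass k kᵐᵒᵖ E]

/-- The right action `(f a)(x) = f(a x)`. -/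
instance : SMul kᵐᵒᵖ (RDual k E) where
  smul a f :=
    ({ toFun := fun x => f (a.unop • x)
       map_add' := fun x y => by simp
       map_smul' := fun r x => by
        rw [smul_comm]; exact map_smul f r _ } : E →ₗ[kᵐᵒᵖ] k)

@[simp] lemma op_smul_apply (a : kᵐᵒᵖ) (f : RDual k E) (x : E) :
    (a • f) x = f (a.unop • x) := rfl

instance : Module kᵐᵒᵖ (RDual k E) where
  one_smul f := by ext x; simp
  mul_smul a b f := by ext x; simp [mul_smul]
  smul_zero a := by ext x; simp
  smul_add a f g := by ext x; simp
  add_smul a b f := by ext x; simp [add_smul]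
  zero_smul f := by ext x; simp

instance : SMulCommClass k kᵐᵒᵖ (RDual k E) where
  smul_comm a b f := by ext x; simp

end RDual

variable [Module k E]

/-- Relations of the tensor algebra of the bimodule `E` on generators the elements of `k` and `E`. -/
inductive TRel : FreeAlgebra ℤ (k ⊕ E) → FreeAlgebra ℤ (k ⊕ E) → Prop
  | one : TRel (FreeAlgebra.ι ℤ (Sum.inl 1)) 1
  | add (r s : k) : TRel (FreeAlgebra.ι ℤ (Sum.inl (r + s)))
      (FreeAlgebra.ι ℤ (Sum.inl r) + FreeAlgebra.ι ℤ (Sum.inl s))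
  | mul (r s : k) : TRel (FreeAlgebra.ι ℤ (Sum.inl (r * s)))
      (FreeAlgebra.ι ℤ (Sum.inl r) * FreeAlgebra.ι ℤ (Sum.inl s))
  | vadd (x y : E) : TRel (FreeAlgebra.ι ℤ (Sum.inr (x + y)))
      (FreeAlgebra.ι ℤ (Sum.inr x) + FreeAlgebra.ι ℤ (Sum.inr y))
  | left (r : k) (x : E) : TRel (FreeAlgebra.ι ℤ (Sum.inr (r • x)))
      (FreeAlgebra.ι ℤ (Sum.inl r) * FreeAlgebra.ι ℤ (Sum.inr x))
  | right (r : k) (x : E) : TRel (FreeAlgebra.ι ℤ (Sum.inr (MulOpposite.op r • x)))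
      (FreeAlgebra.ι ℤ (Sum.inr x) * FreeAlgebra.ι ℤ (Sum.inl r))

/-- The tensor algebra `T_k(E) = k ⊕ E ⊕ (E ⊗_k E) ⊕ ⋯`, by its universal property: the ring
generated by the ring `k` and the `k`-bimodule `E`. -/
def TAlg : Type u := RingQuot (TRel k E)

namespace TAlg

instance : Ring (TAlg k E) := inferInstanceAs (Ring (RingQuot (TRel k E)))

/-- The quotient map from the free ring. -/
def proj : FreeAlgebra ℤ (k ⊕ E) →+* TAlg k E := RingQuot.mkRingHom (TRel k E)

variable {k E} in
lemma proj_rel {a b : FreeAlgebra ℤ (k ⊕ E)} (h : TRel k E a b) : proj k E a = proj k E b :=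
  RingQuot.mkRingHom_rel h

/-- The structure map `k → T_k(E)`. -/
def unit : k →+* TAlg k E where
  toFun r := proj k E (FreeAlgebra.ι ℤ (Sum.inl r))
  map_one' := by rw [proj_rel TRel.one, map_one]
  map_mul' r s := by rw [proj_rel (TRel.mul r s), map_mul]
  map_zero' := by
    have h := proj_rel (E := E) (TRel.add (0 : k) 0)
    rw [add_zero, map_add] at h
    simpa using h
  map_add' r s := by rw [proj_rel (TRel.add r s), map_add]

/-- The inclusion `E → T_k(E)`. -/
def ι : E →+ TAlg k E :=
  AddMonoidHom.mk' (fun x => proj k E (FreeAlgebra.ι ℤ (Sum.inr x))) (fun x y => by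
    rw [proj_rel (TRel.vadd x y), map_add])

variable {k E}

lemma ι_smul (r : k) (x : E) : ι k E (r • x) = unit k E r * ι k E x :=
  (proj_rel (TRel.left r x)).trans (map_mul _ _ _)

lemma ι_op_smul (r : k) (x : E) : ι k E (MulOpposite.op r • x) = ι k E x * unit k E r :=
  (proj_rel (TRel.right r x)).trans (map_mul _ _ _)

variable (k E)

/-- The degree `n` piece `E^{⊗ n}` of `T_k(E)`: sums of elements `r x₁ ⋯ xₙ`. -/
def deg (n : ℕ) : AddSubgroup (TAlg k E) :=
  AddSubgroup.closure
    {t | ∃ (r : k) (l : List E), l.length = n ∧ t = unit k E r * (l.map (ι k E)).prod}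

/-- The filtration `F_p T_k(E) = ⨁_{i ≤ p} E^{⊗ i}`. -/
def filt (p : ℕ) : AddSubgroup (TAlg k E) := ⨆ i ∈ Set.Iic p, deg k E i

/-- The map `E ⊗_k E → T_k(E)` onto the degree two piece. -/
def m2 : BTensor k E E →+ TAlg k E :=
  BTensor.lift
    (AddMonoidHom.mk' (fun x => (AddMonoidHom.mulLeft (ι k E x)).comp (ι k E))
      (fun x y => by ext z; simp [add_mul]))
    (fun x r y => by simp [ι_op_smul, ι_smul, mul_assoc])

variable {k E}

@[simp] lemma m2_tmul (x y : E) : m2 k E (BTensor.tmul k x y) = ι k E x * ι k E y := rfl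

end TAlg

variable {k E}

/-- The `k`-algebra `T_k(E)/J`. -/
def QAlg (J : TwoSidedIdeal (TAlg k E)) : Type u := J.ringCon.Quotient

namespace QAlg

variable (J : TwoSidedIdeal (TAlg k E))

instance : Ring (QAlg J) := inferInstanceAs (Ring J.ringCon.Quotient)

/-- The quotient map. -/
def mk : TAlg k E →+* QAlg J := J.ringCon.mk'

lemma mk_eq_zero {t : TAlg k E} (ht : t ∈ J) : mk J t = 0 :=
  Quotient.sound' ((J.rel_iff _ _).2 (by simpa using ht))

/-- The structure map `k → T_k(E)/J`. -/
def unit : k →+* QAlg J := (mk J).comp (TAlg.unit k E)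

/-- The map `E → T_k(E)/J`. -/
def ι : E →+ QAlg J := (mk J).toAddMonoidHom.comp (TAlg.ι k E)

/-- The image of the degree `n` piece; this is the grading of `T_k(E)/J` when `J` is
homogeneous. -/
def deg (n : ℕ) : AddSubgroup (QAlg J) := (TAlg.deg k E n).map (mk J).toAddMonoidHom

instance : Module k (QAlg J) := Module.compHom (QAlg J) (unit J)

instance : Module kᵐᵒᵖ (QAlg J) := Module.compHom (QAlg J) (unit J).op

variable {J}

lemma smul_def (r : k) (a : QAlg J) : r • a = unit J r * a := rfl

lemma op_smul_def (r : k) (a : QAlg J) : MulOpposite.op r • a = a * unit J r := rfl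

instance : SMulCommClass k kᵐᵒᵖ (QAlg J) where
  smul_comm r s a := by
    induction s using MulOpposite.rec' with
    | h s => simp only [smul_def, op_smul_def, mul_assoc]

lemma ι_smul (r : k) (x : E) : ι J (r • x) = unit J r * ι J x := by
  simp [ι, unit, TAlg.ι_smul]

lemma ι_op_smul (r : k) (x : E) : ι J (MulOpposite.op r • x) = ι J x * unit J r := by
  simp [ι, unit, TAlg.ι_op_smul]

lemma unit_mem (r : k) : unit J r ∈ deg J 0 :=
  ⟨TAlg.unit k E r, AddSubgroup.subset_closure ⟨r, [], rfl, by simp⟩, rfl⟩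

lemma ι_mem (x : E) : ι J x ∈ deg J 1 :=
  ⟨TAlg.ι k E x, AddSubgroup.subset_closure ⟨1, [x], rfl, by simp⟩, rfl⟩

end QAlg

/-- The ideal of `T_k(E)` generated by a space `Q ⊆ E ⊗_k E` of quadratic relations. The quadratic
algebra `T_k(E)/(Q)` is `QAlg (quadIdeal Q)`. -/
def quadIdeal (Q : AddSubgroup (BTensor k E E)) : TwoSidedIdeal (TAlg k E) :=
  TwoSidedIdeal.span (TAlg.m2 k E '' Q)

variable [SMulCommClass k kᵐᵒᵖ E]

/-- The pairing of `E^* ⊗_k E^*` with `E ⊗_k E`, given by `(f ⊗ g)(x ⊗ y) = f(g(x) y)`. -/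
def pairing : BTensor k (RDual k E) (RDual k E) →+ BTensor k E E →+ k :=
  BTensor.lift
    (AddMonoidHom.mk'
      (fun f => AddMonoidHom.mk'
        (fun g => BTensor.lift
          (AddMonoidHom.mk'
            (fun x => AddMonoidHom.mk' (fun y => f (g x • y)) (fun y y' => by simp))
            (fun x x' => by ext y; simp [add_smul]))
          (fun x r y => by simp [mul_smul]))
        (fun g g' => BTensor.hom_ext fun x y => by simp [add_smul]))
      (fun f f' => by
        ext g : 1
        exact BTensor.hom_ext fun x y => by simp))
    (fun f r g => BTensor.hom_ext fun x y => by simp [mul_smul])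

@[simp] lemma pairing_tmul (f g : RDual k E) (x y : E) :
    pairing (BTensor.tmul k f g) (BTensor.tmul k x y) = f (g x • y) := rfl

/-- `Q^⊥ ⊆ E^* ⊗_k E^*`: the elements which vanish on `Q` as functionals on `E ⊗_k E`. -/
def perp (Q : AddSubgroup (BTensor k E E)) :
    AddSubgroup (BTensor k (RDual k E) (RDual k E)) where
  carrier := {t | ∀ q ∈ Q, pairing t q = 0}
  zero_mem' _ _ := by simp
  add_mem' ha hb q hq := by simp [ha q hq, hb q hq]
  neg_mem' ha q hq := by simp [ha q hq]

/-- The defining ideal of the quadratic dual: for `A = T_k(E)/(Q)`, the quadratic dual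
`A^! = T_k(E^*)/(Q^⊥)` is `QAlg (dualIdeal Q)`. -/
def dualIdeal (Q : AddSubgroup (BTensor k E E)) : TwoSidedIdeal (TAlg k (RDual k E)) :=
  quadIdeal (perp Q)

end Algebra

/-! ## Graded modules and Koszul algebras -/

section Graded

variable {Λ : Type u} [Ring Λ] (𝒜 : ℕ → AddSubgroup Λ)

/-- `ℤ`-graded left modules over a ring `Λ` graded by the subgroups `𝒜 i`, `i ≥ 0`. -/
structure GrMod where
  carrier : Type u
  [grp : AddCommGroup carrier]
  [mod : Module Λ carrier]
  deg : ℤ → AddSubgroup carrier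
  isInternal : DirectSum.IsInternal deg
  smul_mem : ∀ {i : ℕ} {j : ℤ} {a : Λ} {m : carrier},
    a ∈ 𝒜 i → m ∈ deg j → a • m ∈ deg (j + i)

attribute [instance] GrMod.grp GrMod.mod

variable {𝒜}

/-- Morphisms of graded modules are `Λ`-linear maps of degree zero. -/
def GrMod.IsGraded {M N : GrMod 𝒜} (f : M.carrier →ₗ[Λ] N.carrier) : Prop :=
  ∀ j, ∀ m ∈ M.deg j, f m ∈ N.deg j

/-- Injective objects of the category of graded modules. -/
def GrMod.IsInjective (I : GrMod 𝒜) : Prop :=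
  ∀ (X Y : GrMod 𝒜) (f : X.carrier →ₗ[Λ] Y.carrier) (g : X.carrier →ₗ[Λ] I.carrier),
    GrMod.IsGraded f → Function.Injective f → GrMod.IsGraded g →
    ∃ h : Y.carrier →ₗ[Λ] I.carrier, GrMod.IsGraded h ∧ h ∘ₗ f = g

/-- Projective objects of the category of graded modules. -/
def GrMod.IsProjective (P : GrMod 𝒜) : Prop :=
  ∀ (X Y : GrMod 𝒜) (f : X.carrier →ₗ[Λ] Y.carrier) (g : P.carrier →ₗ[Λ] Y.carrier),
    GrMod.IsGraded f → Function.Surjective f → GrMod.IsGraded g →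
    ∃ h : P.carrier →ₗ[Λ] X.carrier, GrMod.IsGraded h ∧ f ∘ₗ h = g

variable (𝒜)

/-- The left ideal `Λ_{>0}` (generated by the elements of positive degree). -/
def augIdeal : Submodule Λ Λ := Submodule.span Λ {a | ∃ i > 0, a ∈ 𝒜 i}

/-- The graded algebra `(Λ, 𝒜)` is Koszul: the graded module `Λ/Λ_{>0}`, concentrated in degree
`0`, has a resolution `⋯ → P 1 → P 0 → Λ/Λ_{>0} → 0` by projective graded modules such that `P i`
is generated by its piece of degree `i`. -/
def IsKoszul : Prop :=
  ∃ (P : ℕ → GrMod 𝒜) (d : ∀ i, (P (i + 1)).carrier →ₗ[Λ] (P i).carrier)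
    (ε : (P 0).carrier →ₗ[Λ] Λ ⧸ augIdeal 𝒜),
    (∀ i, (P i).IsProjective) ∧
    (∀ i : ℕ, Submodule.span Λ ((P i).deg i : Set (P i).carrier) = ⊤) ∧
    (∀ i, GrMod.IsGraded (d i)) ∧
    (∀ j ≠ 0, ∀ x ∈ (P 0).deg j, ε x = 0) ∧
    Function.Surjective ε ∧
    Function.Exact (d 0) ε ∧
    (∀ i, Function.Exact (d (i + 1)) (d i))

/-! ## Curved differential graded algebras and modules -/

/-- Curved differential graded structures on the graded algebra `(Λ, 𝒜)`, where `𝒜 0` is the base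
ring. Since `|c| = 2`, the graded commutator `[c, a]` is `c a - a c`. -/
@[ext]
structure CDGA where
  d : Λ →+ Λ
  c : Λ
  d_mem : ∀ {i : ℕ} {a : Λ}, a ∈ 𝒜 i → d a ∈ 𝒜 (i + 1)
  c_mem : c ∈ 𝒜 2
  d_base_mul : ∀ {r : Λ} (a : Λ), r ∈ 𝒜 0 → d (r * a) = r * d a
  d_mul_base : ∀ {r : Λ} (a : Λ), r ∈ 𝒜 0 → d (a * r) = d a * r
  leibniz : ∀ {i : ℕ} {a : Λ} (b : Λ), a ∈ 𝒜 i → d (a * b) = d a * b + (-1) ^ i * (a * d b)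
  d_d : ∀ a, d (d a) = c * a - a * c
  d_c : d c = 0

variable {𝒜}

/-- Curved modules over a curved differential graded algebra. -/
structure CurvedModule (D : CDGA 𝒜) extends GrMod 𝒜 where
  d : carrier →+ carrier
  d_mem : ∀ {j : ℤ} {m : carrier}, m ∈ deg j → d m ∈ deg (j + 1)
  d_base : ∀ {r : Λ} (m : carrier), r ∈ 𝒜 0 → d (r • m) = r • d m
  d_d : ∀ m, d (d m) = D.c • m
  leibniz : ∀ {i : ℕ} {a : Λ} (m : carrier), a ∈ 𝒜 i →
    d (a • m) = D.d a • m + ((-1) ^ i * a) • d m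

namespace CurvedModule

variable {D : CDGA 𝒜}

/-- Morphisms of curved modules. -/
def IsHom {M N : CurvedModule D} (f : M.carrier →ₗ[Λ] N.carrier) : Prop :=
  GrMod.IsGraded (M := M.toGrMod) (N := N.toGrMod) f ∧ ∀ m, f (M.d m) = N.d (f m)

/-- `f = d s + s d` for a map `s` of graded modules of degree `-1`, that is,
`s (a m) = (-1)^{|a|} a s(m)`. -/
def NullHomotopic {M N : CurvedModule D} (f : M.carrier →ₗ[Λ] N.carrier) : Prop :=
  ∃ s : M.carrier →+ N.carrier,
    (∀ j, ∀ m ∈ M.deg j, s m ∈ N.deg (j - 1)) ∧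
    (∀ (i : ℕ) (a : Λ) (m : M.carrier), a ∈ 𝒜 i → s (a • m) = ((-1) ^ i * a) • s m) ∧
    ∀ m, f m = N.d (s m) + s (M.d m)

/-- Isomorphism in the homotopy category of curved modules. -/
def HomotopyEquivalent (M N : CurvedModule D) : Prop :=
  ∃ (f : M.carrier →ₗ[Λ] N.carrier) (g : N.carrier →ₗ[Λ] M.carrier),
    IsHom f ∧ IsHom g ∧
    NullHomotopic (M := M) (N := M) (g ∘ₗ f - LinearMap.id) ∧
    NullHomotopic (M := N) (N := N) (f ∘ₗ g - LinearMap.id)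

/-- Objects of the homotopy category isomorphic to a curved module whose underlying graded module
is injective. -/
def InKInj (M : CurvedModule D) : Prop :=
  ∃ J : CurvedModule D, J.toGrMod.IsInjective ∧ HomotopyEquivalent M J

end CurvedModule

end Graded

/-! ## Non-homogeneous Koszul algebras -/

section NonHomogeneous

variable {k E : Type u} [Ring k] [AddCommGroup E] [Module k E] [Module kᵐᵒᵖ E]

/-- `U = T_k(E)/J` is a non-homogeneous quadratic algebra: `J` is generated by
`J ∩ F_2 T_k(E)` and `F_1 U = k ⊕ E`, that is, `k ⊕ E → U` is injective. -/
structure IsNonhomQuadratic (J : TwoSidedIdeal (TAlg k E)) : Prop where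
  span_eq : TwoSidedIdeal.span ((J : Set (TAlg k E)) ∩ TAlg.filt k E 2) = J
  injective : ∀ (e : E) (r : k), TAlg.ι k E e + TAlg.unit k E r ∈ J → e = 0 ∧ r = 0

/-- The space of quadratic relations `Q = p_2(J ∩ F_2 T_k(E)) ⊆ E ⊗_k E`. -/
def relSpace (J : TwoSidedIdeal (TAlg k E)) : AddSubgroup (BTensor k E E) where
  carrier := {q | ∃ (e : E) (r : k), TAlg.m2 k E q + TAlg.ι k E e + TAlg.unit k E r ∈ J}
  zero_mem' := ⟨0, 0, by simp⟩
  add_mem' := by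
    rintro a b ⟨e, r, h⟩ ⟨e', r', h'⟩
    refine ⟨e + e', r + r', ?_⟩
    convert J.add_mem h h' using 1
    simp only [map_add]
    abel
  neg_mem' := by
    rintro a ⟨e, r, h⟩
    refine ⟨-e, -r, ?_⟩
    convert J.neg_mem h using 1
    simp only [map_neg]
    abel

/-- The map `α : Q → E`, where `J ∩ F_2 T_k(E) = {q + α(q) + β(q) | q ∈ Q}`. -/
noncomputable def alpha (J : TwoSidedIdeal (TAlg k E)) (q : relSpace J) : E :=
  q.2.choose

/-- The map `β : Q → k`, where `J ∩ F_2 T_k(E) = {q + α(q) + β(q) | q ∈ Q}`. -/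
noncomputable def beta (J : TwoSidedIdeal (TAlg k E)) (q : relSpace J) : k :=
  q.2.choose_spec.choose

lemma alpha_beta_mem (J : TwoSidedIdeal (TAlg k E)) (q : relSpace J) :
    TAlg.m2 k E q + TAlg.ι k E (alpha J q) + TAlg.unit k E (beta J q) ∈ J :=
  q.2.choose_spec.choose_spec

/-- `U = T_k(E)/J` is a non-homogeneous Koszul algebra: it is a non-homogeneous quadratic algebra
and the associated quadratic algebra `A = T_k(E)/(Q)` is Koszul. -/
structure IsNonhomKoszul (J : TwoSidedIdeal (TAlg k E)) : Prop extends IsNonhomQuadratic J where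
  koszul : IsKoszul (QAlg.deg (quadIdeal (relSpace J)))

variable [SMulCommClass k kᵐᵒᵖ E]

/-- The ring `A^!`, the quadratic dual of the associated quadratic algebra `A` of `T_k(E)/J`. -/
abbrev KDual (J : TwoSidedIdeal (TAlg k E)) : Type u := QAlg (dualIdeal (relSpace J))

/-- The grading of `A^!`. -/
abbrev KDual.deg (J : TwoSidedIdeal (TAlg k E)) : ℕ → AddSubgroup (KDual J) :=
  QAlg.deg (dualIdeal (relSpace J))

/-- The map `E^* ⊗_k E^* → (A^!)^2`, with kernel `Q^⊥`. -/
def KDual.m2 (J : TwoSidedIdeal (TAlg k E)) :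
    BTensor k (RDual k E) (RDual k E) →+ KDual J :=
  (QAlg.mk (dualIdeal (relSpace J))).toAddMonoidHom.comp (TAlg.m2 k (RDual k E))

/-- `w ∈ (A^!)^2 = Q^*` is the functional `φ` on `Q`. -/
def KDual.Represents {J : TwoSidedIdeal (TAlg k E)} (w : KDual J) (φ : relSpace J → k) : Prop :=
  ∃ t, w = KDual.m2 J t ∧ ∀ q : relSpace J, pairing t q = φ q

/-- `(d, c)` is the curved structure `(α^*, β)` on `A^!`: one has `d f = f ∘ α` in
`(A^!)^2 = Q^*` for `f ∈ (A^!)^1 = E^*`, and `c = β`. -/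
structure IsKoszulDualStructure (J : TwoSidedIdeal (TAlg k E)) (D : CDGA (KDual.deg J)) :
    Prop where
  d_eq : ∀ f : RDual k E,
    KDual.Represents (D.d (QAlg.ι _ f)) (fun q => f (alpha J q))
  c_eq : KDual.Represents D.c (beta J)

end NonHomogeneous

/-! ## The complexes `S(I)` and `F(I)` -/

section Complexes

open CategoryTheory

variable {k E : Type u} [Ring k] [AddCommGroup E] [Module k E] [Module kᵐᵒᵖ E]

/-- The pieces of a graded module are `k`-modules. -/
instance GrMod.degModule {J : TwoSidedIdeal (TAlg k E)} (I : GrMod (QAlg.deg J)) (n : ℤ) :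
    Module k (I.deg n) where
  smul r m := ⟨QAlg.unit J r • m.1, by
    have h := I.smul_mem (QAlg.unit_mem r) m.2
    rwa [Nat.cast_zero, add_zero] at h⟩
  one_smul m := Subtype.ext (by
    change QAlg.unit J 1 • m.1 = m.1
    rw [map_one, one_smul])
  mul_smul r s m := Subtype.ext (by
    change QAlg.unit J (r * s) • m.1 = QAlg.unit J r • QAlg.unit J s • m.1
    rw [map_mul, mul_smul])
  smul_zero r := Subtype.ext (smul_zero _)
  smul_add r m m' := Subtype.ext (smul_add _ _ _)
  add_smul r s m := Subtype.ext (by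
    change QAlg.unit J (r + s) • m.1 = QAlg.unit J r • m.1 + QAlg.unit J s • m.1
    rw [map_add, add_smul])
  zero_smul m := Subtype.ext (by
    change QAlg.unit J 0 • m.1 = 0
    rw [map_zero, zero_smul])

lemma GrMod.coe_smul {J : TwoSidedIdeal (TAlg k E)} (I : GrMod (QAlg.deg J)) {n : ℤ} (r : k)
    (m : I.deg n) : ((r • m : I.deg n) : I.carrier) = QAlg.unit J r • m.1 := rfl

lemma TAlg.mul_unit_mem {n : ℕ} {a : TAlg k E} (ha : a ∈ TAlg.deg k E n) (r : k) :
    a * TAlg.unit k E r ∈ TAlg.deg k E n := by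
  induction ha using AddSubgroup.closure_induction with
  | zero => rw [zero_mul]; exact zero_mem _
  | add x y _ _ hx hy => rw [add_mul]; exact add_mem hx hy
  | neg x _ hx => rw [neg_mul]; exact neg_mem hx
  | mem x hx =>
    obtain ⟨s, l, hl, rfl⟩ := hx
    apply AddSubgroup.subset_closure
    rcases List.eq_nil_or_concat l with rfl | ⟨l, y, rfl⟩
    · exact ⟨s * r, [], hl, by simp⟩
    · refine ⟨s, l ++ [MulOpposite.op r • y], by simpa using hl, ?_⟩
      simp [TAlg.ι_op_smul, mul_assoc]

lemma QAlg.mul_unit_mem {J : TwoSidedIdeal (TAlg k E)} {n : ℕ} {a : QAlg J}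
    (ha : a ∈ QAlg.deg J n) (r : k) : a * QAlg.unit J r ∈ QAlg.deg J n := by
  obtain ⟨t, ht, rfl⟩ := ha
  exact ⟨_, TAlg.mul_unit_mem ht r, map_mul (QAlg.mk J) _ _⟩

/-- The degree `n` piece of `S(I) = {m ∈ I | a m = 0 for all a of positive degree}`. -/
def socle {J : TwoSidedIdeal (TAlg k E)} (I : GrMod (QAlg.deg J)) (n : ℤ) :
    Submodule k (I.deg n) where
  carrier := {m | ∀ i > 0, ∀ a ∈ QAlg.deg J i, a • m.1 = 0}
  zero_mem' i _ a _ := smul_zero a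
  add_mem' hm hm' i hi a ha := by
    change a • (_ + _) = _
    rw [smul_add, hm i hi a ha, hm' i hi a ha, add_zero]
  smul_mem' r m hm i hi a ha := by
    rw [GrMod.coe_smul, ← mul_smul]
    exact hm i hi _ (QAlg.mul_unit_mem ha r)

variable {J : TwoSidedIdeal (TAlg k E)} {D : CDGA (QAlg.deg J)}

/-- The differential of a curved module on its pieces. -/
def CurvedModule.dDeg (I : CurvedModule D) (n : ℤ) : I.deg n →ₗ[k] I.deg (n + 1) where
  toFun m := ⟨I.d m.1, I.d_mem m.2⟩
  map_add' _ _ := Subtype.ext (map_add I.d _ _)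
  map_smul' r _ := Subtype.ext (I.d_base _ (QAlg.unit_mem r))

lemma CurvedModule.dDeg_mem (I : CurvedModule D) (n : ℤ) (m : I.deg n)
    (hm : m ∈ socle I.toGrMod n) : I.dDeg n m ∈ socle I.toGrMod (n + 1) := by
  intro i hi a ha
  have h := I.leibniz m.1 ha
  rw [hm i hi a ha, hm (i + 1) (Nat.succ_pos i) _ (D.d_mem ha), map_zero, zero_add,
    mul_smul] at h
  change a • I.d m.1 = 0
  rcases Nat.even_or_odd i with hi' | hi'
  · rw [hi'.neg_one_pow, one_smul] at h
    exact h.symm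
  · rw [hi'.neg_one_pow, neg_one_smul] at h
    exact neg_eq_zero.1 h.symm

/-- The complex of `k`-modules `S(I)`, with the restriction of the differential of `I`. -/
noncomputable def socleComplex (I : CurvedModule D) : CochainComplex (ModuleCat.{u} k) ℤ :=
  CochainComplex.of (fun n => ModuleCat.of k (socle I.toGrMod n))
    (fun n => ModuleCat.ofHom ((I.dDeg n).restrict (I.dDeg_mem n)))
    (fun n => by
      ext m
      change I.d (I.d m.1.1) = 0
      rw [I.d_d]
      exact m.2 2 (by norm_num) _ D.c_mem)

end Complexes

section FComplex

open CategoryTheory BTensor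

section

variable {k E : Type u} [Ring k] [AddCommGroup E] [Module k E] [Module kᵐᵒᵖ E]
  [SMulCommClass k kᵐᵒᵖ E] {J : TwoSidedIdeal (TAlg k E)}

/-- The action of `f ∈ E^* = (A^!)^1` on the pieces of a graded `A^!`-module. -/
def GrMod.act (I : GrMod (KDual.deg J)) (n : ℤ) : RDual k E →+ I.deg n →+ I.deg (n + 1) :=
  AddMonoidHom.mk'
    (fun f => AddMonoidHom.mk'
      (fun m => ⟨QAlg.ι (dualIdeal (relSpace J)) f • m.1, by
        have h := I.smul_mem (QAlg.ι_mem f) m.2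
        rwa [Nat.cast_one] at h⟩)
      (fun _ _ => Subtype.ext (smul_add _ _ _)))
    (fun f g => by
      ext m
      change QAlg.ι (dualIdeal (relSpace J)) (f + g) • m.1
        = QAlg.ι (dualIdeal (relSpace J)) f • m.1 + QAlg.ι (dualIdeal (relSpace J)) g • m.1
      rw [map_add, add_smul])

lemma GrMod.coe_act (I : GrMod (KDual.deg J)) (n : ℤ) (f : RDual k E) (m : I.deg n) :
    (I.act n f m : I.carrier) = QAlg.ι (dualIdeal (relSpace J)) f • m.1 := rfl

lemma GrMod.smul_act (I : GrMod (KDual.deg J)) (n : ℤ) (r : k) (f : RDual k E) (m : I.deg n) :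
    I.act n (r • f) m = r • I.act n f m :=
  Subtype.ext (by
    rw [GrMod.coe_act, GrMod.coe_smul, GrMod.coe_act, QAlg.ι_smul, mul_smul])

lemma GrMod.act_smul (I : GrMod (KDual.deg J)) (n : ℤ) (r : k) (f : RDual k E) (m : I.deg n) :
    I.act n (MulOpposite.op r • f) m = I.act n f (r • m) :=
  Subtype.ext (by
    rw [GrMod.coe_act, GrMod.coe_act, GrMod.coe_smul, QAlg.ι_op_smul, mul_smul])

/-- The degree `n` piece `U ⊗_k I^n` of `F(I)`. -/
abbrev FDeg (I : GrMod (KDual.deg J)) (n : ℤ) : Type u := BTensor k (QAlg J) (I.deg n)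

lemma pairing_op_smul (t : BTensor k (RDual k E) (RDual k E)) (r : k) (w : BTensor k E E) :
    pairing t (MulOpposite.op r • w) = pairing t w * r := by
  induction t using BTensor.induction_on with
  | h0 => simp
  | ha t t' h h' => simp [h, h', add_mul]
  | ht f g =>
    induction w using BTensor.induction_on with
    | h0 => simp
    | ha w w' h h' => rw [smul_add, map_add, h, h', map_add, add_mul]
    | ht x y =>
      rw [right_smul_tmul, pairing_tmul, pairing_tmul, smul_comm, RDual.map_op_smul]

lemma pairing_smul (r : k) (t : BTensor k (RDual k E) (RDual k E)) (w : BTensor k E E) :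
    pairing (r • t) w = r * pairing t w := by
  induction t using BTensor.induction_on with
  | h0 => simp
  | ha t t' h h' => rw [smul_add, map_add, AddMonoidHom.add_apply, h, h', map_add,
      AddMonoidHom.add_apply, mul_add]
  | ht f g =>
    induction w using BTensor.induction_on with
    | h0 => simp
    | ha w w' h h' => rw [map_add, h, h', map_add, mul_add]
    | ht x y => rw [left_smul_tmul, pairing_tmul, pairing_tmul, RDual.smul_apply]

lemma pairing_sum {ι : Type*} [Fintype ι] (r : ι → k)
    (t : ι → BTensor k (RDual k E) (RDual k E)) (w : BTensor k E E) :
    pairing (∑ j, r j • t j) w = ∑ j, r j * pairing (t j) w := by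
  rw [map_sum, AddMonoidHom.finsetSum_apply]
  exact Finset.sum_congr rfl fun j _ => pairing_smul _ _ _

lemma m2_op_smul (r : k) (w : BTensor k E E) :
    TAlg.m2 k E (MulOpposite.op r • w) = TAlg.m2 k E w * TAlg.unit k E r := by
  induction w using BTensor.induction_on with
  | h0 => simp
  | ha w w' h h' => rw [smul_add, map_add, h, h', map_add, add_mul]
  | ht x y => rw [right_smul_tmul, TAlg.m2_tmul, TAlg.m2_tmul, TAlg.ι_op_smul, mul_assoc]

lemma m2_smul (r : k) (w : BTensor k E E) :
    TAlg.m2 k E (r • w) = TAlg.unit k E r * TAlg.m2 k E w := by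
  induction w using BTensor.induction_on with
  | h0 => simp
  | ha w w' h h' => rw [smul_add, map_add, h, h', map_add, mul_add]
  | ht x y => rw [left_smul_tmul, TAlg.m2_tmul, TAlg.m2_tmul, TAlg.ι_smul, mul_assoc]

lemma m2_mem (w : BTensor k E E) : TAlg.m2 k E w ∈ TAlg.deg k E 2 := by
  induction w using BTensor.induction_on with
  | h0 => rw [map_zero]; exact zero_mem _
  | ha w w' h h' => rw [map_add]; exact add_mem h h'
  | ht x y => exact AddSubgroup.subset_closure ⟨1, [x, y], rfl, by simp⟩

/-- The space `Q` as a right submodule. -/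
def relSub (J : TwoSidedIdeal (TAlg k E)) : Submodule kᵐᵒᵖ (BTensor k E E) where
  __ := relSpace J
  smul_mem' := by
    rintro r q ⟨e, s, h⟩
    induction r using MulOpposite.rec' with
    | h r =>
    refine ⟨MulOpposite.op r • e, s * r, ?_⟩
    rw [m2_op_smul, TAlg.ι_op_smul, map_mul, ← add_mul, ← add_mul]
    exact J.mul_mem_right _ _ h

lemma alpha_beta_unique (hJ : IsNonhomQuadratic J) (q : relSpace J) {e : E} {r : k}
    (h : TAlg.m2 k E q + TAlg.ι k E e + TAlg.unit k E r ∈ J) :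
    alpha J q = e ∧ beta J q = r := by
  have h' := J.sub_mem (alpha_beta_mem J q) h
  have h2 := hJ.injective (alpha J q - e) (beta J q - r) (by
    convert h' using 1
    simp only [map_sub]
    abel)
  exact ⟨sub_eq_zero.1 h2.1, sub_eq_zero.1 h2.2⟩

lemma alpha_beta_add (hJ : IsNonhomQuadratic J) (q q' : relSub J) :
    alpha J (q + q' : relSub J) = alpha J q + alpha J q' ∧
      beta J (q + q' : relSub J) = beta J q + beta J q' :=
  alpha_beta_unique hJ _ (by
    convert J.add_mem (alpha_beta_mem J q) (alpha_beta_mem J q') using 1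
    change TAlg.m2 k E (q.1 + q'.1) + _ + _ = _
    simp only [map_add]
    abel)

lemma alpha_beta_smul (hJ : IsNonhomQuadratic J) (r : kᵐᵒᵖ) (q : relSub J) :
    alpha J (r • q : relSub J) = r • alpha J q ∧
      beta J (r • q : relSub J) = beta J q * r.unop := by
  induction r using MulOpposite.rec' with
  | h r =>
  refine alpha_beta_unique hJ _ ?_
  convert J.mul_mem_right _ (TAlg.unit k E r) (alpha_beta_mem J q) using 1
  change TAlg.m2 k E (MulOpposite.op r • q.1) + _ + _ = _
  rw [m2_op_smul, TAlg.ι_op_smul, MulOpposite.unop_op, map_mul, ← add_mul, ← add_mul]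

/-- `α` as a right linear map. -/
noncomputable def alphaLin (hJ : IsNonhomQuadratic J) : relSub J →ₗ[kᵐᵒᵖ] E where
  toFun q := alpha J q
  map_add' q q' := (alpha_beta_add hJ q q').1
  map_smul' r q := (alpha_beta_smul hJ r q).1

/-- `β` as a right linear map. -/
noncomputable def betaLin (hJ : IsNonhomQuadratic J) : relSub J →ₗ[kᵐᵒᵖ] k where
  toFun q := beta J q
  map_add' q q' := (alpha_beta_add hJ q q').2
  map_smul' r q := (alpha_beta_smul hJ r q).2

lemma KDual.m2_eq_zero {t : BTensor k (RDual k E) (RDual k E)} (ht : t ∈ perp (relSpace J)) :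
    KDual.m2 J t = 0 :=
  QAlg.mk_eq_zero _ (TwoSidedIdeal.subset_span ⟨t, ht, rfl⟩)

lemma KDual.Represents.eq {w : KDual J} {φ : relSpace J → k} (hw : KDual.Represents w φ)
    {t : BTensor k (RDual k E) (RDual k E)} (ht : ∀ q : relSpace J, pairing t q = φ q) :
    KDual.m2 J t = w := by
  obtain ⟨s, rfl, hs⟩ := hw
  rw [← sub_eq_zero, ← map_sub]
  refine KDual.m2_eq_zero fun q hq => ?_
  rw [map_sub, AddMonoidHom.sub_apply, ht ⟨q, hq⟩, hs ⟨q, hq⟩, sub_self]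

/-- The action of `(A^!)^2` on the pieces of a graded `A^!`-module. -/
def GrMod.act2 (I : GrMod (KDual.deg J)) (n : ℤ) (m : I.deg n) :
    BTensor k (RDual k E) (RDual k E) →+ I.deg (n + 1 + 1) :=
  AddMonoidHom.mk'
    (fun t => ⟨KDual.m2 J t • m.1, by
      have h := I.smul_mem (i := 2) (a := KDual.m2 J t) ⟨_, m2_mem t, rfl⟩ m.2
      rwa [Nat.cast_ofNat, ← one_add_one_eq_two, ← add_assoc] at h⟩)
    (fun t t' => Subtype.ext (by
      change KDual.m2 J (t + t') • m.1 = KDual.m2 J t • m.1 + KDual.m2 J t' • m.1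
      rw [map_add, add_smul]))

lemma GrMod.coe_act2 (I : GrMod (KDual.deg J)) (n : ℤ) (m : I.deg n)
    (t : BTensor k (RDual k E) (RDual k E)) :
    (I.act2 n m t : I.carrier) = KDual.m2 J t • m.1 := rfl

lemma GrMod.act2_tmul (I : GrMod (KDual.deg J)) (n : ℤ) (m : I.deg n) (f g : RDual k E) :
    I.act2 n m (tmul k f g) = I.act (n + 1) f (I.act n g m) :=
  Subtype.ext (by
    rw [GrMod.coe_act2, GrMod.coe_act, GrMod.coe_act, ← mul_smul]
    congr 1)

lemma GrMod.act2_smul (I : GrMod (KDual.deg J)) (n : ℤ) (m : I.deg n) (r : k)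
    (t : BTensor k (RDual k E) (RDual k E)) : I.act2 n m (r • t) = r • I.act2 n m t :=
  Subtype.ext (by
    rw [GrMod.coe_act2, GrMod.coe_smul, GrMod.coe_act2, ← mul_smul]
    congr 1
    change QAlg.mk _ (TAlg.m2 _ _ (r • t)) = _
    rw [m2_smul, map_mul]
    rfl)

end

variable {k E : Type u} [Ring k] [AddCommGroup E] [Module kᵐᵒᵖ E]

lemma exists_dualBasis (k W : Type u) [Ring k] [IsSemisimpleRing k] [AddCommGroup W]
    [Module kᵐᵒᵖ W] [Module.Finite kᵐᵒᵖ W] :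
    ∃ (n : ℕ) (x : Fin n → W) (f : Fin n → RDual k W),
      ∀ w, w = ∑ a, MulOpposite.op (f a w) • x a := by
  obtain ⟨n, p, hp⟩ := Module.Finite.exists_fin' kᵐᵒᵖ W
  have := Module.projective_of_isSemisimpleRing kᵐᵒᵖ W
  obtain ⟨s, hs⟩ := Module.projective_lifting_property p LinearMap.id hp
  refine ⟨n, fun a => p (Pi.single a 1), fun a =>
    ({ toFun := fun w => (s w a).unop
       map_add' := fun w w' => by simp
       map_smul' := fun r w => by simp } : W →ₗ[kᵐᵒᵖ] k), fun w => ?_⟩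
  have h : p (s w) = w := LinearMap.congr_fun hs w
  conv_lhs => rw [← h, ← Finset.univ_sum_single (s w), map_sum]
  refine Finset.sum_congr rfl fun a _ => ?_
  change _ = s w a • p (Pi.single a 1)
  rw [← map_smul, ← Pi.single_smul, smul_eq_mul, mul_one]

section

variable (k E) [IsSemisimpleRing k] [Module.Finite kᵐᵒᵖ E]

/-- The number of terms of a chosen expression `∑ x_a ⊗ x̂_a` of the coevaluation element
`c_E(1) ∈ E ⊗_k E^* = Hom_{-k}(E, E)`, which corresponds to the identity of `E`. -/
noncomputable def coevCard : ℕ := (exists_dualBasis k E).choose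

/-- The elements `x_a`. -/
noncomputable def coevVec : Fin (coevCard k E) → E := (exists_dualBasis k E).choose_spec.choose

/-- The elements `x̂_a`. -/
noncomputable def coevDual : Fin (coevCard k E) → RDual k E :=
  (exists_dualBasis k E).choose_spec.choose_spec.choose

variable {E}

lemma coev_spec (e : E) :
    e = ∑ a, MulOpposite.op (coevDual k E a e) • coevVec k E a :=
  (exists_dualBasis k E).choose_spec.choose_spec.choose_spec e

variable {k}

lemma coev_spec_dual (f : RDual k E) : f = ∑ a, f (coevVec k E a) • coevDual k E a := by
  ext e
  conv_lhs => rw [coev_spec k e, map_sum]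
  rw [RDual.sum_apply]
  exact Finset.sum_congr rfl fun a _ => RDual.map_op_smul _ _ _


variable [Module k E] [SMulCommClass k kᵐᵒᵖ E]

lemma coev_move {P : Type*} [AddCommGroup P] (G : E →+ RDual k E →+ P)
    (hG : ∀ e (r : k) f, G (MulOpposite.op r • e) f = G e (r • f)) (r : k) :
    ∑ a, G (r • coevVec k E a) (coevDual k E a)
      = ∑ a, G (coevVec k E a) (MulOpposite.op r • coevDual k E a) := by
  have h1 : ∀ a, G (r • coevVec k E a) (coevDual k E a)
      = ∑ b, G (coevVec k E b) (coevDual k E b (r • coevVec k E a) • coevDual k E a) := by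
    intro a
    conv_lhs => rw [coev_spec k (r • coevVec k E a), map_sum, AddMonoidHom.finsetSum_apply]
    exact Finset.sum_congr rfl fun b _ => hG _ _ _
  rw [Finset.sum_congr rfl fun a _ => h1 a, Finset.sum_comm]
  refine Finset.sum_congr rfl fun b _ => ?_
  rw [← map_sum]
  congr 1
  exact (coev_spec_dual (MulOpposite.op r • coevDual k E b)).symm

end

section

variable [IsSemisimpleRing k] [Module.Finite kᵐᵒᵖ E] [Module k E] [SMulCommClass k kᵐᵒᵖ E]
  {J : TwoSidedIdeal (TAlg k E)} {D : CDGA (KDual.deg J)}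

/-- The biadditive map `(u, m) ↦ ∑ u x_a ⊗ x̂_a m + u ⊗ d m`. -/
noncomputable def dFAux (I : CurvedModule D) (n : ℤ) :
    QAlg J →+ I.deg n →+ FDeg I.toGrMod (n + 1) :=
  AddMonoidHom.mk'
    (fun u => ∑ a, (tmulHom k (u * QAlg.ι J (coevVec k E a))).comp
        (I.act n (coevDual k E a))
      + (tmulHom k u).comp (I.dDeg n).toAddMonoidHom)
    (fun u v => by
      ext m
      simp only [AddMonoidHom.add_apply, AddMonoidHom.finsetSum_apply, AddMonoidHom.comp_apply,
        tmulHom_apply, add_mul, add_tmul, Finset.sum_add_distrib]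
      abel)

lemma dFAux_apply (I : CurvedModule D) (n : ℤ) (u : QAlg J) (m : I.deg n) :
    dFAux I n u m = ∑ a, tmul k (u * QAlg.ι J (coevVec k E a)) (I.act n (coevDual k E a) m)
      + tmul k u (I.dDeg n m) := by
  simp [dFAux, AddMonoidHom.finsetSum_apply]

lemma dFAux_balanced (I : CurvedModule D) (n : ℤ) (u : QAlg J) (r : k) (m : I.deg n) :
    dFAux I n (MulOpposite.op r • u) m = dFAux I n u (r • m) := by
  rw [dFAux_apply, dFAux_apply, map_smul, smul_tmul]
  congr 1
  let G : E →+ RDual k E →+ FDeg I.toGrMod (n + 1) :=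
    AddMonoidHom.mk' (fun x => (tmulHom k (u * QAlg.ι J x)).comp ((I.act n).flip m))
      (fun x y => by ext f; simp [mul_add])
  have hG := coev_move G (fun e s f => by
    change tmul k (u * QAlg.ι J _) (I.act n f m) = tmul k _ (I.act n (s • f) m)
    rw [QAlg.ι_op_smul, GrMod.smul_act, ← mul_assoc, ← QAlg.op_smul_def, smul_tmul]) r
  refine (Finset.sum_congr rfl fun a _ => ?_).trans (hG.trans
    (Finset.sum_congr rfl fun a _ => ?_))
  · change _ = tmul k (u * QAlg.ι J _) _
    rw [QAlg.ι_smul, QAlg.op_smul_def, mul_assoc]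
    rfl
  · change tmul k _ (I.act n _ m) = _
    rw [GrMod.act_smul]

/-- The differential of `F(I) = U ⊗_k I`, given by `u ⊗ m ↦ ∑ u x_a ⊗ x̂_a m + u ⊗ d m`. -/
noncomputable def dF (I : CurvedModule D) (n : ℤ) :
    FDeg I.toGrMod n →ₗ[k] FDeg I.toGrMod (n + 1) :=
  { BTensor.lift (dFAux I n) (dFAux_balanced I n) with
    map_smul' := fun r x => by
      change BTensor.lift (dFAux I n) (dFAux_balanced I n) (r • x)
        = r • BTensor.lift (dFAux I n) (dFAux_balanced I n) x
      induction x using BTensor.induction_on with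
      | h0 => simp
      | ha x y hx hy => rw [smul_add, map_add, hx, hy, map_add, smul_add]
      | ht u m =>
        rw [left_smul_tmul, lift_tmul, lift_tmul, dFAux_apply, dFAux_apply, smul_add,
          Finset.smul_sum, left_smul_tmul]
        congr 1
        refine Finset.sum_congr rfl fun a _ => ?_
        rw [left_smul_tmul, QAlg.smul_def, QAlg.smul_def, mul_assoc] }

lemma dF_tmul (I : CurvedModule D) (n : ℤ) (u : QAlg J) (m : I.deg n) :
    dF I n (tmul k u m) = ∑ a, tmul k (u * QAlg.ι J (coevVec k E a))
        (I.act n (coevDual k E a) m) + tmul k u (I.dDeg n m) :=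
  dFAux_apply I n u m

/-! The square of the differential of `F(I)` vanishes. -/

variable (k E) in
/-- The elements `x_a ⊗ x_b` of `E ⊗_k E`. -/
noncomputable def coevVec2 (c : Fin (coevCard k E) × Fin (coevCard k E)) : BTensor k E E :=
  tmul k (coevVec k E c.1) (coevVec k E c.2)

variable (k E) in
/-- The elements `x̂_b ⊗ x̂_a` of `E^* ⊗_k E^*`. -/
noncomputable def coevDual2 (c : Fin (coevCard k E) × Fin (coevCard k E)) :
    BTensor k (RDual k E) (RDual k E) :=
  tmul k (coevDual k E c.2) (coevDual k E c.1)

lemma coev_spec2 (w : BTensor k E E) :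
    w = ∑ c, MulOpposite.op (pairing (coevDual2 k E c) w) • coevVec2 k E c := by
  induction w using BTensor.induction_on with
  | h0 => simp
  | ha w w' h h' =>
    simp only [map_add, MulOpposite.op_add, add_smul, Finset.sum_add_distrib]
    rw [← h, ← h']
  | ht x y =>
    conv_lhs => rw [coev_spec k x, ← tmulHom_apply, map_sum, AddMonoidHom.finsetSum_apply]
    rw [Fintype.sum_prod_type]
    refine Finset.sum_congr rfl fun a _ => ?_
    rw [tmulHom_apply, smul_tmul]
    conv_lhs => rw [coev_spec k (coevDual k E a x • y), ← tmulHom_apply, map_sum]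
    rfl

/-- Any balanced map vanishing on `Q^⊥` takes the same value on the coevaluation element of
`E ⊗_k E` and on that of `Q`. -/
lemma exists_coev_rel (J : TwoSidedIdeal (TAlg k E)) :
    ∃ (n : ℕ) (q : Fin n → relSub J) (t : Fin n → BTensor k (RDual k E) (RDual k E)),
      (∀ φ : relSub J →ₗ[kᵐᵒᵖ] k, ∀ w : relSub J,
        pairing (∑ j, φ (q j) • t j) w = φ w) ∧
      ∀ {P : Type u} [AddCommGroup P]
        (Θ : BTensor k E E →+ BTensor k (RDual k E) (RDual k E) →+ P)
        (_ : ∀ w (r : k) t, Θ (MulOpposite.op r • w) t = Θ w (r • t))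
        (_ : ∀ w, ∀ t ∈ perp (relSpace J), Θ w t = 0),
        ∑ c, Θ (coevVec2 k E c) (coevDual2 k E c) = ∑ j, Θ (q j) (t j) := by
  obtain ⟨C, hC⟩ := exists_isCompl (relSub J)
  let p : BTensor k E E →ₗ[kᵐᵒᵖ] relSub J := Submodule.projectionOnto _ _ hC
  have hp : ∀ w : relSub J, p w = w := Submodule.projectionOnto_apply_left hC
  let e := Fintype.equivFin (Fin (coevCard k E) × Fin (coevCard k E))
  let pr (g : BTensor k E E → BTensor k E E)
      (j : Fin (coevCard k E) × Fin (coevCard k E)) : BTensor k (RDual k E) (RDual k E) :=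
    ∑ c, pairing (coevDual2 k E j) (g (coevVec2 k E c)) • coevDual2 k E c
  have hpr : ∀ (g : BTensor k E E →ₗ[kᵐᵒᵖ] BTensor k E E) j w,
      pairing (pr g j) w = pairing (coevDual2 k E j) (g w) := by
    intro g j w
    rw [pairing_sum]
    conv_rhs => rw [coev_spec2 w, map_sum, map_sum]
    refine Finset.sum_congr rfl fun c _ => ?_
    rw [map_smul, pairing_op_smul]
  have hw : ∀ w : relSub J,
      w = ∑ j, MulOpposite.op (pairing (coevDual2 k E j) w.1) • p (coevVec2 k E j) := by
    intro w
    conv_lhs => rw [← hp w, coev_spec2 w.1, map_sum]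
    exact Finset.sum_congr rfl fun c _ => map_smul _ _ _
  let p' : BTensor k E E →ₗ[kᵐᵒᵖ] BTensor k E E := (relSub J).subtype ∘ₗ p
  refine ⟨_, fun j => p (coevVec2 k E (e.symm j)), fun j => pr p' (e.symm j), ?_, ?_⟩
  · intro φ w
    rw [pairing_sum, ← Equiv.sum_comp e]
    conv_rhs => rw [hw w, map_sum]
    refine Finset.sum_congr rfl fun j _ => ?_
    rw [Equiv.symm_apply_apply, hpr, map_smul]
    change _ * pairing _ (p w.1).1 = _
    rw [hp]
    change φ (p (coevVec2 k E (e.symm (e j)))) * _ = φ (p (coevVec2 k E j)) * _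
    rw [Equiv.symm_apply_apply]
    rfl
  · intro P _ Θ hΘ hΘ0
    rw [← Equiv.sum_comp e]
    simp only [Equiv.symm_apply_apply]
    let g : BTensor k E E →ₗ[kᵐᵒᵖ] BTensor k E E := LinearMap.id - p'
    have hsum : ∀ (f : BTensor k E E →ₗ[kᵐᵒᵖ] BTensor k E E) (f' : BTensor k E E →ₗ[kᵐᵒᵖ]
        BTensor k E E) (_ : ∀ w, f' (f w) = f w),
        ∑ c, Θ (f (coevVec2 k E c)) (coevDual2 k E c)
          = ∑ j, Θ (f' (coevVec2 k E j)) (pr f j) := by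
      intro f f' hf
      have h1 : ∀ c, Θ (f (coevVec2 k E c)) (coevDual2 k E c) = ∑ j, Θ (f' (coevVec2 k E j))
          (pairing (coevDual2 k E j) (f (coevVec2 k E c)) • coevDual2 k E c) := by
        intro c
        conv_lhs => rw [← hf, coev_spec2 (f (coevVec2 k E c)), map_sum, map_sum,
          AddMonoidHom.finsetSum_apply]
        refine Finset.sum_congr rfl fun j _ => ?_
        rw [map_smul, hΘ]
      rw [Finset.sum_congr rfl fun c _ => h1 c, Finset.sum_comm]
      exact Finset.sum_congr rfl fun j _ => (map_sum _ _ _).symm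
    have hsplit : ∀ c, Θ (coevVec2 k E c) (coevDual2 k E c)
        = Θ (p' (coevVec2 k E c)) (coevDual2 k E c)
          + Θ (g (coevVec2 k E c)) (coevDual2 k E c) := by
      intro c
      rw [← AddMonoidHom.add_apply, ← map_add]
      simp [g]
    rw [Finset.sum_congr rfl fun c _ => hsplit c, Finset.sum_add_distrib,
      hsum p' p' (fun w => by
        change (p (p w).1).1 = _
        rw [hp]
        rfl),
      hsum g LinearMap.id (fun w => rfl)]
    refine (congrArg (_ + ·) (Finset.sum_eq_zero fun j _ => hΘ0 _ _ fun q hq => ?_)).trans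
      (add_zero _)
    rw [hpr]
    have : g q = 0 := by
      change q - (p q).1 = 0
      rw [hp ⟨q, hq⟩, sub_self]
    rw [this, map_zero]

lemma dF_dF_tmul (hJ : IsNonhomQuadratic J) (hD : IsKoszulDualStructure J D)
    (I : CurvedModule D) (n : ℤ) (u : QAlg J) (m : I.deg n) :
    dF I (n + 1) (dF I n (tmul k u m)) = 0 := by
  obtain ⟨N, q, t, ht, hΘ⟩ := exists_coev_rel J
  let mkm2 : BTensor k E E →+ QAlg J := (QAlg.mk J).toAddMonoidHom.comp (TAlg.m2 k E)
  let Θ : BTensor k E E →+ BTensor k (RDual k E) (RDual k E) →+ FDeg I.toGrMod (n + 1 + 1) :=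
    AddMonoidHom.mk' (fun w => (tmulHom k (u * mkm2 w)).comp (I.act2 n m))
      (fun w w' => by ext s; simp [mul_add])
  have hΘ' := hΘ Θ (fun w r s => by
      change tmul k (u * mkm2 _) (I.act2 n m s) = tmul k _ (I.act2 n m (r • s))
      rw [GrMod.act2_smul, ← smul_tmul, QAlg.op_smul_def, mul_assoc]
      congr 2
      change QAlg.mk J (TAlg.m2 k E _) = _
      rw [m2_op_smul, map_mul]
      rfl)
    (fun w s hs => by
      change tmul k _ (I.act2 n m s) = 0
      rw [show I.act2 n m s = 0 from Subtype.ext (by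
        rw [GrMod.coe_act2, KDual.m2_eq_zero hs, zero_smul]
        rfl), tmul_zero])
  have hq : ∀ j, mkm2 (q j) = - QAlg.ι J (alpha J (q j)) - QAlg.unit J (beta J (q j)) := by
    intro j
    have h := QAlg.mk_eq_zero J (alpha_beta_mem J (q j))
    rw [map_add, map_add] at h
    change mkm2 (q j) + QAlg.ι J _ + QAlg.unit J _ = 0 at h
    rw [← sub_eq_zero, ← h]
    abel
  have hα : ∀ j, tmul k (u * QAlg.ι J (alpha J (q j))) (I.act2 n m (t j))
      = ∑ a, tmul k (u * QAlg.ι J (coevVec k E a))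
          (I.act2 n m (coevDual k E a (alpha J (q j)) • t j)) := by
    intro j
    conv_lhs => rw [coev_spec k (alpha J (q j)), map_sum, Finset.mul_sum, ← tmulHom_apply,
      map_sum, AddMonoidHom.finsetSum_apply]
    refine Finset.sum_congr rfl fun a _ => ?_
    rw [tmulHom_apply, QAlg.ι_op_smul, ← mul_assoc, ← QAlg.op_smul_def, smul_tmul,
      GrMod.act2_smul]
  have hd : ∀ a, ∑ j, I.act2 n m (coevDual k E a (alpha J (q j)) • t j)
      = (⟨D.d (QAlg.ι _ (coevDual k E a)) • m.1, by
        have h := I.smul_mem (D.d_mem (QAlg.ι_mem (coevDual k E a))) m.2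
        rwa [show n + ((1 + 1 : ℕ) : ℤ) = n + 1 + 1 by push_cast; ring] at h⟩ :
          I.deg (n + 1 + 1)) := by
    intro a
    rw [← map_sum]
    refine Subtype.ext ?_
    rw [GrMod.coe_act2]
    congr 1
    refine (hD.d_eq (coevDual k E a)).eq fun w => ?_
    exact ht ((coevDual k E a : E →ₗ[kᵐᵒᵖ] k) ∘ₗ alphaLin hJ) w
  have hc : ∑ j, I.act2 n m (beta J (q j) • t j)
      = (⟨D.c • m.1, by
        have h := I.smul_mem D.c_mem m.2
        rwa [show n + ((2 : ℕ) : ℤ) = n + 1 + 1 by push_cast; ring] at h⟩ :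
          I.deg (n + 1 + 1)) := by
    rw [← map_sum]
    refine Subtype.ext ?_
    rw [GrMod.coe_act2]
    congr 1
    exact hD.c_eq.eq fun w => ht (betaLin hJ) w
  have hsum : ∑ c, Θ (coevVec2 k E c) (coevDual2 k E c)
      = - (∑ a, tmul k (u * QAlg.ι J (coevVec k E a))
            (∑ j, I.act2 n m (coevDual k E a (alpha J (q j)) • t j)))
        - tmul k u (∑ j, I.act2 n m (beta J (q j) • t j)) := by
    rw [hΘ']
    have h1 : ∀ j, Θ (q j) (t j) = - (∑ a, tmul k (u * QAlg.ι J (coevVec k E a))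
          (I.act2 n m (coevDual k E a (alpha J (q j)) • t j)))
        - tmul k u (I.act2 n m (beta J (q j) • t j)) := by
      intro j
      change tmulHom k (u * mkm2 (q j)) (I.act2 n m (t j)) = _
      rw [hq, mul_sub, mul_neg, map_sub, map_neg, AddMonoidHom.sub_apply,
        AddMonoidHom.neg_apply, tmulHom_apply, tmulHom_apply, hα, ← QAlg.op_smul_def, smul_tmul,
        GrMod.act2_smul]
    rw [Finset.sum_congr rfl fun j _ => h1 j, Finset.sum_sub_distrib, Finset.sum_neg_distrib,
      Finset.sum_comm]
    simp only [← tmulHom_apply, map_sum]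
  rw [hc, Finset.sum_congr rfl fun a _ => congrArg (tmul k (u * QAlg.ι J (coevVec k E a))) (hd a)]
    at hsum
  rw [dF_tmul, map_add, map_sum, dF_tmul]
  have h2 : ∀ a, dF I (n + 1) (tmul k (u * QAlg.ι J (coevVec k E a))
        (I.act n (coevDual k E a) m))
      = ∑ b, Θ (coevVec2 k E (a, b)) (coevDual2 k E (a, b))
        + tmul k (u * QAlg.ι J (coevVec k E a)) (I.dDeg (n + 1) (I.act n (coevDual k E a) m)) := by
    intro a
    rw [dF_tmul]
    congr 1
    refine Finset.sum_congr rfl fun b _ => ?_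
    rw [← GrMod.act2_tmul, mul_assoc]
    congr 2
  rw [Finset.sum_congr rfl fun a _ => h2 a, Finset.sum_add_distrib, ← Fintype.sum_prod_type',
    hsum]
  have h3 : ∀ a, I.dDeg (n + 1) (I.act n (coevDual k E a) m)
      = (⟨D.d (QAlg.ι _ (coevDual k E a)) • m.1, by
        have h := I.smul_mem (D.d_mem (QAlg.ι_mem (coevDual k E a))) m.2
        rwa [show n + ((1 + 1 : ℕ) : ℤ) = n + 1 + 1 by push_cast; ring] at h⟩ :
          I.deg (n + 1 + 1)) - I.act (n + 1) (coevDual k E a) (I.dDeg n m) := by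
    intro a
    refine Subtype.ext ?_
    change I.d (QAlg.ι _ (coevDual k E a) • m.1) = D.d (QAlg.ι _ (coevDual k E a)) • m.1
      - QAlg.ι _ (coevDual k E a) • I.d m.1
    rw [I.leibniz _ (QAlg.ι_mem (coevDual k E a)), pow_one, neg_one_mul, neg_smul, sub_eq_add_neg]
  have h4 : I.dDeg (n + 1) (I.dDeg n m) = (⟨D.c • m.1, by
        have h := I.smul_mem D.c_mem m.2
        rwa [show n + ((2 : ℕ) : ℤ) = n + 1 + 1 by push_cast; ring] at h⟩ :
          I.deg (n + 1 + 1)) := Subtype.ext (I.d_d m.1)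
  rw [h4]
  simp only [h3, ← tmulHom_apply, map_sub, Finset.sum_sub_distrib]
  abel

lemma dF_dF (hJ : IsNonhomQuadratic J) (hD : IsKoszulDualStructure J D)
    (I : CurvedModule D) (n : ℤ) (x : FDeg I.toGrMod n) : dF I (n + 1) (dF I n x) = 0 := by
  induction x using BTensor.induction_on with
  | h0 => simp
  | ha x y hx hy => rw [map_add, map_add, hx, hy, add_zero]
  | ht u m => exact dF_dF_tmul hJ hD I n u m

/-- The complex of `k`-modules `F(I) = U ⊗_k I`. -/
noncomputable def FComplex (hJ : IsNonhomQuadratic J) (hD : IsKoszulDualStructure J D)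
    (I : CurvedModule D) : CochainComplex (ModuleCat.{u} k) ℤ :=
  CochainComplex.of (fun n => ModuleCat.of k (FDeg I.toGrMod n))
    (fun n => ModuleCat.ofHom (dF I n))
    (fun n => by
      ext x
      exact dF_dF hJ hD I n x)

/-- The map `S(I)^n → F(I)^n`, `m ↦ 1 ⊗ m`. -/
noncomputable def socleToFDeg (I : CurvedModule D) (n : ℤ) :
    socle I.toGrMod n →ₗ[k] FDeg I.toGrMod n where
  toFun m := tmul k 1 m.1
  map_add' m m' := tmul_add k _ _ _
  map_smul' r m := by
    rw [RingHom.id_apply, left_smul_tmul, QAlg.smul_def, mul_one]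
    change tmul k 1 (r • m.1) = _
    rw [← smul_tmul, QAlg.op_smul_def, one_mul]

lemma dF_socleToFDeg (I : CurvedModule D) (n : ℤ) (m : socle I.toGrMod n) :
    dF I n (socleToFDeg I n m)
      = socleToFDeg I (n + 1) ((I.dDeg n).restrict (I.dDeg_mem n) m) := by
  change dF I n (tmul k 1 m.1) = tmul k 1 (I.dDeg n m.1)
  rw [dF_tmul]
  refine (congrArg (· + _) (Finset.sum_eq_zero fun a _ => ?_)).trans (zero_add _)
  rw [show I.act n (coevDual k E a) m.1 = 0 from
    Subtype.ext (m.2 1 one_pos _ (QAlg.ι_mem (coevDual k E a))), tmul_zero]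

/-- The morphism of complexes `S(I) → F(I)`, `m ↦ 1 ⊗ m`. -/
noncomputable def socleToF (hJ : IsNonhomQuadratic J) (hD : IsKoszulDualStructure J D)
    (I : CurvedModule D) : socleComplex I ⟶ FComplex hJ hD I :=
  CochainComplex.ofHom (fun n => ModuleCat.ofHom (socleToFDeg I n)) (fun n => by
    simp only [socleComplex, FComplex, CochainComplex.of_d]
    ext m
    exact dF_socleToFDeg I n m)

end

end FComplex

end NHKoszul

/-! Filter `U` by degree. Once `gr U = A` is known, the graded pieces of `U ⊗ I` form the Koszul
complex `A ⊗ I` with differential `a ⊗ m ↦ ∑ a x_b ⊗ x̂_b m`; the term `u ⊗ d m` does not raise the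
filtration and disappears. For a graded injective `I` this complex is exact in positive `A`-degree,
and its kernel in `A`-degree zero is the socle. A cocycle of `U ⊗ I` can therefore be pushed down
the filtration by coboundaries until it has the form `1 ⊗ m` with `m` in `S(I)`
(`exists_eq_dF_add`). Both complexes respect homotopies, which extends the result to all of `K(Inj
A^!)`.

Koszulness enters through one fact, `kosD_exact`: the complex `A ⊗ ((A^!)^i)^*` is exact in degrees
`i ≥ 1`. It is obtained by identifying the generators of the given linear resolution, one degree
after another, with `((A^!)^i)^*`; the linear part of the Koszul complex is exact for any quadratic
algebra, and the linear part determines a linear resolution. Since `k` is semisimple, dualizing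
gives exactness of the complex of right linear maps `A → A^!` (`exists_of_cocycle`), which is used
twice.

The first use is `gr U = A` (`relFilt_inf_low_le`, `comp_mem_quadIdeal_of_mem`). It says that
relations among relations create no new relations of lower degree. By duality, this amounts to
extending functionals which kill the relations of filtration degree `n` to functionals which kill
those of degree `n + 1`. The obstruction is a map from `A_n` to `(A^!)^2`; the curved structure of
`A^!` shows that it is a cocycle, and exactness makes it a coboundary, which supplies the
correction.

The second use is exactness of `A ⊗ I`. As `A_j` is finitely generated projective over `k`, `A_j ⊗
I^n` is the group of graded `A^!`-linear maps from a shift of `Hom_{-k}(A_j, A^!)` to `I`;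
injectivity of `I` turns exactness of the complex of these `Hom` modules into exactness of `A ⊗ I`
(`exists_kosI_eq`).

The curved structure needs no Koszulness. A functional on `(A^!)^3` is an element `z` of `(Q ⊗ E) ∩
(E ⊗ Q)`. Multiplying the relations `q + α(q) + β(q)` by `E` on either side and subtracting cancels
the cubic term `z` and leaves an element of `J ∩ F_2`. So `γ = (α ⊗ 1 - 1 ⊗ α) z` lies in `Q`, with
`α(γ) = (β ⊗ 1 - 1 ⊗ β) z` and `β(γ) = 0` (`exists_relation_of_cog`). Dually, these three facts say
that `d` respects `Q^⊥`, that `d² = [c, ·]` and that `d(c) = 0`. -/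

namespace NHKoszul

open scoped TensorProduct
open BTensor

/-! ## Universal properties -/

section Lift

variable {k V : Type u} [Ring k] [AddCommGroup V] [Module k V] [Module kᵐᵒᵖ V]

namespace TAlg

/-- The universal property of the tensor algebra. -/
def lift {R : Type*} [Ring R] (f : k →+* R) (g : V →+ R) (hl : ∀ r x, g (r • x) = f r * g x)
    (hr : ∀ r x, g (MulOpposite.op r • x) = g x * f r) : TAlg k V →+* R :=
  RingQuot.lift ⟨(FreeAlgebra.lift ℤ (Sum.elim f g)).toRingHom, by
    intro a b h
    induction h with
    | one => simp
    | add => simp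
    | mul => simp
    | vadd => simp
    | left => simp [hl]
    | right => simp [hr]⟩

section

variable {R : Type*} [Ring R] (f : k →+* R) (g : V →+ R) (hl : ∀ r x, g (r • x) = f r * g x)
    (hr : ∀ r x, g (MulOpposite.op r • x) = g x * f r)

@[simp] lemma lift_unit (r : k) : lift f g hl hr (unit k V r) = f r :=
  (RingQuot.lift_mkRingHom_apply _ _ _).trans (by simp)

@[simp] lemma lift_ι (x : V) : lift f g hl hr (ι k V x) = g x :=
  (RingQuot.lift_mkRingHom_apply _ _ _).trans (by simp)

end

/-- The tensor algebra is generated by `k` under addition and right multiplication by elements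
of `V`. -/
@[elab_as_elim]
lemma induction_right {P : TAlg k V → Prop} (t : TAlg k V) (unit : ∀ r, P (unit k V r))
    (add : ∀ s t, P s → P t → P (s + t)) (mul_ι : ∀ t x, P t → P (t * ι k V x)) : P t := by
  -- `P` is not visibly stable under right multiplication by `k`. Building this stability into the
  -- predicate works because `v r` is again an element of `V`.
  let P' (t : TAlg k V) : Prop := ∀ r, P (t * TAlg.unit k V r)
  have h : ∀ w : FreeAlgebra ℤ (k ⊕ V), ∀ s, P' s → P' (s * proj k V w) := by
    intro w
    induction w with
    | grade0 n =>
      intro s hs r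
      have : proj k V (algebraMap ℤ _ n) = TAlg.unit k V n := by simp
      rw [this, mul_assoc, ← map_mul]
      exact hs _
    | grade1 x =>
      intro s hs r
      rcases x with a | x
      · change P (s * TAlg.unit k V a * TAlg.unit k V r)
        rw [mul_assoc, ← map_mul]
        exact hs _
      · change P (s * ι k V x * TAlg.unit k V r)
        rw [mul_assoc, ← ι_op_smul]
        refine mul_ι _ _ ?_
        simpa using hs 1
    | mul a b ha hb =>
      intro s hs
      rw [map_mul, ← mul_assoc]
      exact hb _ (ha _ hs)
    | add a b ha hb =>
      intro s hs r
      rw [map_add, mul_add, add_mul]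
      exact add _ _ (ha _ hs r) (hb _ hs r)
  obtain ⟨w, rfl⟩ : ∃ w, proj k V w = t := RingQuot.mkRingHom_surjective _ t
  have := h w 1 (fun r => by simpa using unit r) 1
  simpa using this

lemma hom_ext {R : Type*} [Ring R] {f g : TAlg k V →+* R}
    (h : ∀ r, f (unit k V r) = g (unit k V r)) (h' : ∀ x, f (ι k V x) = g (ι k V x)) : f = g := by
  ext t
  induction t using induction_right with
  | unit r => exact h r
  | add s t hs ht => rw [map_add, map_add, hs, ht]
  | mul_ι t x ht => rw [map_mul, map_mul, ht, h']

end TAlg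

namespace QAlg

variable (J : TwoSidedIdeal (TAlg k V))

lemma mk_surjective : Function.Surjective (mk J) := Quotient.mk''_surjective

lemma mk_eq_zero_iff {t : TAlg k V} : mk J t = 0 ↔ t ∈ J :=
  ⟨fun h => by
    have h' : mk J t = mk J 0 := by rw [h, map_zero]
    simpa using (J.rel_iff _ _).1 (Quotient.exact h'), mk_eq_zero J⟩

/-- Ring homomorphisms out of `T_k(V)/J`. -/
def lift {R : Type*} [Ring R] (f : TAlg k V →+* R) (hf : ∀ t ∈ J, f t = 0) : QAlg J →+* R :=
  J.ringCon.lift f (fun s t h => by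
    change f s = f t
    rw [← sub_eq_zero, ← map_sub]
    exact hf _ ((J.rel_iff _ _).1 h))

@[simp] lemma lift_mk {R : Type*} [Ring R] (f : TAlg k V →+* R) (hf : ∀ t ∈ J, f t = 0)
    (t : TAlg k V) : lift J f hf (mk J t) = f t := rfl

lemma mk_unit (r : k) : mk J (TAlg.unit k V r) = unit J r := rfl

lemma mk_ι (x : V) : mk J (TAlg.ι k V x) = ι J x := rfl

variable {J}

@[elab_as_elim]
lemma induction_right {P : QAlg J → Prop} (a : QAlg J) (unit : ∀ r, P (unit J r))
    (add : ∀ a b, P a → P b → P (a + b)) (mul_ι : ∀ a x, P a → P (a * ι J x)) : P a := by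
  obtain ⟨t, rfl⟩ := mk_surjective J a
  induction t using TAlg.induction_right with
  | unit r => exact unit r
  | add s t hs ht => rw [map_add]; exact add _ _ hs ht
  | mul_ι t x ht => rw [map_mul]; exact mul_ι _ _ ht

end QAlg

lemma quadIdeal_le_iff {Q : AddSubgroup (BTensor k V V)} {I : TwoSidedIdeal (TAlg k V)} :
    (∀ t ∈ quadIdeal Q, t ∈ I) ↔ ∀ q ∈ Q, TAlg.m2 k V q ∈ I :=
  (TwoSidedIdeal.span_le (I := I)).trans
    ⟨fun h q hq => h ⟨q, hq, rfl⟩, by rintro h _ ⟨q, hq, rfl⟩; exact h q hq⟩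

lemma map_eq_zero_of_mem_quadIdeal {Q : AddSubgroup (BTensor k V V)} {R : Type*} [Ring R]
    (f : TAlg k V →+* R) (hf : ∀ q ∈ Q, f (TAlg.m2 k V q) = 0) {t : TAlg k V}
    (ht : t ∈ quadIdeal Q) : f t = 0 :=
  (TwoSidedIdeal.mem_ker f).1 (quadIdeal_le_iff.2
    (fun q hq => (TwoSidedIdeal.mem_ker f).2 (hf q hq)) t ht)

lemma m2_mem_quadIdeal {Q : AddSubgroup (BTensor k V V)} {q : BTensor k V V} (hq : q ∈ Q) :
    TAlg.m2 k V q ∈ quadIdeal Q :=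
  TwoSidedIdeal.subset_span ⟨q, hq, rfl⟩

/-! ## Gradings -/

namespace TAlg

variable (k V) in
/-- The grading of `T_k(V)`, as a ring homomorphism `t ↦ ∑ tₙ Xⁿ`. -/
noncomputable def toPoly : TAlg k V →+* Polynomial (TAlg k V) :=
  lift (Polynomial.C.comp (unit k V))
    (AddMonoidHom.mk' (fun x => Polynomial.C (ι k V x) * Polynomial.X)
      (fun x y => by simp [add_mul]))
    (fun r x => by simp [ι_smul, mul_assoc])
    (fun r x => by simp [ι_op_smul, mul_assoc, Polynomial.X_mul_C])

lemma toPoly_unit (r : k) : toPoly k V (unit k V r) = Polynomial.C (unit k V r) := by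
  simp [toPoly]

lemma toPoly_ι (x : V) : toPoly k V (ι k V x) = Polynomial.C (ι k V x) * Polynomial.X := by
  simp [toPoly]

/-- The projections to the homogeneous components. -/
noncomputable def comp (n : ℕ) : TAlg k V →+ TAlg k V :=
  AddMonoidHom.mk' (fun t => (toPoly k V t).coeff n) (fun s t => by simp)

lemma comp_apply (n : ℕ) (t : TAlg k V) : comp n t = (toPoly k V t).coeff n := rfl

lemma comp_zero_unit (r : k) : comp 0 (unit k V r) = unit k V r := by
  simp [comp_apply, toPoly_unit]

lemma comp_succ_unit (n : ℕ) (r : k) : comp (n + 1) (unit k V r) = 0 := by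
  simp [comp_apply, toPoly_unit]

lemma comp_zero_mul_ι (t : TAlg k V) (x : V) : comp 0 (t * ι k V x) = 0 := by
  simp [comp_apply, toPoly_ι, ← mul_assoc]

lemma comp_succ_mul_ι (n : ℕ) (t : TAlg k V) (x : V) :
    comp (n + 1) (t * ι k V x) = comp n t * ι k V x := by
  simp [comp_apply, toPoly_ι, ← mul_assoc]

lemma comp_mul_unit (n : ℕ) (t : TAlg k V) (r : k) :
    comp n (t * unit k V r) = comp n t * unit k V r := by
  simp [comp_apply, toPoly_unit]

lemma comp_unit_mul (n : ℕ) (t : TAlg k V) (r : k) :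
    comp n (unit k V r * t) = unit k V r * comp n t := by
  simp [comp_apply, toPoly_unit]

lemma unit_mem (r : k) : unit k V r ∈ deg k V 0 :=
  AddSubgroup.subset_closure ⟨r, [], rfl, by simp⟩

lemma mul_ι_mem {n : ℕ} {t : TAlg k V} (ht : t ∈ deg k V n) (x : V) :
    t * ι k V x ∈ deg k V (n + 1) := by
  induction ht using AddSubgroup.closure_induction with
  | zero => rw [zero_mul]; exact zero_mem _
  | add x y _ _ hx hy => rw [add_mul]; exact add_mem hx hy
  | neg x _ hx => rw [neg_mul]; exact neg_mem hx
  | mem y hy =>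
    obtain ⟨s, l, hl, rfl⟩ := hy
    exact AddSubgroup.subset_closure ⟨s, l ++ [x], by simp [hl], by simp [mul_assoc]⟩

lemma comp_mem (n : ℕ) (t : TAlg k V) : comp n t ∈ deg k V n := by
  induction t using induction_right generalizing n with
  | unit r =>
    cases n with
    | zero => rw [comp_zero_unit]; exact unit_mem r
    | succ n => rw [comp_succ_unit]; exact zero_mem _
  | add s t hs ht => rw [map_add]; exact add_mem (hs n) (ht n)
  | mul_ι t x ht =>
    cases n with
    | zero => rw [comp_zero_mul_ι]; exact zero_mem _
    | succ n => rw [comp_succ_mul_ι]; exact mul_ι_mem (ht n) x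

lemma toPoly_of_mem {n : ℕ} {t : TAlg k V} (ht : t ∈ deg k V n) :
    toPoly k V t = Polynomial.monomial n t := by
  induction ht using AddSubgroup.closure_induction with
  | zero => simp
  | add x y _ _ hx hy => rw [map_add, map_add, hx, hy]
  | neg x _ hx => rw [map_neg, map_neg, hx]
  | mem y hy =>
    obtain ⟨s, l, hl, rfl⟩ := hy
    induction l using List.reverseRecOn generalizing n with
    | nil =>
      obtain rfl : 0 = n := hl
      simp [toPoly_unit]
    | append_singleton l x ih =>
      obtain rfl : l.length + 1 = n := by simpa using hl
      rw [List.map_append, List.prod_append, ← mul_assoc, map_mul, ih rfl]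
      simp [toPoly_ι, ← mul_assoc, Polynomial.monomial_mul_C, Polynomial.monomial_mul_X]

lemma comp_of_mem {n : ℕ} {t : TAlg k V} (ht : t ∈ deg k V n) : comp n t = t := by
  simp [comp_apply, toPoly_of_mem ht]

lemma comp_of_mem_ne {n m : ℕ} {t : TAlg k V} (ht : t ∈ deg k V n) (h : m ≠ n) :
    comp m t = 0 := by
  simp [comp_apply, toPoly_of_mem ht, Polynomial.coeff_monomial, h.symm]

/-- Setting `X = 1` forgets the grading. This is how an element is recovered as the sum of its
components. -/
lemma eval_toPoly (t : TAlg k V) : (toPoly k V t).eval 1 = t := by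
  let e := Polynomial.eval₂RingHom' (RingHom.id (TAlg k V)) 1 (fun a => Commute.one_right a)
  have h : e.comp (toPoly k V) = RingHom.id _ :=
    hom_ext (fun r => by simp [toPoly_unit, e]) (fun x => by simp [toPoly_ι, e])
  exact RingHom.congr_fun h t

lemma exists_sum_comp (t : TAlg k V) :
    ∃ N, (∀ n ≥ N, comp n t = 0) ∧ t = ∑ n ∈ Finset.range N, comp n t := by
  refine ⟨(toPoly k V t).natDegree + 1, fun n hn =>
    Polynomial.coeff_eq_zero_of_natDegree_lt hn, ?_⟩
  conv_lhs => rw [← eval_toPoly t, Polynomial.eval_eq_sum_range]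
  simp [comp_apply]

lemma deg_le_filt {n p : ℕ} (h : n ≤ p) : deg k V n ≤ filt k V p :=
  le_iSup₂_of_le (f := fun i _ => deg k V i) n h le_rfl

lemma mem_filt_iff {p : ℕ} {t : TAlg k V} : t ∈ filt k V p ↔ ∀ n > p, comp n t = 0 := by
  constructor
  · intro h n hn
    have : filt k V p ≤ (comp n : TAlg k V →+ TAlg k V).ker :=
      iSup₂_le fun i hi t ht => comp_of_mem_ne ht (by
        have : i ≤ p := hi
        omega)
    exact this h
  · intro h
    obtain ⟨N, -, hN⟩ := exists_sum_comp t
    rw [hN]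
    refine sum_mem fun n _ => ?_
    by_cases hn : n ≤ p
    · exact deg_le_filt hn (comp_mem n t)
    · rw [h n (by omega)]
      exact zero_mem _

lemma comp_m2 (q : BTensor k V V) : toPoly k V (m2 k V q)
    = Polynomial.C (m2 k V q) * Polynomial.X ^ 2 := by
  induction q using BTensor.induction_on with
  | h0 => simp
  | ha x y hx hy => simp [hx, hy, add_mul]
  | ht x y =>
    rw [m2_tmul, map_mul, toPoly_ι, toPoly_ι, map_mul, mul_assoc, ← mul_assoc Polynomial.X,
      Polynomial.X_mul_C, pow_two]
    simp only [mul_assoc]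

end TAlg

namespace QAlg

variable {Q : AddSubgroup (BTensor k V V)}

variable (Q) in
/-- The grading of a quadratic algebra, as a ring homomorphism `a ↦ ∑ aₙ Xⁿ`. -/
noncomputable def toPoly :
    QAlg (quadIdeal Q) →+* Polynomial (QAlg (quadIdeal Q)) :=
  lift _ ((Polynomial.mapRingHom (mk (quadIdeal Q))).comp (TAlg.toPoly k V)) fun t ht =>
    map_eq_zero_of_mem_quadIdeal _ (fun q hq => by
      simp [TAlg.comp_m2, mk_eq_zero _ (m2_mem_quadIdeal hq)]) ht

/-- The projections to the homogeneous components. -/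
noncomputable def comp (n : ℕ) : QAlg (quadIdeal Q) →+ QAlg (quadIdeal Q) :=
  AddMonoidHom.mk' (fun t => (toPoly Q t).coeff n) (fun s t => by simp)

lemma comp_mk (n : ℕ) (t : TAlg k V) :
    comp n (mk (quadIdeal Q) t) = mk (quadIdeal Q) (TAlg.comp n t) := by
  change (toPoly Q _).coeff n = _
  simp [toPoly, TAlg.comp_apply]

lemma comp_zero_unit (r : k) : comp 0 (unit (quadIdeal Q) r) = unit (quadIdeal Q) r := by
  rw [← mk_unit, comp_mk, TAlg.comp_zero_unit]

lemma comp_succ_unit (n : ℕ) (r : k) : comp (n + 1) (unit (quadIdeal Q) r) = 0 := by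
  rw [← mk_unit, comp_mk, TAlg.comp_succ_unit, map_zero]

lemma comp_zero_mul_ι (a : QAlg (quadIdeal Q)) (x : V) :
    comp 0 (a * ι (quadIdeal Q) x) = 0 := by
  obtain ⟨t, rfl⟩ := mk_surjective _ a
  rw [← mk_ι, ← map_mul, comp_mk, TAlg.comp_zero_mul_ι, map_zero]

lemma comp_succ_mul_ι (n : ℕ) (a : QAlg (quadIdeal Q)) (x : V) :
    comp (n + 1) (a * ι (quadIdeal Q) x) = comp n a * ι (quadIdeal Q) x := by
  obtain ⟨t, rfl⟩ := mk_surjective _ a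
  rw [← mk_ι, ← map_mul, comp_mk, TAlg.comp_succ_mul_ι, map_mul, comp_mk]

lemma comp_mul_unit (n : ℕ) (a : QAlg (quadIdeal Q)) (r : k) :
    comp n (a * unit (quadIdeal Q) r) = comp n a * unit (quadIdeal Q) r := by
  obtain ⟨t, rfl⟩ := mk_surjective _ a
  rw [← mk_unit, ← map_mul, comp_mk, TAlg.comp_mul_unit, map_mul, comp_mk]

lemma comp_unit_mul (n : ℕ) (a : QAlg (quadIdeal Q)) (r : k) :
    comp n (unit (quadIdeal Q) r * a) = unit (quadIdeal Q) r * comp n a := by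
  obtain ⟨t, rfl⟩ := mk_surjective _ a
  rw [← mk_unit, ← map_mul, comp_mk, TAlg.comp_unit_mul, map_mul, comp_mk]

lemma mul_ι_mem {J : TwoSidedIdeal (TAlg k V)} {n : ℕ} {a : QAlg J} (ha : a ∈ deg J n) (x : V) :
    a * ι J x ∈ deg J (n + 1) := by
  obtain ⟨t, ht, rfl⟩ := ha
  exact ⟨_, TAlg.mul_ι_mem ht x, map_mul (mk J) _ _⟩

lemma comp_mem (n : ℕ) (a : QAlg (quadIdeal Q)) : comp n a ∈ deg (quadIdeal Q) n := by
  obtain ⟨t, rfl⟩ := mk_surjective _ a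
  rw [comp_mk]
  exact ⟨_, TAlg.comp_mem n t, rfl⟩

lemma comp_of_mem {n : ℕ} {a : QAlg (quadIdeal Q)} (ha : a ∈ deg (quadIdeal Q) n) :
    comp n a = a := by
  obtain ⟨t, ht, rfl⟩ := ha
  exact (comp_mk n t).trans (by rw [TAlg.comp_of_mem ht]; rfl)

lemma comp_of_mem_ne {n m : ℕ} {a : QAlg (quadIdeal Q)} (ha : a ∈ deg (quadIdeal Q) n)
    (h : m ≠ n) : comp m a = 0 := by
  obtain ⟨t, ht, rfl⟩ := ha
  exact (comp_mk m t).trans (by rw [TAlg.comp_of_mem_ne ht h, map_zero])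

lemma exists_sum_comp (a : QAlg (quadIdeal Q)) :
    ∃ N, (∀ n ≥ N, comp n a = 0) ∧ a = ∑ n ∈ Finset.range N, comp n a := by
  obtain ⟨t, rfl⟩ := mk_surjective _ a
  obtain ⟨N, h, h'⟩ := TAlg.exists_sum_comp t
  refine ⟨N, fun n hn => by rw [comp_mk, h n hn, map_zero], ?_⟩
  conv_lhs => rw [h', map_sum]
  simp only [comp_mk]

end QAlg

/-! ## Additive maps out of quadratic algebras -/

variable [SMulCommClass k kᵐᵒᵖ V]

/-- A balanced biadditive map `ω : B × V → K` determines an additive map `t v ↦ ω(t, v)` out of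
the tensor algebra. -/
lemma TAlg.exists_hom {B : Type*} [Ring B] (π : TAlg k V →+* B) {K : Type*} [AddCommGroup K]
    (ω : B →+ V →+ K) (hω : ∀ b r v, ω (b * π (unit k V r)) v = ω b (r • v)) :
    ∃ (φ : TAlg k V →+ K) (ψ : TAlg k V →+* (AddMonoid.End (B × (k →+ K)))ᵐᵒᵖ),
      (∀ t v, φ (t * ι k V v) = ω (π t) v) ∧ (∀ r, φ (unit k V r) = 0) ∧
      (∀ t, φ t = ((ψ t).unop (1, 0)).2 1) ∧
      (∀ v p, (ψ (ι k V v)).unop p = (p.1 * π (ι k V v),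
        (ω p.1).comp (AddMonoidHom.mk' (fun s : k => MulOpposite.op s • v)
          (fun s s' => by simp [add_smul])))) := by
  -- The map is built as the output of a right action of `T_k(V)` on pairs `(b, h)`: the first entry
  -- records the image of the word read so far, and `h(s)` is the value after one more
  -- multiplication by the scalar `s`. A scalar `r` acts by `(b r, h(r ·))` and a vector `v` by `(b
  -- v, s ↦ ω(b, v s))`. The value `φ t` is read off from `(1, 0) · t`.
  let act (r : k) : AddMonoid.End (B × (k →+ K)) :=
    AddMonoidHom.mk' (fun p => (p.1 * π (unit k V r), p.2.comp (AddMonoidHom.mulLeft r)))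
      (fun p p' => Prod.ext (add_mul _ _ _) (by ext; simp))
  let f : k →+* (AddMonoid.End (B × (k →+ K)))ᵐᵒᵖ :=
    { toFun := fun r => MulOpposite.op (act r)
      map_one' := MulOpposite.unop_injective (AddMonoidHom.ext fun p => Prod.ext (by
        change p.1 * π (unit k V 1) = p.1
        simp) (by
        ext s
        change p.2 (1 * s) = p.2 s
        rw [one_mul]))
      map_mul' := fun r s => MulOpposite.unop_injective (AddMonoidHom.ext fun p => Prod.ext (by
        change p.1 * π (unit k V (r * s)) = p.1 * π (unit k V r) * π (unit k V s)
        simp [mul_assoc]) (by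
        ext z
        change p.2 (r * s * z) = p.2 (r * (s * z))
        rw [mul_assoc]))
      map_zero' := MulOpposite.unop_injective (AddMonoidHom.ext fun p => Prod.ext (by
        change p.1 * π (unit k V 0) = 0
        simp) (by
        ext z
        change p.2 (0 * z) = 0
        simp))
      map_add' := fun r s => MulOpposite.unop_injective (AddMonoidHom.ext fun p => Prod.ext (by
        change p.1 * π (unit k V (r + s)) = p.1 * π (unit k V r) + p.1 * π (unit k V s)
        simp [mul_add]) (by
        ext z
        change p.2 ((r + s) * z) = p.2 (r * z) + p.2 (s * z)
        simp [add_mul])) }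
  let act' (v : V) : AddMonoid.End (B × (k →+ K)) :=
    AddMonoidHom.mk' (fun p => (p.1 * π (ι k V v), (ω p.1).comp
        (AddMonoidHom.mk' (fun s : k => MulOpposite.op s • v) (fun s s' => by simp [add_smul]))))
      (fun p p' => Prod.ext (add_mul _ _ _) (by ext; simp))
  let g : V →+ (AddMonoid.End (B × (k →+ K)))ᵐᵒᵖ :=
    AddMonoidHom.mk' (fun v => MulOpposite.op (act' v)) (fun v w =>
      MulOpposite.unop_injective (AddMonoidHom.ext fun p => Prod.ext (by
        change p.1 * π (ι k V (v + w)) = p.1 * π (ι k V v) + p.1 * π (ι k V w)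
        simp [mul_add]) (by
        ext z
        change ω p.1 (MulOpposite.op z • (v + w))
          = ω p.1 (MulOpposite.op z • v) + ω p.1 (MulOpposite.op z • w)
        simp)))
  let ψ := TAlg.lift f g
    (fun r v => MulOpposite.unop_injective (AddMonoidHom.ext fun p => Prod.ext (by
      change p.1 * π (ι k V (r • v)) = p.1 * π (unit k V r) * π (ι k V v)
      rw [ι_smul, map_mul, mul_assoc]) (by
      ext z
      change ω p.1 (MulOpposite.op z • r • v) = ω (p.1 * π (unit k V r)) (MulOpposite.op z • v)
      rw [hω, smul_comm r])))
    (fun r v => MulOpposite.unop_injective (AddMonoidHom.ext fun p => Prod.ext (by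
      change p.1 * π (ι k V (MulOpposite.op r • v)) = p.1 * π (ι k V v) * π (unit k V r)
      rw [ι_op_smul, map_mul, mul_assoc]) (by
      ext z
      change ω p.1 (MulOpposite.op z • MulOpposite.op r • v)
        = ω p.1 (MulOpposite.op (r * z) • v)
      rw [MulOpposite.op_mul, mul_smul])))
  have hψι : ∀ v, ψ (ι k V v) = g v := fun v => lift_ι _ _ _ _ v
  have hψu : ∀ r, ψ (unit k V r) = f r := fun v => lift_unit _ _ _ _ v
  have hmul : ∀ s t p, (ψ (s * t)).unop p = (ψ t).unop ((ψ s).unop p) := fun s t p => by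
    rw [map_mul]; rfl
  have hadd : ∀ s t p, (ψ (s + t)).unop p = (ψ s).unop p + (ψ t).unop p := fun s t p => by
    rw [map_add]; rfl
  have h1 : ∀ t, ((ψ t).unop (1, 0)).1 = π t := by
    intro t
    induction t using induction_right with
    | unit r =>
      rw [hψu]
      exact one_mul _
    | add s t hs ht => rw [hadd, map_add, ← hs, ← ht]; rfl
    | mul_ι t v ht =>
      rw [hmul, hψι, map_mul, ← ht]; rfl
  refine ⟨AddMonoidHom.mk' (fun t => ((ψ t).unop (1, 0)).2 1) (fun s t => by rw [hadd]; rfl),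
    ψ, fun t v => ?_, fun r => ?_, fun t => rfl, fun v p => by rw [hψι]; rfl⟩
  · change ((ψ (t * ι k V v)).unop (1, 0)).2 1 = _
    rw [hmul, hψι, ← h1]
    change ω _ (MulOpposite.op (1 : k) • v) = _
    rw [MulOpposite.op_one, one_smul]
  · change ((ψ (unit k V r)).unop (1, 0)).2 1 = _
    rw [hψu]
    rfl

/-- The version of `TAlg.exists_hom` for quadratic algebras. -/
lemma QAlg.exists_hom {Q : AddSubgroup (BTensor k V V)}
    (hQr : ∀ q ∈ Q, ∀ r : k, MulOpposite.op r • q ∈ Q) {K : Type*} [AddCommGroup K]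
    (ω : QAlg (quadIdeal Q) →+ V →+ K)
    (hω : ∀ b r v, ω (b * unit (quadIdeal Q) r) v = ω b (r • v))
    (hQ : ∀ (b : QAlg (quadIdeal Q)) (Θ : BTensor k V V →+ K),
      (∀ x y, Θ (BTensor.tmul k x y) = ω (b * ι (quadIdeal Q) x) y) → ∀ q ∈ Q, Θ q = 0) :
    ∃ φ : QAlg (quadIdeal Q) →+ K,
      (∀ b v, φ (b * ι (quadIdeal Q) v) = ω b v) ∧ ∀ r, φ (unit (quadIdeal Q) r) = 0 := by
  obtain ⟨φ, ψ, h1, h2, h3, h4⟩ := TAlg.exists_hom (mk (quadIdeal Q)) ω hω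
  -- The action descends to the quadratic algebra: the first entry is multiplied by `q`, which is
  -- zero there, and the second entry at `s` is the value at `q s` of the functional `Θ` that `hQ`
  -- controls.
  have hψ : ∀ q ∈ Q, ψ (TAlg.m2 k V q) = 0 := by
    intro q hq
    refine MulOpposite.unop_injective (AddMonoidHom.ext fun p => Prod.ext ?_ ?_)
    · have : ∀ w, ((ψ (TAlg.m2 k V w)).unop p).1 = p.1 * mk (quadIdeal Q) (TAlg.m2 k V w) := by
        intro w
        induction w using BTensor.induction_on with
        | h0 => simp
        | ha x y hx hy =>
          rw [map_add, map_add, map_add, mul_add, ← hx, ← hy]; rfl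
        | ht x y =>
          rw [TAlg.m2_tmul, map_mul]
          change ((ψ (TAlg.ι k V y)).unop ((ψ (TAlg.ι k V x)).unop p)).1 = _
          rw [h4, h4, map_mul (mk _), ← mul_assoc]
      exact (this q).trans (by rw [mk_eq_zero _ (m2_mem_quadIdeal hq), mul_zero]; rfl)
    · ext s
      let Θ' : BTensor k V V →+ K :=
        (AddMonoidHom.mk' (fun w => ((ψ (TAlg.m2 k V w)).unop p).2 s) (fun x y => by
          rw [map_add, map_add]; rfl))
      let Θ : BTensor k V V →+ K := BTensor.lift
        (AddMonoidHom.mk' (fun x => ω (p.1 * ι (quadIdeal Q) x))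
          (fun x y => by ext; simp [mul_add]))
        (fun x r y => by
          change ω (p.1 * ι (quadIdeal Q) _) y = ω (p.1 * ι (quadIdeal Q) _) _
          rw [ι_op_smul, ← mul_assoc, hω])
      have hΘ : Θ' = Θ.comp (DistribSMul.toAddMonoidHom _ (MulOpposite.op s)) :=
        BTensor.hom_ext fun x y => by
          change ((ψ (TAlg.m2 k V _)).unop p).2 s = ω (p.1 * ι (quadIdeal Q) x) _
          rw [TAlg.m2_tmul, map_mul]
          change ((ψ (TAlg.ι k V y)).unop ((ψ (TAlg.ι k V x)).unop p)).2 s = _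
          rw [h4, h4]
          rfl
      change Θ' q = 0
      rw [hΘ]
      exact hQ p.1 Θ (fun x y => rfl) _ (hQr q hq s)
  have hφ : ∀ t ∈ quadIdeal Q, φ t = 0 := fun t ht => by
    rw [h3, map_eq_zero_of_mem_quadIdeal ψ hψ ht]
    rfl
  have hφ' : ∀ s t, mk (quadIdeal Q) s = mk (quadIdeal Q) t → φ s = φ t := fun s t h => by
    rw [← sub_eq_zero, ← map_sub]
    exact hφ _ ((mk_eq_zero_iff _).1 (by rw [map_sub, h, sub_self]))
  have hsec := Function.surjInv_eq (mk_surjective (quadIdeal Q))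
  refine ⟨AddMonoidHom.mk' (fun b => φ (Function.surjInv (mk_surjective (quadIdeal Q)) b))
    (fun b c => by
      rw [← map_add]
      exact hφ' _ _ (by rw [hsec, map_add, hsec, hsec])), fun b v => ?_, fun r => ?_⟩
  · change φ _ = _
    rw [hφ' _ (Function.surjInv (mk_surjective (quadIdeal Q)) b * TAlg.ι k V v) (by
      rw [hsec, map_mul, hsec]; rfl), h1, hsec]
  · change φ _ = _
    rw [hφ' _ (TAlg.unit k V r) (by rw [hsec]; rfl), h2]

end Lift

/-! ## Quadratic relations -/

section Relations

variable {k E : Type u} [Ring k] [AddCommGroup E] [Module k E] [Module kᵐᵒᵖ E]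
  [SMulCommClass k kᵐᵒᵖ E]

lemma relSpace_op_smul_mem {J : TwoSidedIdeal (TAlg k E)} (q : BTensor k E E)
    (hq : q ∈ relSpace J) (r : k) : MulOpposite.op r • q ∈ relSpace J :=
  (relSub J).smul_mem (MulOpposite.op r) hq

lemma relSpace_smul_mem {J : TwoSidedIdeal (TAlg k E)} (q : BTensor k E E)
    (hq : q ∈ relSpace J) (r : k) : r • q ∈ relSpace J := by
  obtain ⟨e, s, h⟩ := hq
  refine ⟨r • e, r * s, ?_⟩
  rw [m2_smul, TAlg.ι_smul, map_mul, ← mul_add, ← mul_add]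
  exact J.mul_mem_left _ _ h

lemma pairing_op_smul_left (t : BTensor k (RDual k E) (RDual k E)) (r : k) (w : BTensor k E E) :
    pairing (MulOpposite.op r • t) w = pairing t (r • w) := by
  induction t using BTensor.induction_on with
  | h0 => simp
  | ha t t' h h' => simp [h, h']
  | ht f g =>
    induction w using BTensor.induction_on with
    | h0 => simp
    | ha w w' h h' => rw [map_add, h, h', smul_add, map_add]
    | ht x y => rw [right_smul_tmul, left_smul_tmul, pairing_tmul, pairing_tmul]; rfl

lemma perp_op_smul_mem {J : TwoSidedIdeal (TAlg k E)} (t : BTensor k (RDual k E) (RDual k E))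
    (ht : t ∈ perp (relSpace J)) (r : k) : MulOpposite.op r • t ∈ perp (relSpace J) :=
  fun q hq => by
    rw [pairing_op_smul_left]
    exact ht _ (relSpace_smul_mem q hq r)

end Relations

/-! ## Low degrees of quadratic algebras -/

section LowDegree

variable {k V : Type u} [Ring k] [AddCommGroup V] [Module k V] [Module kᵐᵒᵖ V]
  [SMulCommClass k kᵐᵒᵖ V]

namespace QAlg

variable {Q : AddSubgroup (BTensor k V V)}

variable (Q) in
/-- The augmentation of a quadratic algebra. -/
def aug : QAlg (quadIdeal Q) →+* k :=
  lift _ (TAlg.lift (RingHom.id k) 0 (fun r x => by simp) (fun r x => by simp))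
    (fun t ht => map_eq_zero_of_mem_quadIdeal _ (fun q hq => by
      clear hq
      induction q using BTensor.induction_on with
      | h0 => simp
      | ha x y hx hy => rw [map_add, map_add, hx, hy, add_zero]
      | ht x y => simp) ht)

@[simp] lemma aug_unit (r : k) : aug Q (unit (quadIdeal Q) r) = r := by
  rw [← mk_unit, aug, lift_mk, TAlg.lift_unit]
  rfl

@[simp] lemma aug_ι (x : V) : aug Q (ι (quadIdeal Q) x) = 0 := by
  rw [← mk_ι, aug, lift_mk, TAlg.lift_ι]
  rfl

lemma comp_zero_eq (a : QAlg (quadIdeal Q)) : comp 0 a = unit (quadIdeal Q) (aug Q a) := by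
  induction a using induction_right with
  | unit r => rw [comp_zero_unit, aug_unit]
  | add a b ha hb => rw [map_add, ha, hb, map_add, map_add]
  | mul_ι a x _ => rw [comp_zero_mul_ι, map_mul, aug_ι, mul_zero, map_zero]

/-- The projection to degree one, which shows that `V` embeds in the quadratic algebra: the
quadratic relations do not reach degree one. -/
lemma exists_pr (Q : AddSubgroup (BTensor k V V))
    (hQr : ∀ q ∈ Q, ∀ r : k, MulOpposite.op r • q ∈ Q) :
    ∃ φ : QAlg (quadIdeal Q) →+ V,
      (∀ b v, φ (b * ι (quadIdeal Q) v) = aug Q b • v) ∧ ∀ r, φ (unit (quadIdeal Q) r) = 0 :=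
  exists_hom hQr
    (AddMonoidHom.mk' (fun b => DistribSMul.toAddMonoidHom V (aug Q b)) (fun b c => by
      ext v; simp [add_smul]))
    (fun b r v => by simp [mul_smul])
    (fun b Θ hΘ q _ => by
      rw [show Θ = 0 from BTensor.hom_ext fun x y => by rw [hΘ]; simp]
      rfl)

end QAlg

end LowDegree

/-! ## Modules over `T_k(V)/J` of the form `T_k(V)/J ⊗_k N` -/

section TensorModule

variable {k V : Type u} [Ring k] [AddCommGroup V] [Module k V] [Module kᵐᵒᵖ V]

namespace BTensor

section

variable {M M' N N' : Type u} [AddCommGroup M] [Module kᵐᵒᵖ M] [AddCommGroup M']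
  [Module kᵐᵒᵖ M'] [AddCommGroup N] [Module k N] [AddCommGroup N'] [Module k N']

variable (k) in
/-- Functoriality of `M ⊗_k N` in both arguments. -/
def map (f : M →+ M') (g : N →+ N')
    (hf : ∀ (r : k) m, f (MulOpposite.op r • m) = MulOpposite.op r • f m)
    (hg : ∀ (r : k) n, g (r • n) = r • g n) : BTensor k M N →+ BTensor k M' N' :=
  lift (AddMonoidHom.mk' (fun m => (tmulHom k (f m)).comp g) (fun m m' => by ext; simp))
    (fun m r n => by simp [hf, hg, smul_tmul])

lemma tmul_sum {ι : Type*} (s : Finset ι) (m : M) (n : ι → N) :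
    tmul k m (∑ i ∈ s, n i) = ∑ i ∈ s, tmul k m (n i) :=
  map_sum (tmulHom k m) n s

lemma sum_tmul {ι : Type*} (s : Finset ι) (m : ι → M) (n : N) :
    tmul k (∑ i ∈ s, m i) n = ∑ i ∈ s, tmul k (m i) n :=
  map_sum ((tmulHom k).flip n) m s

lemma neg_tmul (m : M) (n : N) : tmul k (-m) n = -tmul k m n :=
  map_neg ((tmulHom k).flip n) m

lemma tmul_neg (m : M) (n : N) : tmul k m (-n) = -tmul k m n :=
  map_neg (tmulHom k m) n

end

variable {J : TwoSidedIdeal (TAlg k V)} {N : Type u} [AddCommGroup N] [Module k N]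

instance algModule : Module (QAlg J) (BTensor k (QAlg J) N) :=
  let act (a : QAlg J) : BTensor k (QAlg J) N →+ BTensor k (QAlg J) N :=
    map k (AddMonoidHom.mulLeft a) (AddMonoidHom.id N)
      (fun r m => by simp [QAlg.op_smul_def, mul_assoc]) (fun r n => rfl)
  Module.compHom (BTensor k (QAlg J) N) (R := AddMonoid.End (BTensor k (QAlg J) N))
    { toFun := act
      map_one' := hom_ext fun m n => congrArg (tmul k · n) (one_mul m)
      map_mul' := fun r s => hom_ext fun m n => congrArg (tmul k · n) (mul_assoc r s m)
      map_zero' := hom_ext fun m n =>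
        (congrArg (tmul k · n) (zero_mul m)).trans (zero_tmul k n)
      map_add' := fun r s => hom_ext fun m n =>
        (congrArg (tmul k · n) (add_mul r s m)).trans (add_tmul k _ _ n) }

lemma alg_smul_tmul (a b : QAlg J) (n : N) : a • tmul k b n = tmul k (a * b) n := rfl

lemma eq_smul_one_tmul (a : QAlg J) (n : N) : tmul k a n = a • tmul k 1 n := by
  rw [alg_smul_tmul, mul_one]

/-- The maps `p_n ⊗ 1` on `A ⊗_k N` for a quadratic algebra `A`. -/
noncomputable def comp {Q : AddSubgroup (BTensor k V V)} (n : ℕ) :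
    BTensor k (QAlg (quadIdeal Q)) N →+ BTensor k (QAlg (quadIdeal Q)) N :=
  map k (QAlg.comp n) (AddMonoidHom.id N) (fun r a => QAlg.comp_mul_unit n a r) (fun _ _ => rfl)

lemma comp_tmul {Q : AddSubgroup (BTensor k V V)} (n : ℕ) (a : QAlg (quadIdeal Q)) (m : N) :
    comp n (tmul k a m) = tmul k (QAlg.comp n a) m := rfl

lemma exists_sum_comp {Q : AddSubgroup (BTensor k V V)}
    (x : BTensor k (QAlg (quadIdeal Q)) N) :
    ∃ M, (∀ n ≥ M, comp n x = 0) ∧ x = ∑ n ∈ Finset.range M, comp n x := by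
  suffices h : ∃ M, ∀ M' ≥ M, (comp M' x = 0) ∧ x = ∑ n ∈ Finset.range M', comp n x by
    obtain ⟨M, h⟩ := h
    exact ⟨M, fun n hn => (h n hn).1, (h M le_rfl).2⟩
  induction x using BTensor.induction_on with
  | h0 => exact ⟨0, fun _ _ => by simp⟩
  | ha x y hx hy =>
    obtain ⟨M, hM⟩ := hx
    obtain ⟨M', hM'⟩ := hy
    refine ⟨max M M', fun n hn => ?_⟩
    have h1 := hM n (le_trans (le_max_left _ _) hn)
    have h2 := hM' n (le_trans (le_max_right _ _) hn)
    refine ⟨by rw [map_add, h1.1, h2.1, add_zero], ?_⟩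
    simp only [map_add, Finset.sum_add_distrib]
    rw [← h1.2, ← h2.2]
  | ht a m =>
    obtain ⟨M, hM, hM'⟩ := QAlg.exists_sum_comp a
    refine ⟨M, fun n hn => ⟨by rw [comp_tmul, hM n hn, zero_tmul], ?_⟩⟩
    simp only [comp_tmul]
    rw [← sum_tmul]
    congr 1
    rw [← Finset.sum_subset (Finset.range_subset_range.2 hn) (fun i _ hi => hM i (by simpa using hi))]
    exact hM'

lemma comp_comp_ne {Q : AddSubgroup (BTensor k V V)} {n m : ℕ} (h : n ≠ m)
    (x : BTensor k (QAlg (quadIdeal Q)) N) : comp n (comp m x) = 0 := by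
  induction x using BTensor.induction_on with
  | h0 => simp
  | ha x y hx hy => simp only [map_add, hx, hy, add_zero]
  | ht a b => rw [comp_tmul, comp_tmul, QAlg.comp_of_mem_ne (QAlg.comp_mem m a) h, zero_tmul]

end BTensor

end TensorModule

/-! ## The Koszul complex -/

section KDual

variable {k E : Type u} [Ring k] [AddCommGroup E] [Module k E] [Module kᵐᵒᵖ E]
  [SMulCommClass k kᵐᵒᵖ E] {J : TwoSidedIdeal (TAlg k E)}

namespace KDual

/-- The structure map `k → A^!`. -/
abbrev unit (J : TwoSidedIdeal (TAlg k E)) : k →+* KDual J := QAlg.unit (dualIdeal (relSpace J))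

/-- The inclusion `E^* → A^!`. -/
abbrev ι (J : TwoSidedIdeal (TAlg k E)) : RDual k E →+ KDual J :=
  QAlg.ι (dualIdeal (relSpace J))

/-- The projections of `A^!` to its homogeneous components. -/
noncomputable def comp (n : ℕ) : KDual J →+ KDual J := QAlg.comp (Q := perp (relSpace J)) n

lemma comp_zero_unit (r : k) : comp 0 (unit J r) = unit J r := QAlg.comp_zero_unit r

lemma comp_succ_unit (n : ℕ) (r : k) : comp (n + 1) (unit J r) = 0 := QAlg.comp_succ_unit n r

lemma comp_zero_mul_ι (a : KDual J) (f : RDual k E) : comp 0 (a * ι J f) = 0 :=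
  QAlg.comp_zero_mul_ι a f

lemma comp_succ_mul_ι (n : ℕ) (a : KDual J) (f : RDual k E) :
    comp (n + 1) (a * ι J f) = comp n a * ι J f :=
  QAlg.comp_succ_mul_ι n a f

lemma comp_mul_unit (n : ℕ) (a : KDual J) (r : k) : comp n (a * unit J r) = comp n a * unit J r :=
  QAlg.comp_mul_unit n a r

lemma comp_unit_mul (n : ℕ) (a : KDual J) (r : k) : comp n (unit J r * a) = unit J r * comp n a :=
  QAlg.comp_unit_mul n a r

lemma comp_mem (n : ℕ) (a : KDual J) : comp n a ∈ KDual.deg J n := QAlg.comp_mem n a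

lemma comp_of_mem {n : ℕ} {a : KDual J} (ha : a ∈ KDual.deg J n) : comp n a = a :=
  QAlg.comp_of_mem ha

lemma comp_of_mem_ne {n m : ℕ} {a : KDual J} (ha : a ∈ KDual.deg J n) (h : m ≠ n) :
    comp m a = 0 :=
  QAlg.comp_of_mem_ne ha h

lemma exists_sum_comp (a : KDual J) :
    ∃ N, (∀ n ≥ N, comp n a = 0) ∧ a = ∑ n ∈ Finset.range N, comp n a :=
  QAlg.exists_sum_comp (Q := perp (relSpace J)) a

lemma exists_hom {K : Type*} [AddCommGroup K] (ω : KDual J →+ RDual k E →+ K)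
    (hω : ∀ b r f, ω (b * unit J r) f = ω b (r • f))
    (hQ : ∀ (b : KDual J) (Θ : BTensor k (RDual k E) (RDual k E) →+ K),
      (∀ f g, Θ (tmul k f g) = ω (b * ι J f) g) → ∀ t ∈ perp (relSpace J), Θ t = 0) :
    ∃ φ : KDual J →+ K, (∀ b f, φ (b * ι J f) = ω b f) ∧ ∀ r, φ (unit J r) = 0 :=
  QAlg.exists_hom (Q := perp (relSpace J)) perp_op_smul_mem ω hω hQ

lemma unit_comm (r s : k) (a : KDual J) : (r • a) * unit J s = r • (a * unit J s) := by
  rw [QAlg.smul_def, QAlg.smul_def, mul_assoc]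

end KDual

end KDual

/-! ### The Koszul complex of the quadratic algebra and its linear part -/

section Koszul

variable {k E : Type u} [Ring k] [AddCommGroup E] [Module k E] [Module kᵐᵒᵖ E]
  [SMulCommClass k kᵐᵒᵖ E]

/-- The associated quadratic algebra `A = T_k(E)/(Q)`. -/
abbrev Assoc (J : TwoSidedIdeal (TAlg k E)) : Type u := QAlg (quadIdeal (relSpace J))

namespace Assoc

/-- The structure map `k → A`. -/
abbrev unit (J : TwoSidedIdeal (TAlg k E)) : k →+* Assoc J := QAlg.unit (quadIdeal (relSpace J))

/-- The inclusion `E → A`. -/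
abbrev ι (J : TwoSidedIdeal (TAlg k E)) : E →+ Assoc J := QAlg.ι (quadIdeal (relSpace J))

/-- The projection of `A` to `E = A_1`. -/
noncomputable def pr (J : TwoSidedIdeal (TAlg k E)) : Assoc J →+ E :=
  (QAlg.exists_pr (relSpace J) relSpace_op_smul_mem).choose

variable {J : TwoSidedIdeal (TAlg k E)}

lemma pr_mul_ι (a : Assoc J) (x : E) : pr J (a * ι J x) = QAlg.aug _ a • x :=
  (QAlg.exists_pr (relSpace J) relSpace_op_smul_mem).choose_spec.1 a x

lemma pr_unit (r : k) : pr J (unit J r) = 0 :=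
  (QAlg.exists_pr (relSpace J) relSpace_op_smul_mem).choose_spec.2 r

lemma pr_ι (x : E) : pr J (ι J x) = x := by
  have := pr_mul_ι (1 : Assoc J) x
  rwa [one_mul, map_one, one_smul] at this

lemma pr_mul_unit (a : Assoc J) (r : k) : pr J (a * unit J r) = MulOpposite.op r • pr J a := by
  induction a using QAlg.induction_right with
  | unit s => rw [← map_mul, pr_unit, pr_unit, smul_zero]
  | add a b ha hb => rw [add_mul, map_add, ha, hb, map_add, smul_add]
  | mul_ι a x _ =>
    rw [mul_assoc, ← QAlg.ι_op_smul, pr_mul_ι, pr_mul_ι, smul_comm]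

lemma comp_one_eq (a : Assoc J) : QAlg.comp 1 a = ι J (pr J a) := by
  induction a using QAlg.induction_right with
  | unit s => rw [QAlg.comp_succ_unit, pr_unit, map_zero]
  | add a b ha hb => rw [map_add, ha, hb, map_add, map_add]
  | mul_ι a x _ => rw [QAlg.comp_succ_mul_ι, pr_mul_ι, QAlg.comp_zero_eq, QAlg.ι_smul]

/-- The elements of `Q^⊥` are functionals on `A_2`. -/
lemma exists_functional {t : BTensor k (RDual k E) (RDual k E)} (ht : t ∈ perp (relSpace J)) :
    ∃ φ : Assoc J →+ k, (∀ a x, φ (a * ι J x) = pairing t (tmul k (pr J a) x)) ∧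
      ∀ a r, φ (a * unit J r) = φ a * r := by
  obtain ⟨φ, h, h'⟩ := QAlg.exists_hom (Q := relSpace J) relSpace_op_smul_mem (K := k)
    (AddMonoidHom.mk' (fun a => (pairing t).comp (tmulHom k (pr J a))) (fun a b => by ext; simp))
    (fun a r x => by
      change pairing t (tmul k (pr J (a * unit J r)) x) = pairing t (tmul k (pr J a) (r • x))
      rw [pr_mul_unit, smul_tmul])
    (fun a Θ hΘ q hq => by
      rw [show Θ = (pairing t).comp (DistribSMul.toAddMonoidHom _ (QAlg.aug _ a)) from
        BTensor.hom_ext fun x y => by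
          rw [hΘ]
          change pairing t (tmul k (pr J _) y) = pairing t (QAlg.aug _ a • tmul k x y)
          rw [pr_mul_ι]
          rfl]
      exact ht _ (relSpace_smul_mem q hq _))
  refine ⟨φ, h, fun a r => ?_⟩
  induction a using QAlg.induction_right with
  | unit s => rw [← map_mul, h', h', zero_mul]
  | add a b ha hb => rw [add_mul, map_add, ha, hb, map_add, add_mul]
  | mul_ι a x _ =>
    rw [mul_assoc, ← QAlg.ι_op_smul, h, h]
    change pairing t (tmul k (pr J a) (MulOpposite.op r • x)) = pairing t (tmul k (pr J a) x) * r
    rw [← right_smul_tmul, pairing_op_smul]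

end Assoc

/-- The left `k`-linear functionals on `A^!` which vanish outside of degree `i`, as a subgroup. -/
def cogSub (J : TwoSidedIdeal (TAlg k E)) (i : ℕ) : AddSubgroup (KDual J →+ k) where
  carrier := {c | (∀ r b, c (r • b) = r * c b) ∧ ∀ b, c (KDual.comp i b) = c b}
  zero_mem' := ⟨by simp, by simp⟩
  add_mem' := fun ha hb => ⟨by simp [ha.1, hb.1, mul_add], by simp [ha.2, hb.2]⟩
  neg_mem' := fun ha => ⟨by simp [ha.1], by simp [ha.2]⟩

/-- The left dual of the degree `i` piece of `A^!`. -/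
def Cog (J : TwoSidedIdeal (TAlg k E)) (i : ℕ) : Type u := cogSub J i

namespace Cog

variable {J : TwoSidedIdeal (TAlg k E)} {i : ℕ}

instance : AddCommGroup (Cog J i) := inferInstanceAs (AddCommGroup (cogSub J i))

instance : FunLike (Cog J i) (KDual J) k where
  coe c := c.1
  coe_injective _ _ h := Subtype.ext (DFunLike.coe_injective h)

instance : AddMonoidHomClass (Cog J i) (KDual J) k where
  map_add c := map_add c.1
  map_zero c := map_zero c.1

@[ext] lemma ext {c c' : Cog J i} (h : ∀ b, c b = c' b) : c = c' := DFunLike.ext _ _ h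

@[simp] lemma add_apply (c c' : Cog J i) (b : KDual J) : (c + c') b = c b + c' b := rfl
@[simp] lemma zero_apply (b : KDual J) : (0 : Cog J i) b = 0 := rfl

/-- Construct an element of `Cog J i`. -/
def ofHom (c : KDual J →+ k) (h1 : ∀ r b, c (r • b) = r * c b)
    (h2 : ∀ b, c (KDual.comp i b) = c b) : Cog J i := ⟨c, h1, h2⟩

lemma map_smul (c : Cog J i) (r : k) (b : KDual J) : c (r • b) = r * c b := c.2.1 r b

lemma map_comp (c : Cog J i) (b : KDual J) : c (KDual.comp i b) = c b := c.2.2 b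

/-- The left action `(r c)(b) = c(b r)`. -/
instance : SMul k (Cog J i) where
  smul r c := ⟨c.1.comp (AddMonoidHom.mulRight (KDual.unit J r)), fun s b => by
    change c (s • b * _) = s * c (b * _)
    rw [KDual.unit_comm, map_smul], fun b => by
    change c (KDual.comp i b * _) = c (b * _)
    rw [← KDual.comp_mul_unit, map_comp]⟩

@[simp] lemma smul_apply (r : k) (c : Cog J i) (b : KDual J) :
    (r • c) b = c (b * KDual.unit J r) := rfl

instance : Module k (Cog J i) where
  one_smul c := by ext; simp
  mul_smul r s c := by ext; simp [mul_assoc]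
  smul_zero r := by ext; simp
  smul_add r c c' := by ext; simp
  add_smul r s c := by ext; simp [mul_add]
  zero_smul c := by ext; simp

/-- The right action `(c r)(b) = c(b) r`. -/
instance : SMul kᵐᵒᵖ (Cog J i) where
  smul r c := ⟨(AddMonoidHom.mulRight r.unop).comp c.1, fun s b => by
    change c (s • b) * _ = s * (c b * _)
    rw [map_smul, mul_assoc], fun b => by
    change c (KDual.comp i b) * _ = c b * _
    rw [map_comp]⟩

@[simp] lemma op_smul_apply (r : kᵐᵒᵖ) (c : Cog J i) (b : KDual J) :
    (r • c) b = c b * r.unop := rfl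

instance : Module kᵐᵒᵖ (Cog J i) where
  one_smul c := by ext; simp
  mul_smul r s c := by ext; simp [mul_assoc]
  smul_zero r := by ext; simp
  smul_add r c c' := by ext; simp [add_mul]
  add_smul r s c := by ext; simp [mul_add]
  zero_smul c := by ext; simp

instance : SMulCommClass k kᵐᵒᵖ (Cog J i) where
  smul_comm r s c := by ext; simp

/-- The action `(f c)(b) = c(b f)` of `E^*`. -/
def act : RDual k E →+ Cog J (i + 1) →+ Cog J i :=
  AddMonoidHom.mk' (fun f => AddMonoidHom.mk'
    (fun c => ⟨c.1.comp (AddMonoidHom.mulRight (KDual.ι J f)), fun s b => by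
      change c (s • b * _) = s * c (b * _)
      rw [← map_smul, QAlg.smul_def, QAlg.smul_def, mul_assoc], fun b => by
      change c (KDual.comp i b * _) = c (b * _)
      rw [← KDual.comp_succ_mul_ι, map_comp]⟩)
    (fun c c' => rfl)) (fun f g => by
      ext c b
      change c (b * KDual.ι J (f + g)) = c (b * KDual.ι J f) + c (b * KDual.ι J g)
      simp [mul_add])

@[simp] lemma act_apply (f : RDual k E) (c : Cog J (i + 1)) (b : KDual J) :
    act f c b = c (b * KDual.ι J f) := rfl

lemma act_smul (f : RDual k E) (r : k) (c : Cog J (i + 1)) :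
    act f (r • c) = act (MulOpposite.op r • f) c := by
  ext b
  simp only [act_apply, smul_apply, KDual.ι, QAlg.ι_op_smul, mul_assoc]

lemma smul_act (f : RDual k E) (r : k) (c : Cog J (i + 1)) :
    r • act f c = act (r • f) c := by
  ext b
  simp only [act_apply, smul_apply, KDual.ι, QAlg.ι_smul, mul_assoc]

lemma act_op_smul (f : RDual k E) (r : kᵐᵒᵖ) (c : Cog J (i + 1)) :
    act f (r • c) = r • act f c := rfl

lemma apply_unit (c : Cog J (i + 1)) (r : k) : c (KDual.unit J r) = 0 := by
  rw [← map_comp, KDual.comp_succ_unit, map_zero]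

lemma zero_apply_mul_ι (c : Cog J 0) (b : KDual J) (f : RDual k E) : c (b * KDual.ι J f) = 0 := by
  rw [← map_comp, KDual.comp_zero_mul_ι, map_zero]

/-- Every element of `A^!` is a scalar plus a sum of right multiples of elements of `E^*`, and a
functional of positive degree kills the scalars. -/
lemma eq_zero_of_act {c : Cog J (i + 1)} (h : ∀ f, act f c = 0) : c = 0 := by
  ext b
  induction b using QAlg.induction_right with
  | unit r => exact apply_unit c r
  | add a b ha hb => rw [map_add, ha, hb, map_add]
  | mul_ι b f _ => exact DFunLike.congr_fun (h f) b

end Cog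

variable [IsSemisimpleRing k] [Module.Finite kᵐᵒᵖ E]

/-- The differential `a ⊗ c ↦ ∑ a x_b ⊗ x̂_b c` of the Koszul complex. -/
noncomputable def kosD (J : TwoSidedIdeal (TAlg k E)) (i : ℕ) :
    BTensor k (Assoc J) (Cog J (i + 1)) →+ BTensor k (Assoc J) (Cog J i) :=
  BTensor.lift
    (AddMonoidHom.mk' (fun a => ∑ b, (tmulHom k (a * Assoc.ι J (coevVec k E b))).comp
      (Cog.act (coevDual k E b))) (fun a a' => by
        ext c
        simp [add_mul, Finset.sum_add_distrib]))
    (fun a r c => by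
      simp only [AddMonoidHom.mk'_apply, AddMonoidHom.finsetSum_apply, AddMonoidHom.comp_apply,
        tmulHom_apply]
      -- The map is balanced because the coevaluation element is central: `r x_b ⊗ x̂_b` and `x_b ⊗
      -- x̂_b r` have the same sum.
      let G : E →+ RDual k E →+ BTensor k (Assoc J) (Cog J i) :=
        AddMonoidHom.mk' (fun x => (tmulHom k (a * Assoc.ι J x)).comp (Cog.act.flip c))
          (fun x y => by ext f; simp [mul_add])
      have hG := coev_move G (fun e s f => by
        change tmul k (a * QAlg.ι _ _) (Cog.act f c) = tmul k _ (Cog.act (s • f) c)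
        rw [QAlg.ι_op_smul, ← Cog.smul_act, ← mul_assoc, ← QAlg.op_smul_def, smul_tmul]) r
      refine (Finset.sum_congr rfl fun b _ => ?_).trans (hG.trans
        (Finset.sum_congr rfl fun b _ => ?_))
      · change _ = tmul k (a * QAlg.ι _ _) _
        rw [QAlg.ι_smul, QAlg.op_smul_def, mul_assoc]
        rfl
      · change tmul k _ (Cog.act _ c) = _
        rw [Cog.act_smul])

variable {J : TwoSidedIdeal (TAlg k E)} {i : ℕ}

lemma kosD_tmul (a : Assoc J) (c : Cog J (i + 1)) :
    kosD J i (tmul k a c) = ∑ b, tmul k (a * Assoc.ι J (coevVec k E b))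
      (Cog.act (coevDual k E b) c) := by
  rw [kosD, lift_tmul]
  simp only [AddMonoidHom.mk'_apply, AddMonoidHom.finsetSum_apply, AddMonoidHom.comp_apply,
    tmulHom_apply]

lemma kosD_smul (a : Assoc J) (x : BTensor k (Assoc J) (Cog J (i + 1))) :
    kosD J i (a • x) = a • kosD J i x := by
  induction x using BTensor.induction_on with
  | h0 => simp
  | ha x y hx hy => simp only [smul_add, map_add, hx, hy]
  | ht b c => simp only [alg_smul_tmul, kosD_tmul, Finset.smul_sum, mul_assoc]

lemma kosD_op_smul (r : kᵐᵒᵖ) (x : BTensor k (Assoc J) (Cog J (i + 1))) :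
    kosD J i (r • x) = r • kosD J i x := by
  induction x using BTensor.induction_on with
  | h0 => simp
  | ha x y hx hy => simp only [smul_add, map_add, hx, hy]
  | ht b c => simp only [right_smul_tmul, kosD_tmul, Finset.smul_sum, Cog.act_op_smul]

lemma kosD_comp (n : ℕ) (x : BTensor k (Assoc J) (Cog J (i + 1))) :
    kosD J i (BTensor.comp n x) = BTensor.comp (n + 1) (kosD J i x) := by
  induction x using BTensor.induction_on with
  | h0 => simp
  | ha x y hx hy => simp only [map_add, hx, hy]
  | ht a c => simp only [comp_tmul, kosD_tmul, map_sum, QAlg.comp_succ_mul_ι]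

/-- The map `a ⊗ c ↦ f(a_1) c`. -/
noncomputable def extr (i : ℕ) : RDual k E →+ BTensor k (Assoc J) (Cog J i) →+ Cog J i :=
  AddMonoidHom.mk' (fun f => BTensor.lift
    (AddMonoidHom.mk' (fun a => DistribSMul.toAddMonoidHom _ (f (Assoc.pr J a)))
      (fun a a' => by ext; simp [mul_add]))
    (fun a r c => by
      change f (Assoc.pr J (a * Assoc.unit J r)) • c = f _ • r • c
      rw [Assoc.pr_mul_unit, RDual.map_op_smul, mul_smul]))
    (fun f g => BTensor.hom_ext fun a c => by
      change (f + g) (Assoc.pr J a) • c = f _ • c + g _ • c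
      rw [RDual.add_apply, add_smul])

lemma extr_tmul (f : RDual k E) (a : Assoc J) (c : Cog J i) :
    extr i f (tmul k a c) = f (Assoc.pr J a) • c := rfl

lemma extr_smul (r : k) (f : RDual k E) (w : BTensor k (Assoc J) (Cog J i)) :
    extr i (r • f) w = r • extr i f w := by
  induction w using BTensor.induction_on with
  | h0 => simp
  | ha x y hx hy => simp only [map_add, hx, hy, smul_add]
  | ht a c => rw [extr_tmul, extr_tmul, RDual.smul_apply, mul_smul]

/-- The maps `extr` are the coordinates of the part in `A_1 ⊗ Cog = E ⊗ Cog` with respect to the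
dual basis `x_b, x̂_b`. -/
lemma comp_one_eq_sum_extr (w : BTensor k (Assoc J) (Cog J i)) :
    BTensor.comp 1 w = ∑ b, tmul k (Assoc.ι J (coevVec k E b)) (extr i (coevDual k E b) w) := by
  induction w using BTensor.induction_on with
  | h0 => simp [tmul_zero]
  | ha x y hx hy => simp only [map_add, hx, hy, tmul_add, Finset.sum_add_distrib]
  | ht a c =>
    rw [comp_tmul, Assoc.comp_one_eq]
    conv_lhs => rw [coev_spec k (Assoc.pr J a), map_sum, sum_tmul]
    refine Finset.sum_congr rfl fun b _ => ?_
    rw [extr_tmul, Assoc.ι, QAlg.ι_op_smul, ← QAlg.op_smul_def, smul_tmul]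

lemma extr_kosD (f : RDual k E) (c : Cog J (i + 1)) :
    extr i f (kosD J i (tmul k 1 c)) = Cog.act f c := by
  rw [kosD_tmul, map_sum]
  conv_rhs => rw [coev_spec_dual f, map_sum, AddMonoidHom.finsetSum_apply]
  refine Finset.sum_congr rfl fun b _ => ?_
  rw [one_mul, extr_tmul, Assoc.pr_ι, Cog.smul_act]

lemma kosD_one_tmul_injective {c : Cog J (i + 1)} (h : kosD J i (tmul k 1 c) = 0) : c = 0 :=
  Cog.eq_zero_of_act fun f => by rw [← extr_kosD, h, map_zero]

/-- An element `t` of `Q^⊥` is a functional on `A_2`. Applying it to the first factor of `kosD w`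
computes the action of `t` on the coordinates of `w`, so a cycle gives zero. -/
lemma sum_act_extr_eq_zero {w : BTensor k (Assoc J) (Cog J (i + 1))} (hw : kosD J i w = 0)
    (Θ : BTensor k (RDual k E) (RDual k E) →+ Cog J i)
    (hΘ : ∀ f g, Θ (tmul k f g) = Cog.act f (extr (i + 1) g w))
    {t : BTensor k (RDual k E) (RDual k E)} (ht : t ∈ perp (relSpace J)) : Θ t = 0 := by
  let Ψ (w : BTensor k (Assoc J) (Cog J (i + 1))) :
      BTensor k (RDual k E) (RDual k E) →+ Cog J i :=
    BTensor.lift (AddMonoidHom.mk' (fun f => AddMonoidHom.mk'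
        (fun g => Cog.act f (extr (i + 1) g w)) (fun g g' => by simp))
        (fun f f' => by ext; simp))
      (fun f r g => by
        change Cog.act _ (extr (i + 1) g w) = Cog.act f (extr (i + 1) (r • g) w)
        rw [extr_smul, Cog.act_smul])
  obtain ⟨φ, h1, h2⟩ := Assoc.exists_functional ht
  let Φ : BTensor k (Assoc J) (Cog J i) →+ Cog J i := BTensor.lift
    (AddMonoidHom.mk' (fun a => DistribSMul.toAddMonoidHom _ (φ a))
      (fun a a' => by ext; simp [mul_add]))
    (fun a r c => by
      change φ (a * Assoc.unit J r) • c = φ a • r • c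
      rw [h2, mul_smul])
  have key : ∀ w, Ψ w t = Φ (kosD J i w) := by
    intro w
    induction w using BTensor.induction_on with
    | h0 =>
      rw [map_zero, map_zero, show Ψ 0 = 0 from BTensor.hom_ext fun f g => by
        change Cog.act f (extr (i + 1) g 0) = 0
        simp]
      rfl
    | ha x y hx hy =>
      rw [map_add, map_add, ← hx, ← hy, show Ψ (x + y) = Ψ x + Ψ y from
        BTensor.hom_ext fun f g => by
          change Cog.act f (extr (i + 1) g (x + y))
            = Cog.act f (extr (i + 1) g x) + Cog.act f (extr (i + 1) g y)
          simp]
      rfl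
    | ht a c =>
      rw [kosD_tmul, map_sum]
      have h3 : ∀ b, Φ (tmul k (a * Assoc.ι J (coevVec k E b)) (Cog.act (coevDual k E b) c))
          = pairing t (tmul k (Assoc.pr J a) (coevVec k E b)) • Cog.act (coevDual k E b) c :=
        fun b => by rw [← h1]; rfl
      simp only [h3]
      suffices h4 : ∀ s, Ψ (tmul k a c) s = ∑ b,
          pairing s (tmul k (Assoc.pr J a) (coevVec k E b)) • Cog.act (coevDual k E b) c from h4 t
      intro s
      induction s using BTensor.induction_on with
      | h0 => simp
      | ha t t' h h' =>
        rw [map_add, h, h']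
        simp only [map_add, AddMonoidHom.add_apply, add_smul, Finset.sum_add_distrib]
      | ht f g =>
        change Cog.act f (g (Assoc.pr J a) • c) = _
        rw [Cog.act_smul]
        conv_lhs => rw [coev_spec_dual (MulOpposite.op (g (Assoc.pr J a)) • f), map_sum,
          AddMonoidHom.finsetSum_apply]
        refine Finset.sum_congr rfl fun b _ => ?_
        rw [← Cog.smul_act]
        rfl
  rw [show Θ = Ψ w from BTensor.hom_ext fun f g => hΘ f g, key, hw, map_zero]

/-- Exactness of the Koszul complex in the degree of the generators plus one. -/
lemma exists_kosD_of_comp_one {w : BTensor k (Assoc J) (Cog J i)} (h1 : BTensor.comp 1 w = w)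
    (hw : ∀ i' (h : i = i' + 1), kosD J i' (h ▸ w) = 0) :
    ∃ c, kosD J i (tmul k 1 c) = w := by
  -- The sought functional must satisfy `c(b f) = (extr f w)(b)`. The only condition for it to exist
  -- on `A^!` is compatibility with `Q^⊥`. In degree zero this is automatic, since functionals of
  -- degree zero kill all multiples of `E^*`; in positive degree it is the cycle condition.
  have hw' : ∀ (Θ : BTensor k (RDual k E) (RDual k E) →+ k) (b : KDual J),
      (∀ f g, Θ (tmul k f g) = extr i g w (b * KDual.ι J f)) →
      ∀ t ∈ perp (relSpace J), Θ t = 0 := by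
    intro Θ b hΘ t ht
    rcases i with _ | i
    · rw [show Θ = 0 from BTensor.hom_ext fun f g => by rw [hΘ, Cog.zero_apply_mul_ι]; rfl]
      rfl
    · let Ψ : BTensor k (RDual k E) (RDual k E) →+ Cog J i :=
        BTensor.lift (AddMonoidHom.mk' (fun f => AddMonoidHom.mk'
            (fun g => Cog.act f (extr (i + 1) g w)) (fun g g' => by simp))
            (fun f f' => by ext; simp))
          (fun f r g => by
            change Cog.act _ (extr (i + 1) g w) = Cog.act f (extr (i + 1) (r • g) w)
            rw [extr_smul, Cog.act_smul])
      have h := sum_act_extr_eq_zero (hw i rfl) Ψ (fun f g => rfl) ht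
      have h' : Θ = (AddMonoidHom.mk' (fun c : Cog J i => c b) (fun _ _ => rfl)).comp Ψ :=
        BTensor.hom_ext fun f g => (hΘ f g).trans rfl
      rw [h']
      change Ψ t b = 0
      rw [h]
      rfl
  obtain ⟨φ, hφ, hφ'⟩ := KDual.exists_hom (J := J) (K := k)
    (AddMonoidHom.mk' (fun b => AddMonoidHom.mk' (fun f => extr i f w b) (fun f g => by simp))
      (fun b b' => by ext; simp))
    (fun b r f => by
      change extr i f w _ = extr i (r • f) w b
      rw [extr_smul]
      rfl)
    (fun b Θ hΘ => hw' Θ b hΘ)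
  have hφ1 : ∀ b f, φ (b * KDual.ι J f) = extr i f w b := hφ
  refine ⟨Cog.ofHom φ (fun r b => ?_) (fun b => ?_), ?_⟩
  · induction b using QAlg.induction_right with
    | unit s => rw [QAlg.smul_def, ← map_mul, hφ', hφ', mul_zero]
    | add a b ha hb => rw [smul_add, map_add, ha, hb, map_add, mul_add]
    | mul_ι b f _ =>
      rw [QAlg.smul_def, ← mul_assoc, hφ1, hφ1, ← QAlg.smul_def, Cog.map_smul]
  · induction b using QAlg.induction_right with
    | unit s => rw [KDual.comp_succ_unit, hφ', map_zero]
    | add a b ha hb => rw [map_add, map_add, ha, hb, map_add]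
    | mul_ι b f _ => rw [KDual.comp_succ_mul_ι, hφ1, hφ1, Cog.map_comp]
  · refine Eq.trans ?_ ((comp_one_eq_sum_extr w).symm.trans h1)
    rw [kosD_tmul]
    refine Finset.sum_congr rfl fun b _ => ?_
    rw [one_mul]
    congr 1
    ext a
    exact hφ a _

/-- The Koszul differential squares to zero. -/
lemma kosD_kosD (x : BTensor k (Assoc J) (Cog J (i + 1 + 1))) :
    kosD J i (kosD J (i + 1) x) = 0 := by
  -- The double sum is the coevaluation element of `E ⊗ E` inserted into a map which kills `Q^⊥`. It
  -- may be replaced by the coevaluation element of `Q`, whose first factors vanish in `A`.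
  obtain ⟨N, q, t, -, hΘ⟩ := exists_coev_rel J
  induction x using BTensor.induction_on with
  | h0 => simp
  | ha x y hx hy => simp only [map_add, hx, hy, add_zero]
  | ht a c =>
    let act2 : BTensor k (RDual k E) (RDual k E) →+ Cog J i :=
      BTensor.lift (AddMonoidHom.mk' (fun f => AddMonoidHom.mk'
          (fun g => Cog.act f (Cog.act g c)) (fun g g' => by simp))
          (fun f f' => by ext; simp))
        (fun f r g => by
          change Cog.act _ (Cog.act g c) = Cog.act f (Cog.act (r • g) c)
          rw [← Cog.smul_act, Cog.act_smul])
    have hact2 : ∀ s b, act2 s b = c (b * KDual.m2 J s) := by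
      intro s b
      induction s using BTensor.induction_on with
      | h0 => simp
      | ha s s' h h' => rw [map_add, map_add, mul_add, map_add, ← h, ← h']; rfl
      | ht f g =>
        change c (b * KDual.ι J f * KDual.ι J g) = c (b * (KDual.ι J f * KDual.ι J g))
        rw [mul_assoc]
    let mkm2 : BTensor k E E →+ Assoc J :=
      (QAlg.mk (quadIdeal (relSpace J))).toAddMonoidHom.comp (TAlg.m2 k E)
    let Θ : BTensor k E E →+ BTensor k (RDual k E) (RDual k E) →+
        BTensor k (Assoc J) (Cog J i) :=
      AddMonoidHom.mk' (fun w => (tmulHom k (a * mkm2 w)).comp act2)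
        (fun w w' => by ext s; simp [mul_add])
    have h := hΘ Θ (fun w r s => by
        change tmul k (a * mkm2 _) (act2 s) = tmul k _ (act2 (r • s))
        have h1 : act2 (r • s) = r • act2 s := by
          ext b
          rw [hact2, Cog.smul_apply, hact2, mul_assoc]
          change c (b * QAlg.mk _ (TAlg.m2 _ _ (r • s))) = _
          rw [m2_smul, map_mul (QAlg.mk _)]
          rfl
        rw [h1, ← smul_tmul, QAlg.op_smul_def, mul_assoc]
        congr 2
        change QAlg.mk _ (TAlg.m2 k E _) = _
        rw [m2_op_smul, map_mul]
        rfl)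
      (fun w s hs => by
        change tmul k _ (act2 s) = 0
        rw [show act2 s = 0 from Cog.ext fun b => by
          rw [hact2, KDual.m2_eq_zero hs, mul_zero, map_zero]; rfl, tmul_zero])
    rw [kosD_tmul, map_sum]
    have h2 : ∀ b, kosD J i (tmul k (a * Assoc.ι J (coevVec k E b))
          (Cog.act (coevDual k E b) c))
        = ∑ b', Θ (coevVec2 k E (b, b')) (coevDual2 k E (b, b')) := by
      intro b
      rw [kosD_tmul]
      exact Finset.sum_congr rfl fun b' _ => by rw [mul_assoc]; rfl
    rw [Finset.sum_congr rfl fun b _ => h2 b, ← Fintype.sum_prod_type', h]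
    refine Finset.sum_eq_zero fun j _ => ?_
    change tmul k (a * mkm2 (q j)) _ = 0
    rw [show mkm2 (q j) = 0 from QAlg.mk_eq_zero _ (m2_mem_quadIdeal (q j).2), mul_zero,
      zero_tmul]

end Koszul

/-! ## Graded modules -/

section GradedModules

/-- The criterion by which all graded modules below are constructed: candidate projections separate
the pieces, and spanning is checked separately. -/
lemma isInternal_of_proj {M : Type*} [AddCommGroup M] (deg : ℤ → AddSubgroup M) (p : ℤ → M →+ M)
    (h1 : ∀ n, ∀ x ∈ deg n, p n x = x) (h2 : ∀ n m, n ≠ m → ∀ x ∈ deg m, p n x = 0)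
    (h3 : ∀ x, x ∈ ⨆ n, deg n) : DirectSum.IsInternal deg := by
  have hp : ∀ (x : DirectSum ℤ fun n => deg n) n,
      p n (DirectSum.coeAddMonoidHom deg x) = x n := by
    intro x n
    induction x using DirectSum.induction_on with
    | zero => simp
    | of m y =>
      rw [DirectSum.coeAddMonoidHom_of]
      by_cases h : m = n
      · subst h
        rw [DirectSum.of_eq_same, h1 _ _ y.2]
      · rw [DirectSum.of_eq_of_ne _ _ _ (Ne.symm h), h2 n m (Ne.symm h) _ y.2]
        rfl
    | add x y hx hy => rw [map_add, map_add, hx, hy]; rfl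
  refine ⟨(injective_iff_map_eq_zero _).2 fun x hx => ?_, fun x => ?_⟩
  · refine DFunLike.ext _ _ fun n => Subtype.ext ?_
    rw [← hp, hx, map_zero]
    rfl
  · refine AddSubgroup.iSup_induction (C := fun x => ∃ a, DirectSum.coeAddMonoidHom deg a = x)
      deg (h3 x) (fun n y hy => ⟨DirectSum.of (fun n => deg n) n ⟨y, hy⟩, ?_⟩) ⟨0, map_zero _⟩ ?_
    · rw [DirectSum.coeAddMonoidHom_of]
    · rintro _ _ ⟨a, rfl⟩ ⟨b, rfl⟩
      exact ⟨a + b, map_add _ _ _⟩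

namespace GrMod

variable {Λ : Type u} [Ring Λ] {𝒜 : ℕ → AddSubgroup Λ}

/-- The projections of a graded module to its homogeneous components. -/
noncomputable def comp (M : GrMod 𝒜) (j : ℤ) : M.carrier →+ M.carrier :=
  (M.deg j).subtype.comp ((DFinsupp.evalAddMonoidHom j).comp
    (AddEquiv.ofBijective (DirectSum.coeAddMonoidHom M.deg) M.isInternal).symm.toAddMonoidHom)

lemma comp_mem (M : GrMod 𝒜) (j : ℤ) (m : M.carrier) : M.comp j m ∈ M.deg j :=
  SetLike.coe_mem _

lemma symm_of_mem (M : GrMod 𝒜) {j : ℤ} {m : M.carrier} (hm : m ∈ M.deg j) :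
    (AddEquiv.ofBijective (DirectSum.coeAddMonoidHom M.deg) M.isInternal).symm m
      = DirectSum.of (fun n => M.deg n) j ⟨m, hm⟩ := by
  rw [AddEquiv.symm_apply_eq]
  exact (DirectSum.coeAddMonoidHom_of M.deg j ⟨m, hm⟩).symm

lemma comp_of_mem (M : GrMod 𝒜) {j : ℤ} {m : M.carrier} (hm : m ∈ M.deg j) : M.comp j m = m := by
  change ((AddEquiv.ofBijective (DirectSum.coeAddMonoidHom M.deg) M.isInternal).symm m j).1 = m
  rw [symm_of_mem M hm, DirectSum.of_eq_same]

lemma comp_of_mem_ne (M : GrMod 𝒜) {i j : ℤ} {m : M.carrier} (hm : m ∈ M.deg j) (h : i ≠ j) :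
    M.comp i m = 0 := by
  change ((AddEquiv.ofBijective (DirectSum.coeAddMonoidHom M.deg) M.isInternal).symm m i).1 = 0
  rw [symm_of_mem M hm, DirectSum.of_eq_of_ne _ _ _ h]
  rfl

@[elab_as_elim]
lemma induction (M : GrMod 𝒜) {P : M.carrier → Prop} (m : M.carrier)
    (mem : ∀ j, ∀ m ∈ M.deg j, P m) (add : ∀ m m', P m → P m' → P (m + m')) : P m := by
  obtain ⟨x, rfl⟩ := M.isInternal.2 m
  induction x using DirectSum.induction_on with
  | zero => rw [map_zero]; exact mem 0 0 (zero_mem _)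
  | of j y => rw [DirectSum.coeAddMonoidHom_of]; exact mem j _ y.2
  | add x y hx hy => rw [map_add]; exact add _ _ hx hy

lemma map_comp {M N : GrMod 𝒜} (s : ℤ) (f : M.carrier →+ N.carrier)
    (hf : ∀ j, ∀ m ∈ M.deg j, f m ∈ N.deg (j + s)) (j : ℤ) (m : M.carrier) :
    f (M.comp j m) = N.comp (j + s) (f m) := by
  induction m using M.induction with
  | mem i m hm =>
    by_cases h : j = i
    · subst h
      rw [comp_of_mem M hm, comp_of_mem N (hf _ _ hm)]
    · rw [comp_of_mem_ne M hm h, comp_of_mem_ne N (hf _ _ hm) (by omega), map_zero]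
  | add m m' h h' => simp only [map_add, h, h']

lemma IsGraded.map_comp {M N : GrMod 𝒜} {f : M.carrier →ₗ[Λ] N.carrier} (hf : IsGraded f)
    (j : ℤ) (m : M.carrier) : f (M.comp j m) = N.comp j (f m) := by
  have := GrMod.map_comp (M := M) (N := N) 0 f.toAddMonoidHom
    (fun j m hm => by rw [add_zero]; exact hf j m hm) j m
  rwa [add_zero] at this

end GrMod

end GradedModules

/-! ### Induced graded modules `A ⊗_k N` -/

section FreeModules

variable {k V : Type u} [Ring k] [AddCommGroup V] [Module k V] [Module kᵐᵒᵖ V]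

namespace QAlg

variable {Q : AddSubgroup (BTensor k V V)}

lemma toPoly_of_mem {n : ℕ} {a : QAlg (quadIdeal Q)} (ha : a ∈ deg (quadIdeal Q) n) :
    toPoly Q a = Polynomial.monomial n a := by
  ext m
  change comp m a = _
  rw [Polynomial.coeff_monomial]
  split_ifs with h
  · rw [← h, comp_of_mem ha]
  · exact comp_of_mem_ne ha (Ne.symm h)

lemma comp_mul_of_mem {p : ℕ} {a : QAlg (quadIdeal Q)} (ha : a ∈ deg (quadIdeal Q) p)
    (n : ℕ) (b : QAlg (quadIdeal Q)) : comp (n + p) (a * b) = a * comp n b := by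
  change (toPoly Q (a * b)).coeff _ = a * (toPoly Q b).coeff n
  rw [map_mul, toPoly_of_mem ha, Polynomial.coeff_monomial_mul]

lemma comp_mul_of_mem_of_lt {p : ℕ} {a : QAlg (quadIdeal Q)} (ha : a ∈ deg (quadIdeal Q) p)
    {n : ℕ} (h : n < p) (b : QAlg (quadIdeal Q)) : comp n (a * b) = 0 := by
  change (toPoly Q (a * b)).coeff _ = 0
  rw [map_mul, toPoly_of_mem ha, ← Polynomial.C_mul_X_pow_eq_monomial, mul_assoc,
    Polynomial.coeff_C_mul, Polynomial.coeff_X_pow_mul', if_neg (by omega), mul_zero]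

lemma mul_mem {J : TwoSidedIdeal (TAlg k V)} {p n : ℕ} {a b : QAlg J} (ha : a ∈ deg J p)
    (hb : b ∈ deg J n) : a * b ∈ deg J (n + p) := by
  obtain ⟨t, ht, rfl⟩ := hb
  induction ht using AddSubgroup.closure_induction with
  | zero => rw [map_zero, mul_zero]; exact zero_mem _
  | add x y _ _ hx hy => rw [map_add, mul_add]; exact add_mem hx hy
  | neg x _ hx => rw [map_neg, mul_neg]; exact neg_mem hx
  | mem y hy =>
    obtain ⟨s, l, hl, rfl⟩ := hy
    change a * mk J _ ∈ _
    induction l using List.reverseRecOn generalizing n with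
    | nil =>
      obtain rfl : 0 = n := hl
      simpa [QAlg.mk_unit] using QAlg.mul_unit_mem ha s
    | append_singleton l x ih =>
      obtain rfl : l.length + 1 = n := by simpa using hl
      have := mul_ι_mem (ih rfl) x
      rw [show l.length + 1 + p = l.length + p + 1 by omega]
      convert this using 1
      simp [mul_assoc, QAlg.ι]

end QAlg

variable {Q : AddSubgroup (BTensor k V V)} {N : Type u} [AddCommGroup N] [Module k N]

lemma BTensor.comp_smul_of_mem {p : ℕ} {a : QAlg (quadIdeal Q)}
    (ha : a ∈ QAlg.deg (quadIdeal Q) p) (n : ℕ) (x : BTensor k (QAlg (quadIdeal Q)) N) :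
    comp (n + p) (a • x) = a • comp n x := by
  induction x using BTensor.induction_on with
  | h0 => simp
  | ha x y hx hy => simp only [map_add, smul_add, hx, hy]
  | ht b m => rw [alg_smul_tmul, comp_tmul, comp_tmul, QAlg.comp_mul_of_mem ha, alg_smul_tmul]

lemma BTensor.comp_smul_of_mem_of_lt {p : ℕ} {a : QAlg (quadIdeal Q)}
    (ha : a ∈ QAlg.deg (quadIdeal Q) p) {n : ℕ} (h : n < p)
    (x : BTensor k (QAlg (quadIdeal Q)) N) : comp n (a • x) = 0 := by
  induction x using BTensor.induction_on with
  | h0 => simp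
  | ha x y hx hy => simp only [map_add, smul_add, hx, hy, add_zero]
  | ht b m => rw [alg_smul_tmul, comp_tmul, QAlg.comp_mul_of_mem_of_lt ha h, zero_tmul]

/-- The graded module `A ⊗_k N` with generators in degree `i`. -/
noncomputable def freeGr (Q : AddSubgroup (BTensor k V V)) (N : Type u) [AddCommGroup N]
    [Module k N] (i : ℤ) : GrMod (QAlg.deg (quadIdeal Q)) where
  carrier := BTensor k (QAlg (quadIdeal Q)) N
  deg n :=
    { carrier := {x | ∀ m : ℕ, (m : ℤ) + i ≠ n → comp m x = 0}
      zero_mem' := fun m _ => map_zero _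
      add_mem' := fun hx hy m hm => by rw [map_add, hx m hm, hy m hm, add_zero]
      neg_mem' := fun hx m hm => by rw [map_neg, hx m hm, neg_zero] }
  isInternal := by
    have hmem : ∀ (m : ℕ) (x : BTensor k (QAlg (quadIdeal Q)) N) (m' : ℕ),
        (m' : ℤ) + i ≠ m + i → comp m' (comp m x) = 0 := fun m x m' h =>
      comp_comp_ne (by rintro rfl; exact h rfl) x
    refine isInternal_of_proj _ (fun n => if i ≤ n then comp (n - i).toNat else 0) ?_ ?_ ?_
    · intro n x hx
      obtain ⟨M, hM, hsum⟩ := exists_sum_comp x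
      split_ifs with h
      · conv_rhs => rw [hsum]
        by_cases hn : (n - i).toNat < M
        · rw [Finset.sum_eq_single_of_mem _ (Finset.mem_range.2 hn)]
          intro m _ hm
          exact hx m (by omega)
        · rw [hM _ (by omega)]
          refine (Finset.sum_eq_zero fun m hm => hx m ?_).symm
          have := Finset.mem_range.1 hm
          omega
      · rw [hsum]
        exact (Finset.sum_eq_zero fun m _ => hx m (by omega)).symm
    · intro n m hnm x hx
      split_ifs with h
      · exact hx _ (by omega)
      · rfl
    · intro x
      obtain ⟨M, -, hsum⟩ := exists_sum_comp x
      rw [hsum]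
      exact sum_mem fun m _ => AddSubgroup.mem_iSup_of_mem ((m : ℤ) + i) (hmem m x)
  smul_mem {p j a x} ha hx m hm := by
    by_cases h : m < p
    · exact comp_smul_of_mem_of_lt ha h x
    · obtain ⟨n, rfl⟩ : ∃ n, m = n + p := ⟨m - p, by omega⟩
      rw [comp_smul_of_mem ha, hx n (by push_cast at hm; omega), smul_zero]

end FreeModules

/-! ## Comparison with a linear resolution -/

section Comparison

variable {k V : Type u} [Ring k] [AddCommGroup V] [Module k V] [Module kᵐᵒᵖ V]
  {Q : AddSubgroup (BTensor k V V)}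

/-- The ring has only nonnegative degrees, so nothing lies below the degree of the generators. -/
lemma GrMod.comp_eq_zero_of_lt {P : GrMod (QAlg.deg (quadIdeal Q))} {i : ℤ}
    (hP : Submodule.span (QAlg (quadIdeal Q)) (P.deg i : Set P.carrier) = ⊤) {j : ℤ} (h : j < i)
    (m : P.carrier) : P.comp j m = 0 := by
  have hm : m ∈ Submodule.span (QAlg (quadIdeal Q)) (P.deg i : Set P.carrier) := hP ▸ trivial
  induction hm using Submodule.closure_induction with
  | zero => exact map_zero _
  | add x y _ _ hx hy => rw [map_add, hx, hy, add_zero]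
  | smul_mem a v hv =>
    obtain ⟨N, -, hN⟩ := QAlg.exists_sum_comp a
    rw [hN, Finset.sum_smul, map_sum]
    exact Finset.sum_eq_zero fun n _ =>
      P.comp_of_mem_ne (P.smul_mem (QAlg.comp_mem n a) hv) (by omega)

/-- An identification of `N` with the degree `i` piece of `P`. -/
structure GenIso (N : Type u) [AddCommGroup N] [Module k N] (P : GrMod (QAlg.deg (quadIdeal Q)))
    (i : ℤ) where
  toHom : N →+ P.carrier
  map_smul : ∀ (r : k) n, toHom (r • n) = QAlg.unit (quadIdeal Q) r • toHom n
  mem : ∀ n, toHom n ∈ P.deg i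
  inj : ∀ n, toHom n = 0 → n = 0
  surj : ∀ v ∈ P.deg i, ∃ n, toHom n = v

namespace GenIso

variable {N : Type u} [AddCommGroup N] [Module k N] {P : GrMod (QAlg.deg (quadIdeal Q))}
    {i : ℤ} (τ : GenIso N P i)

/-- The map `A ⊗_k N → P`. -/
def lift : BTensor k (QAlg (quadIdeal Q)) N →ₗ[QAlg (quadIdeal Q)] P.carrier :=
  let f : BTensor k (QAlg (quadIdeal Q)) N →+ P.carrier := BTensor.lift
    (AddMonoidHom.mk' (fun a => (DistribSMul.toAddMonoidHom _ a).comp τ.toHom)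
      (fun a b => by ext; simp [add_smul]))
    (fun a r n => by
      change (a * QAlg.unit (quadIdeal Q) r) • τ.toHom n = a • τ.toHom (r • n)
      rw [τ.map_smul, mul_smul])
  { f with
    map_smul' := fun a x => by
      change f (a • x) = a • f x
      induction x using BTensor.induction_on with
      | h0 => simp
      | ha x y hx hy => rw [smul_add, map_add, hx, hy, map_add, smul_add]
      | ht b n => exact mul_smul a b (τ.toHom n) }

lemma lift_tmul (a : QAlg (quadIdeal Q)) (n : N) : τ.lift (tmul k a n) = a • τ.toHom n := rfl

lemma lift_comp (m : ℕ) (x : BTensor k (QAlg (quadIdeal Q)) N) :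
    τ.lift (BTensor.comp m x) = P.comp (i + m) (τ.lift x) := by
  induction x using BTensor.induction_on with
  | h0 => simp
  | ha x y hx hy => simp only [map_add, hx, hy]
  | ht a n =>
    rw [BTensor.comp_tmul, lift_tmul, lift_tmul]
    obtain ⟨M, hM, hsum⟩ := QAlg.exists_sum_comp a
    conv_rhs => rw [hsum, Finset.sum_smul, map_sum]
    have h1 : ∀ m', m' ≠ m → P.comp (i + m) (QAlg.comp m' a • τ.toHom n) = 0 := fun m' hm' =>
      P.comp_of_mem_ne (P.smul_mem (QAlg.comp_mem m' a) (τ.mem n)) (by omega)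
    by_cases hm : m < M
    · rw [Finset.sum_eq_single_of_mem _ (Finset.mem_range.2 hm) (fun m' _ h => h1 m' h)]
      exact (P.comp_of_mem (P.smul_mem (QAlg.comp_mem m a) (τ.mem n))).symm
    · rw [hM m (by omega), zero_smul, Finset.sum_eq_zero]
      exact fun m' hm' => h1 m' (by have := Finset.mem_range.1 hm'; omega)

variable [SMulCommClass k kᵐᵒᵖ V]

lemma exists_comp_zero_eq (x : BTensor k (QAlg (quadIdeal Q)) N) :
    ∃ n, BTensor.comp 0 x = tmul k 1 n := by
  induction x using BTensor.induction_on with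
  | h0 => exact ⟨0, by rw [map_zero, tmul_zero]⟩
  | ha x y hx hy =>
    obtain ⟨n, hn⟩ := hx
    obtain ⟨n', hn'⟩ := hy
    exact ⟨n + n', by rw [map_add, hn, hn', tmul_add]⟩
  | ht a n =>
    refine ⟨QAlg.aug Q a • n, ?_⟩
    rw [BTensor.comp_tmul, QAlg.comp_zero_eq, ← smul_tmul, QAlg.op_smul_def, one_mul]

/-- Surjectivity is generation in degree `i`. Projectivity provides a graded section; it maps
generators to the degree `i` part `1 ⊗ N`, where the given identification is injective, so it is
also a left inverse. -/
lemma lift_bijective (hP : P.IsProjective)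
    (hgen : Submodule.span (QAlg (quadIdeal Q)) (P.deg i : Set P.carrier) = ⊤) :
    Function.Bijective τ.lift := by
  have hsurj : Function.Surjective τ.lift := by
    rw [← LinearMap.range_eq_top, ← top_le_iff, ← hgen, Submodule.span_le]
    intro v hv
    obtain ⟨n, rfl⟩ := τ.surj v hv
    exact ⟨tmul k 1 n, by rw [lift_tmul, one_smul]⟩
  refine ⟨?_, hsurj⟩
  have hgr : GrMod.IsGraded (M := freeGr Q N i) (N := P) τ.lift := by
    intro j (x : BTensor k (QAlg (quadIdeal Q)) N) hx
    obtain ⟨M, -, hsum⟩ := BTensor.exists_sum_comp x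
    change τ.lift x ∈ _
    rw [hsum, map_sum]
    refine sum_mem fun m _ => ?_
    by_cases h : (m : ℤ) + i = j
    · rw [lift_comp, ← h, add_comm i]
      exact P.comp_mem _ _
    · rw [show BTensor.comp m x = 0 from hx m h, map_zero]
      exact zero_mem _
  obtain ⟨h, hh, hid⟩ := hP (freeGr Q N i) P τ.lift LinearMap.id hgr hsurj (fun j m hm => hm)
  refine Function.LeftInverse.injective (g := h) fun x => ?_
  induction x using BTensor.induction_on with
  | h0 => rw [map_zero]; exact map_zero h
  | ha x y hx hy => rw [map_add]; exact (map_add h _ _).trans (congrArg₂ _ hx hy)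
  | ht a n =>
    rw [eq_smul_one_tmul, LinearMap.map_smul]
    refine (LinearMap.map_smul h _ _).trans (congrArg (a • ·) ?_)
    -- The section preserves degrees, so this value has degree `i` and is therefore of the form `1 ⊗
    -- n'`.
    have h1 : h (τ.lift (tmul k 1 n)) ∈ (freeGr Q N i).deg i :=
      hh _ _ (by rw [lift_tmul, one_smul]; exact τ.mem n)
    obtain ⟨M, h2, hsum⟩ := BTensor.exists_sum_comp (Q := Q) (N := N) (h (τ.lift (tmul k 1 n)))
    obtain ⟨n', hn'⟩ := exists_comp_zero_eq (Q := Q) (N := N) (h (τ.lift (tmul k 1 n)))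
    have h3 : h (τ.lift (tmul k 1 n)) = tmul k 1 n' := by
      refine Eq.trans hsum (Eq.trans ?_ hn')
      rcases Nat.eq_zero_or_pos M with hM | hM
      · subst hM
        rw [h2 0 le_rfl, Finset.sum_range_zero]
      · rw [Finset.sum_eq_single_of_mem _ (Finset.mem_range.2 hM)]
        exact fun m _ hm => h1 m (by omega)
    have h4 : τ.lift (h (τ.lift (tmul k 1 n))) = τ.lift (tmul k 1 n) :=
      LinearMap.congr_fun hid _
    rw [h3, lift_tmul, lift_tmul, one_smul, one_smul] at h4
    rw [h3, sub_eq_zero.1 (τ.inj (n' - n) (by rw [map_sub, h4, sub_self]))]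

end GenIso

/-- Additive maps determined by a functional relation. -/
lemma exists_addMonoidHom_of_rel {M N : Type*} [AddCommGroup M] [AddCommGroup N]
    (R : M → N → Prop) (hadd : ∀ m m' n n', R m n → R m' n' → R (m + m') (n + n'))
    (hex : ∀ m, ∃ n, R m n) (huniq : ∀ m n n', R m n → R m n' → n = n') :
    ∃ f : M →+ N, ∀ m, R m (f m) := by
  choose f hf using hex
  exact ⟨AddMonoidHom.mk' f fun m m' => huniq _ _ _ (hf _) (hadd _ _ _ _ (hf m) (hf m')), hf⟩

end Comparison

/-! ### Exactness of the Koszul complex of a Koszul algebra -/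

section Resolution

variable {k E : Type u} [Ring k] [AddCommGroup E] [Module k E] [Module kᵐᵒᵖ E]
  [SMulCommClass k kᵐᵒᵖ E] [IsSemisimpleRing k] [Module.Finite kᵐᵒᵖ E]
  {J : TwoSidedIdeal (TAlg k E)}

lemma GrMod.mem_of_comp {Λ : Type u} [Ring Λ] {𝒜 : ℕ → AddSubgroup Λ} {M : GrMod 𝒜} {j : ℤ}
    {m : M.carrier} (h : M.comp j m = m) : m ∈ M.deg j := h ▸ M.comp_mem j m

lemma comp_one_kosD_one_tmul {i : ℕ} (c : Cog J (i + 1)) :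
    BTensor.comp 1 (kosD J i (tmul k 1 c)) = kosD J i (tmul k 1 c) := by
  have h := kosD_comp 0 (tmul k (1 : Assoc J) c)
  rw [comp_tmul, ← map_one (QAlg.unit _), QAlg.comp_zero_unit] at h
  rw [← map_one (QAlg.unit _)]
  exact h.symm

/-- The inductive step in the comparison of the Koszul complex with a linear resolution. -/
lemma GenIso.exists_succ {i : ℕ} {P P' P'' : GrMod (QAlg.deg (quadIdeal (relSpace J)))}
    (d : P'.carrier →ₗ[Assoc J] P.carrier) (d' : P''.carrier →ₗ[Assoc J] P'.carrier)
    (hd : GrMod.IsGraded d) (hd' : GrMod.IsGraded d') (hex : Function.Exact d' d)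
    (hP : P.IsProjective)
    (hgen : Submodule.span (Assoc J) (P.deg i : Set P.carrier) = ⊤)
    (hgen'' : Submodule.span (Assoc J) (P''.deg (i + 2 : ℕ) : Set P''.carrier) = ⊤)
    (τ : GenIso (Cog J i) P i)
    (ha : ∀ c, τ.lift (kosD J i (tmul k 1 c)) ∈ LinearMap.range d)
    (hb : ∀ w, BTensor.comp 1 w = w → τ.lift w ∈ LinearMap.range d →
      ∃ c, kosD J i (tmul k 1 c) = w) :
    ∃ τ' : GenIso (Cog J (i + 1)) P' (i + 1 : ℕ), (∀ x, d (τ'.lift x) = τ.lift (kosD J i x)) ∧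
      (∀ c, τ'.lift (kosD J (i + 1) (tmul k 1 c)) ∈ LinearMap.range d') ∧
      (∀ w, BTensor.comp 1 w = w → τ'.lift w ∈ LinearMap.range d' →
        ∃ c, kosD J (i + 1) (tmul k 1 c) = w) := by
  have hbij := τ.lift_bijective hP hgen
  have hmem : ∀ c, τ.lift (kosD J i (tmul k 1 c)) ∈ P.deg (i + 1 : ℕ) := fun c =>
    GrMod.mem_of_comp (by
      rw [← comp_one_kosD_one_tmul, τ.lift_comp, Nat.cast_add]
      exact P.comp_of_mem (P.comp_mem _ _))
  -- On generators the differential is injective: a generator in its kernel comes from `P''` in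
  -- degree `i + 1`, but `P''` starts in degree `i + 2`. Hence lifts of `kosD (1 ⊗ c)` in the
  -- generating degree are unique, and the comparison map is automatically additive and `k`-linear.
  have huniq : ∀ v ∈ P'.deg (i + 1 : ℕ), d v = 0 → v = 0 := by
    intro v hv h0
    obtain ⟨y, rfl⟩ := (hex v).1 h0
    rw [← P'.comp_of_mem hv, ← hd'.map_comp, GrMod.comp_eq_zero_of_lt hgen'' (by omega), map_zero]
  obtain ⟨f, hf⟩ := exists_addMonoidHom_of_rel
    (fun (c : Cog J (i + 1)) (v : P'.carrier) => v ∈ P'.deg (i + 1 : ℕ) ∧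
      d v = τ.lift (kosD J i (tmul k 1 c)))
    (fun c c' v v' h h' => ⟨add_mem h.1 h'.1, by
      rw [map_add, h.2, h'.2, tmul_add, map_add, map_add]⟩)
    (fun c => by
      obtain ⟨y, hy⟩ := ha c
      exact ⟨P'.comp (i + 1 : ℕ) y, P'.comp_mem _ _, by
        rw [hd.map_comp, hy, P.comp_of_mem (hmem c)]⟩)
    (fun c v v' h h' => sub_eq_zero.1 (huniq _ (sub_mem h.1 h'.1) (by
      rw [map_sub, h.2, h'.2, sub_self])))
  have hone : ∀ (r : k) (c : Cog J (i + 1)),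
      tmul k 1 (r • c) = QAlg.unit (quadIdeal (relSpace J)) r • tmul k 1 c := fun r c => by
    rw [alg_smul_tmul, mul_one, ← smul_tmul, QAlg.op_smul_def, one_mul]
  let τ' : GenIso (Cog J (i + 1)) P' (i + 1 : ℕ) :=
    { toHom := f
      map_smul := fun r c => sub_eq_zero.1 (huniq _
        (sub_mem (hf _).1 (by simpa using P'.smul_mem (QAlg.unit_mem r) (hf c).1)) (by
          rw [map_sub, (hf _).2, LinearMap.map_smul, (hf _).2, hone, kosD_smul, LinearMap.map_smul,
            sub_self]))
      mem := fun c => (hf c).1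
      inj := fun c h => kosD_one_tmul_injective (hbij.1 (by
        rw [← (hf c).2, h, map_zero, map_zero]))
      -- A generator `v` has `d v` in degree `i + 1` of `P`, which corresponds to `A_1 ⊗ Cog J i`;
      -- there `hb` says that images of `d` are Koszul boundaries of some `1 ⊗ c`.
      surj := fun v hv => by
        obtain ⟨w, hw⟩ := hbij.2 (d v)
        obtain ⟨c, rfl⟩ := hb w (hbij.1 (by
          rw [τ.lift_comp, hw]
          exact P.comp_of_mem (by simpa using hd _ _ hv))) (by rw [hw]; exact ⟨v, rfl⟩)
        exact ⟨c, sub_eq_zero.1 (huniq _ (sub_mem (hf c).1 hv) (by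
          rw [map_sub, (hf c).2, hw, sub_self]))⟩ }
  have hcomp : ∀ x, d (τ'.lift x) = τ.lift (kosD J i x) := by
    intro x
    induction x using BTensor.induction_on with
    | h0 => simp
    | ha x y hx hy => simp only [map_add, hx, hy]
    | ht a c =>
      rw [eq_smul_one_tmul, LinearMap.map_smul, LinearMap.map_smul, kosD_smul, LinearMap.map_smul,
        τ'.lift_tmul, one_smul]
      exact congrArg (a • ·) (hf c).2
  -- Both induction hypotheses reproduce themselves: the first from `kosD_kosD`, the second because
  -- an element of `A_1 ⊗ Cog J (i + 1)` mapping to a boundary is a Koszul cycle, and the linear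
  -- part of the Koszul complex is always exact.
  refine ⟨τ', hcomp, fun c => (hex _).1 (by rw [hcomp, kosD_kosD, map_zero]), fun w h1 hw => ?_⟩
  refine exists_kosD_of_comp_one h1 fun i' h => ?_
  obtain rfl : i = i' := by omega
  refine hbij.1 ?_
  rw [← hcomp, map_zero]
  exact (hex _).2 hw

lemma QAlg.aug_eq_zero_of_mem_augIdeal {a : Assoc J}
    (ha : a ∈ augIdeal (QAlg.deg (quadIdeal (relSpace J)))) : QAlg.aug _ a = 0 := by
  induction ha using Submodule.span_induction with
  | zero => exact map_zero _
  | add x y _ _ hx hy => rw [map_add, hx, hy, add_zero]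
  | smul a x _ hx => rw [smul_eq_mul, map_mul, hx, mul_zero]
  | mem x hx =>
    obtain ⟨i, hi, hx⟩ := hx
    have := QAlg.comp_zero_eq x
    rw [QAlg.comp_of_mem_ne hx (by omega)] at this
    rw [← QAlg.aug_unit (Q := relSpace J) (QAlg.aug _ x), ← this, map_zero]

lemma QAlg.sub_aug_mem_augIdeal (a : Assoc J) :
    a - Assoc.unit J (QAlg.aug _ a) ∈ augIdeal (QAlg.deg (quadIdeal (relSpace J))) := by
  obtain ⟨N, h0, hN⟩ := QAlg.exists_sum_comp a
  have : a - Assoc.unit J (QAlg.aug _ a)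
      = ∑ n ∈ (Finset.range (N + 1)).erase 0, QAlg.comp n a := by
    rw [← QAlg.comp_zero_eq, Finset.sum_erase_eq_sub (by simp), Finset.sum_range_succ, ← hN,
      h0 N le_rfl, add_zero]
  rw [this]
  refine sum_mem fun n hn => Submodule.subset_span ⟨n, ?_, QAlg.comp_mem n a⟩
  exact Nat.pos_of_ne_zero (Finset.ne_of_mem_erase hn)

namespace KDual

variable (J) in
/-- The augmentation of `A^!`. -/
def aug : KDual J →+* k := QAlg.aug (perp (relSpace J))

lemma aug_unit (r : k) : aug J (unit J r) = r := QAlg.aug_unit (Q := perp (relSpace J)) r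

lemma aug_ι (f : RDual k E) : aug J (ι J f) = 0 := QAlg.aug_ι (Q := perp (relSpace J)) f

lemma comp_zero_eq (b : KDual J) : comp 0 b = unit J (aug J b) :=
  QAlg.comp_zero_eq (Q := perp (relSpace J)) b

end KDual

/-- Functionals of degree zero are determined by their value at `1`, so `Cog J 0` is a copy of `k`.
This starts the comparison with the resolution of `k`. -/
lemma Cog.apply_eq (c : Cog J 0) (b : KDual J) : c b = KDual.aug J b * c 1 := by
  rw [← Cog.map_comp, KDual.comp_zero_eq, ← mul_one (KDual.unit J _), ← QAlg.smul_def,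
    Cog.map_smul]

lemma Cog.exists_apply_one_eq (r : k) : ∃ c : Cog J 0, c 1 = r := by
  refine ⟨Cog.ofHom ((AddMonoidHom.mulRight r).comp (KDual.aug J).toAddMonoidHom)
    (fun s b => ?_) (fun b => ?_), ?_⟩
  · change KDual.aug J (s • b) * r = s * (KDual.aug J b * r)
    rw [QAlg.smul_def, map_mul, KDual.aug_unit, mul_assoc]
  · change KDual.aug J (KDual.comp 0 b) * r = KDual.aug J b * r
    rw [KDual.comp_zero_eq, KDual.aug_unit]
  · change KDual.aug J 1 * r = r
    rw [map_one, one_mul]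

/-- The Koszul complex of a Koszul algebra is exact. -/
lemma kosD_exact (hK : IsKoszul (QAlg.deg (quadIdeal (relSpace J)))) {i : ℕ}
    {x : BTensor k (Assoc J) (Cog J (i + 1))} (hx : kosD J i x = 0) :
    ∃ y, kosD J (i + 1) y = x := by
  obtain ⟨P, d, ε, hP, hgen, hd, hε, hεs, hex0, hex⟩ := hK
  have hcomp0 : ∀ p : (P 0).carrier, ε ((P 0).comp 0 p) = ε p := by
    intro p
    induction p using (P 0).induction with
    | mem j p hp =>
      by_cases h : j = 0
      · rw [(P 0).comp_of_mem (h ▸ hp)]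
      · rw [(P 0).comp_of_mem_ne hp (Ne.symm h), hε j h p hp, map_zero]
    | add p p' h h' => simp only [map_add, h, h']
  -- As in the inductive step, `ε` is injective in degree zero because `P 1` has no elements there.
  have huniq : ∀ v ∈ (P 0).deg 0, ε v = 0 → v = 0 := by
    intro v hv h0
    obtain ⟨y, rfl⟩ := (hex0 v).1 h0
    rw [← (P 0).comp_of_mem hv, ← (hd 0).map_comp,
      GrMod.comp_eq_zero_of_lt (hgen (0 + 1)) (by simp), map_zero]
  let q : Assoc J →ₗ[Assoc J] Assoc J ⧸ augIdeal (QAlg.deg (quadIdeal (relSpace J))) :=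
    Submodule.mkQ _
  have hq : ∀ a, q a = 0 ↔ a ∈ augIdeal (QAlg.deg (quadIdeal (relSpace J))) := fun a =>
    Submodule.Quotient.mk_eq_zero _
  obtain ⟨f, hf⟩ := exists_addMonoidHom_of_rel
    (fun (c : Cog J 0) (v : (P 0).carrier) => v ∈ (P 0).deg 0 ∧ ε v = q (Assoc.unit J (c 1)))
    (fun c c' v v' h h' => ⟨add_mem h.1 h'.1, by
      rw [map_add, h.2, h'.2, Cog.add_apply, map_add, map_add]⟩)
    (fun c => by
      obtain ⟨y, hy⟩ := hεs (q (Assoc.unit J (c 1)))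
      exact ⟨(P 0).comp 0 y, (P 0).comp_mem _ _, by rw [hcomp0, hy]⟩)
    (fun c v v' h h' => sub_eq_zero.1 (huniq _ (sub_mem h.1 h'.1) (by
      rw [map_sub, h.2, h'.2, sub_self])))
  let τ : GenIso (Cog J 0) (P 0) (0 : ℕ) :=
    { toHom := f
      map_smul := fun r c => sub_eq_zero.1 (huniq _
        (sub_mem (hf _).1 (by simpa using (P 0).smul_mem (QAlg.unit_mem r) (hf c).1)) (by
          rw [map_sub, (hf _).2, map_smul, (hf _).2, ← map_smul, ← map_sub, hq, smul_eq_mul,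
            ← map_mul, Cog.smul_apply, one_mul, ← mul_one (KDual.unit J r), ← QAlg.smul_def,
            Cog.map_smul, sub_self]
          exact zero_mem _))
      mem := fun c => (hf c).1
      inj := fun c h => by
        have h1 : q (Assoc.unit J (c 1)) = 0 := by rw [← (hf c).2, h, map_zero]
        have h2 := QAlg.aug_eq_zero_of_mem_augIdeal ((hq _).1 h1)
        rw [QAlg.aug_unit] at h2
        ext b
        rw [Cog.apply_eq, h2, mul_zero]
        rfl
      surj := fun v hv => by
        obtain ⟨a, ha⟩ := Submodule.mkQ_surjective _ (ε v)
        obtain ⟨c, hc⟩ := Cog.exists_apply_one_eq (J := J) (QAlg.aug _ a)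
        refine ⟨c, sub_eq_zero.1 (huniq _ (sub_mem (hf c).1 hv) ?_)⟩
        rw [map_sub, (hf c).2, ← ha, hc, ← neg_eq_zero, neg_sub]
        change q a - q _ = 0
        rw [← map_sub, hq]
        exact QAlg.sub_aug_mem_augIdeal a }
  have hτ : ∀ c, τ.lift (kosD J 0 (tmul k 1 c)) ∈ LinearMap.range (d 0) := by
    intro c
    refine (hex0 _).1 ?_
    rw [← hcomp0, ← comp_one_kosD_one_tmul, τ.lift_comp,
      (P 0).comp_of_mem_ne ((P 0).comp_mem _ _) (by simp), map_zero]
  -- No cycle condition is needed at the bottom: every element of `A_1 ⊗ Cog J 0` is a Koszul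
  -- boundary.
  have hτ' : ∀ w, BTensor.comp 1 w = w → τ.lift w ∈ LinearMap.range (d 0) →
      ∃ c, kosD J 0 (tmul k 1 c) = w := fun w h1 _ =>
    exists_kosD_of_comp_one h1 fun i' h => absurd h (by omega)
  have main : ∀ i : ℕ, ∃ τ : GenIso (Cog J i) (P i) i,
      (∀ c, τ.lift (kosD J i (tmul k 1 c)) ∈ LinearMap.range (d i)) ∧
      ∀ w, BTensor.comp 1 w = w → τ.lift w ∈ LinearMap.range (d i) →
        ∃ c, kosD J i (tmul k 1 c) = w := by
    intro i
    induction i with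
    | zero => exact ⟨τ, hτ, hτ'⟩
    | succ i ih =>
      obtain ⟨τ, ha, hb⟩ := ih
      obtain ⟨τ', -, ha', hb'⟩ := GenIso.exists_succ (d i) (d (i + 1)) (hd _) (hd _) (hex _)
        (hP _) (hgen _) (hgen _) τ ha hb
      exact ⟨τ', ha', hb'⟩
  -- Three consecutive terms suffice. The identifications are extended one by one from `τ0` so that
  -- they commute with the differentials, and exactness at the middle term is transported.
  obtain ⟨τ0, ha, hb⟩ := main i
  obtain ⟨τ1, h1, ha1, hb1⟩ := GenIso.exists_succ (d i) (d (i + 1)) (hd _) (hd _) (hex _)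
    (hP _) (hgen _) (hgen _) τ0 ha hb
  obtain ⟨τ2, h2, -, -⟩ := GenIso.exists_succ (d (i + 1)) (d (i + 1 + 1)) (hd _) (hd _) (hex _)
    (hP _) (hgen _) (hgen _) τ1 ha1 hb1
  obtain ⟨y, hy⟩ := (hex i (τ1.lift x)).1 (by rw [h1, hx, map_zero])
  obtain ⟨z, rfl⟩ := (τ2.lift_bijective (hP _) (hgen _)).2 y
  exact ⟨z, (τ1.lift_bijective (hP _) (hgen _)).1 (by rw [← h2, hy])⟩

end Resolution

/-! ## Finiteness and duality -/

section Duality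

/-- Over a semisimple ring the range of `f` has a complement and `f` splits over its range, so any
map killing `ker f` factors through the whole target. This is the form in which semisimplicity is
used to dualize and to extend functionals and symbols. -/
lemma exists_extension_of_ker_le {R X Y Z : Type*} [Ring R] [IsSemisimpleRing R]
    [AddCommGroup X] [AddCommGroup Y] [AddCommGroup Z] [Module R X] [Module R Y] [Module R Z]
    (f : X →ₗ[R] Y) (g : X →ₗ[R] Z) (h : LinearMap.ker f ≤ LinearMap.ker g) :
    ∃ g' : Y →ₗ[R] Z, ∀ x, g' (f x) = g x := by
  obtain ⟨C, hC⟩ := exists_isCompl (LinearMap.range f)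
  have := Module.projective_of_isSemisimpleRing R (LinearMap.range f)
  obtain ⟨s, hs⟩ := Module.projective_lifting_property f.rangeRestrict LinearMap.id
    f.surjective_rangeRestrict
  refine ⟨g ∘ₗ s ∘ₗ Submodule.projectionOnto _ _ hC, fun x => ?_⟩
  have h1 : Submodule.projectionOnto _ _ hC (f x) = f.rangeRestrict x :=
    Submodule.projectionOnto_apply_left hC (f.rangeRestrict x)
  change g (s _) = g x
  rw [h1, ← sub_eq_zero, ← map_sub]
  refine h ?_
  have h2 : f.rangeRestrict (s (f.rangeRestrict x)) = f.rangeRestrict x := LinearMap.congr_fun hs _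
  rw [LinearMap.mem_ker, map_sub, sub_eq_zero]
  exact congrArg Subtype.val h2

lemma exists_dualBasis_left (R W : Type*) [Ring R] [IsSemisimpleRing R] [AddCommGroup W]
    [Module R W] [Module.Finite R W] :
    ∃ (n : ℕ) (x : Fin n → W) (f : Fin n → W →ₗ[R] R), ∀ w, w = ∑ a, f a w • x a := by
  obtain ⟨n, p, hp⟩ := Module.Finite.exists_fin' R W
  have := Module.projective_of_isSemisimpleRing R W
  obtain ⟨s, hs⟩ := Module.projective_lifting_property p LinearMap.id hp
  refine ⟨n, fun a => p (Pi.single a 1), fun a => LinearMap.proj a ∘ₗ s, fun w => ?_⟩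
  have h : p (s w) = w := LinearMap.congr_fun hs w
  conv_lhs => rw [← h, ← Finset.univ_sum_single (s w), map_sum]
  refine Finset.sum_congr rfl fun a _ => ?_
  change _ = s w a • p (Pi.single a 1)
  rw [← map_smul, ← Pi.single_smul, smul_eq_mul, mul_one]

variable {k E : Type u} [Ring k] [AddCommGroup E] [Module k E] [Module kᵐᵒᵖ E]
  [SMulCommClass k kᵐᵒᵖ E] [IsSemisimpleRing k] [Module.Finite kᵐᵒᵖ E]
  {J : TwoSidedIdeal (TAlg k E)}

namespace KDual

/-- The degree `i` piece of `A^!` as a left `k`-module. -/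
noncomputable def piece (J : TwoSidedIdeal (TAlg k E)) (i : ℕ) : Submodule k (KDual J) where
  __ := KDual.deg J i
  smul_mem' r a ha := by
    change r • a ∈ KDual.deg J i
    rw [QAlg.smul_def, ← comp_of_mem ha, ← comp_unit_mul]
    exact comp_mem _ _

lemma mem_piece {i : ℕ} {a : KDual J} : a ∈ piece J i ↔ a ∈ KDual.deg J i := Iff.rfl

/-- By coevaluation, `(A^!)^{i+1}` is the sum of the finitely many right translates `(A^!)^i x̂_b`,
and right multiplication is left linear. -/
lemma piece_fg (i : ℕ) : (piece J i).FG := by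
  induction i with
  | zero =>
    have : piece J 0 = Submodule.span k {1} := by
      refine le_antisymm (fun a ha => ?_) (Submodule.span_le.2 ?_)
      · rw [← comp_of_mem (mem_piece.1 ha), comp_zero_eq, ← mul_one (unit J _), ← QAlg.smul_def]
        exact Submodule.smul_mem _ _ (Submodule.subset_span rfl)
      · rintro _ rfl
        change 1 ∈ KDual.deg J 0
        rw [← map_one (unit J)]
        exact QAlg.unit_mem 1
    rw [this]
    exact Submodule.fg_span_singleton 1
  | succ i ih =>
    let mr (f : RDual k E) : KDual J →ₗ[k] KDual J :=
      { AddMonoidHom.mulRight (ι J f) with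
        map_smul' := fun r a => by
          change r • a * ι J f = r • (a * ι J f)
          rw [QAlg.smul_def, QAlg.smul_def, mul_assoc] }
    have : piece J (i + 1) = ⨆ b, (piece J i).map (mr (coevDual k E b)) := by
      refine le_antisymm (fun a ha => ?_) (iSup_le fun b => ?_)
      · rw [← comp_of_mem (mem_piece.1 ha)]
        clear ha
        induction a using QAlg.induction_right with
        | unit r => rw [comp_succ_unit]; exact zero_mem _
        | add a b ha hb => rw [map_add]; exact add_mem ha hb
        | mul_ι a f _ =>
          rw [comp_succ_mul_ι, coev_spec_dual f, map_sum, Finset.mul_sum]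
          refine sum_mem fun b _ => Submodule.mem_iSup_of_mem b ?_
          rw [QAlg.ι_smul, ← mul_assoc]
          exact ⟨_, QAlg.mul_unit_mem (comp_mem i a) _, rfl⟩
      · rintro _ ⟨a, ha, rfl⟩
        exact QAlg.mul_ι_mem ha _
    rw [this]
    exact Submodule.fg_iSup _ fun b => ih.map _

lemma exists_dualBasis (J : TwoSidedIdeal (TAlg k E)) (i : ℕ) :
    ∃ (n : ℕ) (b : Fin n → KDual J) (c : Fin n → Cog J i),
      (∀ s, b s ∈ KDual.deg J i) ∧ ∀ a, comp i a = ∑ s, c s a • b s := by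
  have := Module.Finite.iff_fg.2 (piece_fg (J := J) i)
  obtain ⟨n, b, f, h⟩ := exists_dualBasis_left k (piece J i)
  let p : KDual J →+ piece J i := AddMonoidHom.mk' (fun a => ⟨comp i a, comp_mem i a⟩)
    (fun a b => Subtype.ext (map_add _ _ _))
  refine ⟨n, fun s => (b s).1, fun s => Cog.ofHom ((f s).toAddMonoidHom.comp p) (fun r a => ?_)
    (fun a => ?_), fun s => (b s).2, fun a => ?_⟩
  · change f s (p (r • a)) = r * f s (p a)
    rw [show p (r • a) = r • p a from Subtype.ext (by
      change comp i (r • a) = r • comp i a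
      rw [QAlg.smul_def, QAlg.smul_def, comp_unit_mul]), map_smul, smul_eq_mul]
  · change f s (p (comp i a)) = f s (p a)
    congr 1
    exact Subtype.ext (comp_of_mem (comp_mem i a))
  · have := congrArg Subtype.val (h (p a))
    change comp i a = _ at this
    rw [this]
    exact map_sum (piece J i).subtype _ _

/-- Finite dual bases make the functionals in `Cog J i` separate the elements of degree `i`.
Identities in `A^!` are checked below by applying functionals. -/
lemma comp_eq_zero_of_cog {i : ℕ} {a : KDual J} (h : ∀ c : Cog J i, c a = 0) : comp i a = 0 := by
  obtain ⟨n, b, c, -, hc⟩ := exists_dualBasis J i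
  rw [hc]
  exact Finset.sum_eq_zero fun s _ => by rw [h, zero_smul]

end KDual

/-- Exactness of the complex of right `k`-linear maps from `A` to `A^!`. -/
lemma exists_of_cocycle (hK : IsKoszul (QAlg.deg (quadIdeal (relSpace J)))) {i : ℕ}
    (ψ : Assoc J →+ KDual J) (hr : ∀ a r, ψ (a * Assoc.unit J r) = ψ a * KDual.unit J r)
    (hdeg : ∀ a, KDual.comp (i + 1) (ψ a) = ψ a)
    (hcoc : ∀ a, ∑ b, ψ (a * Assoc.ι J (coevVec k E b)) * KDual.ι J (coevDual k E b) = 0) :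
    ∃ ψ' : Assoc J →+ KDual J, (∀ a r, ψ' (a * Assoc.unit J r) = ψ' a * KDual.unit J r) ∧
      (∀ a, KDual.comp i (ψ' a) = ψ' a) ∧
      ∀ a, ∑ b, ψ' (a * Assoc.ι J (coevVec k E b)) * KDual.ι J (coevDual k E b) = ψ a := by
  -- The map `ψ` is viewed as the functional `a ⊗ c ↦ c(ψ a)` on a term of the Koszul complex. The
  -- cocycle condition says that it kills the image of the preceding differential, hence, by
  -- exactness, the kernel of the following one.
  let l : BTensor k (Assoc J) (Cog J (i + 1)) →+ k := BTensor.lift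
    (AddMonoidHom.mk' (fun a => AddMonoidHom.mk' (fun c : Cog J (i + 1) => c (ψ a))
      (fun c c' => rfl)) (fun a a' => by ext c; exact (congrArg c (map_add ψ a a')).trans (map_add c _ _)))
    (fun a r c => by
      change c (ψ (a * Assoc.unit J r)) = c (ψ a * KDual.unit J r)
      rw [hr])
  have hl : ∀ a c, l (tmul k a c) = c (ψ a) := fun a c => rfl
  let L : BTensor k (Assoc J) (Cog J (i + 1)) →ₗ[kᵐᵒᵖ] k :=
    { l with
      map_smul' := fun r x => by
        change l (r • x) = r • l x
        induction x using BTensor.induction_on with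
        | h0 => simp
        | ha x y hx hy => simp only [smul_add, map_add, hx, hy]
        | ht a c => rw [right_smul_tmul, hl, hl]; rfl }
  let Dl : BTensor k (Assoc J) (Cog J (i + 1)) →ₗ[kᵐᵒᵖ] BTensor k (Assoc J) (Cog J i) :=
    { kosD J i with map_smul' := fun r x => kosD_op_smul r x }
  have hlD : ∀ y, l (kosD J (i + 1) y) = 0 := by
    intro y
    induction y using BTensor.induction_on with
    | h0 => simp
    | ha x y hx hy => rw [map_add, map_add, hx, hy, add_zero]
    | ht a c =>
      rw [kosD_tmul, map_sum]
      simp only [hl, Cog.act_apply]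
      rw [← map_sum, hcoc, map_zero]
  -- The factorization of this functional through `kosD` is the required primitive, still in the
  -- form of a functional on `A ⊗ Cog J i`.
  obtain ⟨μ, hμ⟩ := exists_extension_of_ker_le Dl L (by
    intro x hx
    obtain ⟨y, rfl⟩ := kosD_exact hK (x := x) hx
    exact hlD y)
  have hμ' : ∀ x, μ (kosD J i x) = l x := hμ
  obtain ⟨n, b, c, hb, hc⟩ := KDual.exists_dualBasis J i
  have hcc : ∀ c' : Cog J i, c' = ∑ s, MulOpposite.op (c' (b s)) • c s := by
    intro c'
    ext a
    rw [← Cog.map_comp, hc, map_sum]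
    change _ = (AddMonoidHom.mk' (fun c : Cog J i => c a) (fun _ _ => rfl)) _
    rw [map_sum]
    exact Finset.sum_congr rfl fun s _ => Cog.map_smul _ _ _
  -- The functional `μ` is converted back into a map to `(A^!)^i` by means of a dual basis; `hψ'`
  -- shows that the conversion does not depend on it.
  let ψ' : Assoc J →+ KDual J := AddMonoidHom.mk'
    (fun a => ∑ s, μ (tmul k a (c s)) • b s)
    (fun a a' => by
      simp only [add_tmul, map_add, add_smul, Finset.sum_add_distrib])
  have hψ' : ∀ a (c' : Cog J i), c' (ψ' a) = μ (tmul k a c') := by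
    intro a c'
    change c' (∑ s, μ (tmul k a (c s)) • b s) = _
    conv_rhs => rw [hcc c', tmul_sum, map_sum]
    rw [map_sum]
    refine Finset.sum_congr rfl fun s _ => ?_
    rw [Cog.map_smul, ← right_smul_tmul, map_smul]
    rfl
  have hdeg' : ∀ a, KDual.comp i (ψ' a) = ψ' a := fun a =>
    KDual.comp_of_mem (KDual.mem_piece.1 (by
      change ∑ s, μ (tmul k a (c s)) • b s ∈ KDual.piece J i
      exact sum_mem fun s _ => Submodule.smul_mem _ _ (KDual.mem_piece.2 (hb s))))
  have hsep : ∀ a a' : KDual J, KDual.comp i a = a → KDual.comp i a' = a' →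
      (∀ c' : Cog J i, c' a = c' a') → a = a' := fun a a' h h' hcc' => by
    rw [← sub_eq_zero, ← h, ← h', ← map_sub]
    exact KDual.comp_eq_zero_of_cog fun c' => by rw [map_sub, hcc', sub_self]
  refine ⟨ψ', fun a r => ?_, hdeg', fun a => ?_⟩
  · refine hsep _ _ (hdeg' _) (by rw [KDual.comp_mul_unit, hdeg']) fun c' => ?_
    rw [hψ', ← Cog.smul_apply, hψ', ← smul_tmul]
    rfl
  · rw [← hdeg a, ← sub_eq_zero]
    have h1 : KDual.comp (i + 1) (∑ b, ψ' (a * Assoc.ι J (coevVec k E b)) *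
        KDual.ι J (coevDual k E b) - ψ a) = 0 := by
      refine KDual.comp_eq_zero_of_cog fun c' => ?_
      rw [map_sub, sub_eq_zero, ← hl, ← hμ', kosD_tmul, map_sum, map_sum]
      refine Finset.sum_congr rfl fun s _ => ?_
      rw [← hψ', Cog.act_apply]
    rw [map_sub, map_sum] at h1
    simpa only [KDual.comp_succ_mul_ι, hdeg'] using h1

end Duality

/-! ## The curved differential of `A^!` -/

section CurvedStructure

variable {k E : Type u} [Ring k] [AddCommGroup E] [Module k E] [Module kᵐᵒᵖ E]
  [SMulCommClass k kᵐᵒᵖ E] {J : TwoSidedIdeal (TAlg k E)}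

lemma alpha_beta_left_smul (hJ : IsNonhomQuadratic J) (r : k) (q : relSpace J) :
    alpha J ⟨r • q.1, relSpace_smul_mem _ q.2 r⟩ = r • alpha J q ∧
      beta J ⟨r • q.1, relSpace_smul_mem _ q.2 r⟩ = r * beta J q := by
  refine alpha_beta_unique hJ _ ?_
  convert J.mul_mem_left (TAlg.unit k E r) _ (alpha_beta_mem J q) using 1
  rw [m2_smul, TAlg.ι_smul, map_mul, ← mul_add, ← mul_add]

namespace KDual

lemma m2_tmul (f g : RDual k E) : m2 J (tmul k f g) = ι J f * ι J g :=
  map_mul (QAlg.mk (dualIdeal (relSpace J))) _ _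

lemma m2_smul (r : k) (t : BTensor k (RDual k E) (RDual k E)) :
    m2 J (r • t) = unit J r * m2 J t := by
  change QAlg.mk _ (TAlg.m2 _ _ (r • t)) = _
  rw [NHKoszul.m2_smul, map_mul]
  rfl

lemma m2_op_smul (r : k) (t : BTensor k (RDual k E) (RDual k E)) :
    m2 J (MulOpposite.op r • t) = m2 J t * unit J r := by
  change QAlg.mk _ (TAlg.m2 _ _ (MulOpposite.op r • t)) = _
  rw [NHKoszul.m2_op_smul, map_mul]
  rfl

lemma m2_mem (t : BTensor k (RDual k E) (RDual k E)) : m2 J t ∈ KDual.deg J 2 :=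
  ⟨_, NHKoszul.m2_mem t, rfl⟩

namespace Represents

variable {w w' : KDual J} {φ φ' : relSpace J → k}

lemma unique (h : Represents w φ) (h' : Represents w' φ) : w = w' := by
  obtain ⟨t, rfl, ht⟩ := h
  exact h'.eq ht

lemma mem_deg (h : Represents w φ) : w ∈ KDual.deg J 2 := by
  obtain ⟨t, rfl, -⟩ := h
  exact m2_mem t

lemma add (h : Represents w φ) (h' : Represents w' φ') :
    Represents (w + w') (fun q => φ q + φ' q) := by
  obtain ⟨t, rfl, ht⟩ := h
  obtain ⟨t', rfl, ht'⟩ := h'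
  exact ⟨t + t', (map_add _ _ _).symm, fun q => by
    rw [map_add, AddMonoidHom.add_apply, ht, ht']⟩

lemma unit_mul (h : Represents w φ) (r : k) :
    Represents (unit J r * w) (fun q => r * φ q) := by
  obtain ⟨t, rfl, ht⟩ := h
  exact ⟨r • t, (m2_smul r t).symm, fun q => by rw [pairing_smul, ht]⟩

lemma mul_unit (h : Represents w φ) (r : k) :
    Represents (w * unit J r) (fun q => φ ⟨r • q.1, relSpace_smul_mem _ q.2 r⟩) := by
  obtain ⟨t, rfl, ht⟩ := h
  exact ⟨MulOpposite.op r • t, (m2_op_smul r t).symm, fun q =>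
    (pairing_op_smul_left t r q.1).trans (ht ⟨r • q.1, relSpace_smul_mem _ q.2 r⟩)⟩

end Represents

lemma ι_mem (f : RDual k E) : ι J f ∈ KDual.deg J 1 := QAlg.ι_mem f

lemma mul_mem {p n : ℕ} {a b : KDual J} (ha : a ∈ KDual.deg J p) (hb : b ∈ KDual.deg J n) :
    a * b ∈ KDual.deg J (n + p) := QAlg.mul_mem ha hb

lemma mul_ι_mem {n : ℕ} {a : KDual J} (ha : a ∈ KDual.deg J n) (f : RDual k E) :
    a * ι J f ∈ KDual.deg J (n + 1) := QAlg.mul_ι_mem ha f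

-- The induction is run on `comp n a` for arbitrary `a`, because a decomposition of a homogeneous
-- element produced by `QAlg.induction_right` need not be homogeneous.
@[elab_as_elim]
lemma deg_induction {P : ∀ (n : ℕ) (a : KDual J), a ∈ KDual.deg J n → Prop}
    (zero : ∀ n, P n 0 (zero_mem _)) (unit : ∀ r, P 0 (unit J r) (QAlg.unit_mem r))
    (add : ∀ n a b ha hb, P n a ha → P n b hb → P n (a + b) (add_mem ha hb))
    (mul_ι : ∀ n a f ha, P n a ha → P (n + 1) (a * ι J f) (mul_ι_mem ha f))
    {n : ℕ} {a : KDual J} (ha : a ∈ KDual.deg J n) : P n a ha := by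
  suffices h : ∀ h : comp n a ∈ KDual.deg J n, P n (comp n a) h by
    have h' := h (comp_mem n a)
    simp only [comp_of_mem ha] at h'
    exact h'
  clear ha
  intro ha
  induction a using QAlg.induction_right generalizing n with
  | unit r =>
    cases n with
    | zero => simp only [comp_zero_unit]; exact unit r
    | succ n => simp only [comp_succ_unit]; exact zero _
  | add a b iha ihb =>
    simp only [map_add]
    exact add _ _ _ (comp_mem _ _) (comp_mem _ _) (iha _) (ihb _)
  | mul_ι a f iha =>
    cases n with
    | zero => simp only [comp_zero_mul_ι]; exact zero _
    | succ n => simp only [comp_succ_mul_ι]; exact mul_ι _ _ _ (comp_mem _ _) (iha _)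

end KDual

variable [IsSemisimpleRing k] [Module.Finite kᵐᵒᵖ E]

/-- The dual basis `q j, t j` of `Q` writes `φ` as the pairing with `∑ φ(q j) t j`; this gives
`(A^!)^2 = Q^*`. -/
lemma KDual.exists_represents (φ : relSub J →ₗ[kᵐᵒᵖ] k) :
    ∃ w : KDual J, w.Represents (fun q => φ q) := by
  obtain ⟨N, q, t, ht, -⟩ := exists_coev_rel J
  exact ⟨_, _, rfl, ht φ⟩

/-- The elements of `(A^!)^2` given by the functionals `f ∘ α` on `Q`. -/
noncomputable def KDual.dGen (hJ : IsNonhomQuadratic J) : RDual k E →+ KDual J :=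
  AddMonoidHom.mk'
    (fun f => (KDual.exists_represents ((f : E →ₗ[kᵐᵒᵖ] k) ∘ₗ alphaLin hJ)).choose)
    (fun f g => (KDual.exists_represents (((f + g : RDual k E) : E →ₗ[kᵐᵒᵖ] k) ∘ₗ
        alphaLin hJ)).choose_spec.unique
      ((KDual.exists_represents ((f : E →ₗ[kᵐᵒᵖ] k) ∘ₗ alphaLin hJ)).choose_spec.add
        (KDual.exists_represents ((g : E →ₗ[kᵐᵒᵖ] k) ∘ₗ alphaLin hJ)).choose_spec))

lemma KDual.dGen_represents (hJ : IsNonhomQuadratic J) (f : RDual k E) :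
    (KDual.dGen hJ f).Represents (fun q => f (alpha J q)) :=
  (KDual.exists_represents ((f : E →ₗ[kᵐᵒᵖ] k) ∘ₗ alphaLin hJ)).choose_spec

lemma KDual.dGen_smul (hJ : IsNonhomQuadratic J) (r : k) (f : RDual k E) :
    KDual.dGen hJ (r • f) = KDual.unit J r * KDual.dGen hJ f :=
  (dGen_represents hJ _).unique ((dGen_represents hJ f).unit_mul r)

lemma KDual.dGen_op_smul (hJ : IsNonhomQuadratic J) (r : k) (f : RDual k E) :
    KDual.dGen hJ (MulOpposite.op r • f) = KDual.dGen hJ f * KDual.unit J r := by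
  refine (dGen_represents hJ _).unique ?_
  convert (dGen_represents hJ f).mul_unit r using 2 with q
  rw [(alpha_beta_left_smul hJ r q).1]
  rfl

/-- The self-consistency of the relations: a functional on `(A^!)^3` is an element of
`Q ⊗ E ∩ E ⊗ Q`, and comparing the two ways to rewrite it produces a relation. -/
lemma exists_relation_of_cog (hJ : IsNonhomQuadratic J) (c : Cog J 3) {C : KDual J}
    (hC : C.Represents (beta J)) :
    ∃ γ : relSpace J, beta J γ = 0 ∧
      (∀ f g, c (KDual.dGen hJ f * KDual.ι J g - KDual.ι J f * KDual.dGen hJ g)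
        = - pairing (tmul k f g) γ.1) ∧
      ∀ f, c (C * KDual.ι J f - KDual.ι J f * C) = - f (alpha J γ) := by
  obtain ⟨N, q, t, ht, hΘ⟩ := exists_coev_rel J
  have hu : ∀ r (b : KDual J), c (KDual.unit J r * b) = r * c b := fun r b => Cog.map_smul c r b
  have hrep : ∀ (w : KDual J) (φ : relSpace J → k), w.Represents φ →
      w = ∑ j, KDual.unit J (φ (q j)) * KDual.m2 J (t j) := by
    rintro w φ ⟨s, rfl, hs⟩
    let φ' : relSub J →ₗ[kᵐᵒᵖ] k :=
      { toFun := fun w => pairing s w.1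
        map_add' := fun w w' => map_add _ _ _
        map_smul' := fun r w => pairing_op_smul s r.unop w.1 }
    obtain rfl : φ = fun q => φ' q := funext fun q => (hs q).symm
    have h : (KDual.m2 J s).Represents (fun q => φ' q) := ⟨s, rfl, fun q => rfl⟩
    rw [← h.eq (ht φ'), map_sum]
    exact Finset.sum_congr rfl fun j _ => KDual.m2_smul _ _
  -- The functional `c` is unfolded as an element of `E ⊗ E ⊗ E` in two ways: as `∑ x_a ⊗ qa_a` in
  -- `E ⊗ Q` by splitting off the last factor of a product of three elements of `E^*`, and as `∑ q_j
  -- ⊗ y_j` in `Q ⊗ E` by splitting off the first. The order is reversed by the convention for the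
  -- pairing.
  let qa (a : Fin (coevCard k E)) : relSub J :=
    ∑ j, MulOpposite.op (c (KDual.m2 J (t j) * KDual.ι J (coevDual k E a))) • q j
  let y (j : Fin N) : E :=
    ∑ a, MulOpposite.op (c (KDual.ι J (coevDual k E a) * KDual.m2 J (t j))) • coevVec k E a
  have h1 : ∀ (w : KDual J) (φ : relSpace J → k), w.Represents φ →
      ∀ a, c (w * KDual.ι J (coevDual k E a)) = φ (qa a) := by
    rintro w φ ⟨s, rfl, hs⟩ a
    let φ' : relSub J →ₗ[kᵐᵒᵖ] k :=
      { toFun := fun w => pairing s w.1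
        map_add' := fun w w' => map_add _ _ _
        map_smul' := fun r w => pairing_op_smul s r.unop w.1 }
    obtain rfl : φ = fun q => φ' q := funext fun q => (hs q).symm
    rw [hrep _ _ ⟨s, rfl, hs⟩, Finset.sum_mul, map_sum]
    refine Eq.trans ?_ (map_sum φ' _ _).symm
    refine Finset.sum_congr rfl fun j _ => ?_
    rw [mul_assoc, hu, LinearMap.map_smul]
    rfl
  have h2 : ∀ f j, c (KDual.ι J f * KDual.m2 J (t j)) = f (y j) := by
    intro f j
    conv_lhs => rw [coev_spec_dual f, map_sum, Finset.sum_mul, map_sum]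
    rw [map_sum]
    refine Finset.sum_congr rfl fun a _ => ?_
    rw [QAlg.ι_smul, mul_assoc, hu, RDual.map_op_smul]
  have h3 : ∀ (w : KDual J) (φ : relSpace J → k), w.Represents φ →
      ∀ f, c (KDual.ι J f * w) = ∑ j, f (φ (q j) • y j) := by
    intro w φ hw f
    rw [hrep w φ hw, Finset.mul_sum, map_sum]
    refine Finset.sum_congr rfl fun j _ => ?_
    rw [← mul_assoc, ← QAlg.ι_op_smul, h2]
    rfl
  have h4 : ∀ (w : KDual J) (φ : relSpace J → k), w.Represents φ → ∀ g,
      c (w * KDual.ι J g)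
        = ∑ a, φ ⟨g (coevVec k E a) • (qa a).1, relSpace_smul_mem _ (qa a).2 _⟩ := by
    intro w φ hw g
    conv_lhs => rw [coev_spec_dual g, map_sum, Finset.mul_sum, map_sum]
    refine Finset.sum_congr rfl fun a _ => ?_
    rw [QAlg.ι_smul, ← mul_assoc]
    exact h1 _ _ (hw.mul_unit _) a
  -- The two unfoldings agree in the tensor algebra: replacing the coevaluation element of `Q` by
  -- that of `E ⊗ E` turns both into the full threefold coevaluation contracted with `c`.
  have hid : ∑ a, TAlg.ι k E (coevVec k E a) * TAlg.m2 k E (qa a).1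
      = ∑ j, TAlg.m2 k E (q j).1 * TAlg.ι k E (y j) := by
    let Θ₁ : BTensor k E E →+ BTensor k (RDual k E) (RDual k E) →+ TAlg k E :=
      AddMonoidHom.mk' (fun w => AddMonoidHom.mk' (fun s => ∑ a, TAlg.ι k E (coevVec k E a) *
        (TAlg.m2 k E w * TAlg.unit k E (c (KDual.m2 J s * KDual.ι J (coevDual k E a)))))
        (fun s s' => by
          simp only [map_add, add_mul, mul_add, Finset.sum_add_distrib]))
        (fun w w' => by
          ext s
          simp only [AddMonoidHom.mk'_apply, AddMonoidHom.add_apply, map_add, add_mul, mul_add,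
            Finset.sum_add_distrib])
    let Θ₂ : BTensor k E E →+ BTensor k (RDual k E) (RDual k E) →+ TAlg k E :=
      AddMonoidHom.mk' (fun w => AddMonoidHom.mk' (fun s => ∑ a, TAlg.m2 k E w *
        (TAlg.ι k E (coevVec k E a) * TAlg.unit k E (c (KDual.ι J (coevDual k E a) * KDual.m2 J s))))
        (fun s s' => by
          simp only [map_add, mul_add, Finset.sum_add_distrib]))
        (fun w w' => by
          ext s
          simp only [AddMonoidHom.mk'_apply, AddMonoidHom.add_apply, map_add, add_mul,
            Finset.sum_add_distrib])
    have hΘ₁ : ∀ w s, Θ₁ w s = ∑ a, TAlg.ι k E (coevVec k E a) * (TAlg.m2 k E w *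
        TAlg.unit k E (c (KDual.m2 J s * KDual.ι J (coevDual k E a)))) := fun _ _ => rfl
    have hΘ₂ : ∀ w s, Θ₂ w s = ∑ a, TAlg.m2 k E w * (TAlg.ι k E (coevVec k E a) *
        TAlg.unit k E (c (KDual.ι J (coevDual k E a) * KDual.m2 J s))) := fun _ _ => rfl
    have e1 := hΘ Θ₁ (fun w r s => by
        rw [hΘ₁, hΘ₁]
        refine Finset.sum_congr rfl fun a _ => ?_
        rw [NHKoszul.m2_op_smul, KDual.m2_smul, mul_assoc (KDual.unit J r), hu,
          map_mul (TAlg.unit k E)]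
        simp only [mul_assoc])
      (fun w s hs => (hΘ₁ w s).trans <| Finset.sum_eq_zero fun a _ => by
        rw [KDual.m2_eq_zero hs, zero_mul, map_zero, map_zero, mul_zero, mul_zero])
    have e2 := hΘ Θ₂ (fun w r s => by
        let G : E →+ RDual k E →+ TAlg k E := AddMonoidHom.mk' (fun x => AddMonoidHom.mk' (fun f =>
          TAlg.m2 k E w * (TAlg.ι k E x * TAlg.unit k E (c (KDual.ι J f * KDual.m2 J s))))
          (fun f f' => by simp only [map_add, add_mul, mul_add]))
          (fun x x' => by
            ext f
            simp only [AddMonoidHom.mk'_apply, AddMonoidHom.add_apply, map_add, add_mul, mul_add])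
        have hG := coev_move G (fun e r' f => by
          change TAlg.m2 k E w * (_ * TAlg.unit k E (c _))
            = TAlg.m2 k E w * (_ * TAlg.unit k E (c _))
          rw [TAlg.ι_op_smul, QAlg.ι_smul, mul_assoc (QAlg.unit _ r'), hu,
            map_mul (TAlg.unit k E), mul_assoc]) r
        rw [hΘ₂, hΘ₂]
        refine (Finset.sum_congr rfl fun a _ => ?_).trans (hG.trans
          (Finset.sum_congr rfl fun a _ => ?_))
        · change _ = TAlg.m2 k E w * (_ * TAlg.unit k E (c _))
          rw [NHKoszul.m2_op_smul, TAlg.ι_smul]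
          simp only [mul_assoc]
        · change TAlg.m2 k E w * (_ * TAlg.unit k E (c _)) = _
          rw [QAlg.ι_op_smul, KDual.m2_smul, mul_assoc])
      (fun w s hs => (hΘ₂ w s).trans <| Finset.sum_eq_zero fun a _ => by
        rw [KDual.m2_eq_zero hs, mul_zero, map_zero, map_zero, mul_zero, mul_zero])
    have l1 : ∑ a, TAlg.ι k E (coevVec k E a) * TAlg.m2 k E (qa a).1
        = ∑ j, Θ₁ (q j).1 (t j) := by
      rw [Finset.sum_congr rfl fun j _ => hΘ₁ (q j).1 (t j), Finset.sum_comm]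
      refine Finset.sum_congr rfl fun a _ => ?_
      rw [← Finset.mul_sum]
      congr 1
      change (TAlg.m2 k E) ((relSub J).subtype (qa a)) = _
      rw [map_sum, map_sum]
      refine Finset.sum_congr rfl fun j _ => ?_
      rw [LinearMap.map_smul, NHKoszul.m2_op_smul]
      rfl
    have l2 : ∑ j, TAlg.m2 k E (q j).1 * TAlg.ι k E (y j) = ∑ j, Θ₂ (q j).1 (t j) := by
      refine Finset.sum_congr rfl fun j _ => ?_
      rw [map_sum, Finset.mul_sum]
      refine Finset.sum_congr rfl fun a _ => ?_
      rw [TAlg.ι_op_smul]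
    rw [l1, l2, ← e1, ← e2, Fintype.sum_prod_type, Fintype.sum_prod_type]
    simp only [hΘ₁, hΘ₂]
    rw [Finset.sum_congr rfl fun b _ => Finset.sum_comm, Finset.sum_comm]
    refine Finset.sum_congr rfl fun a _ => Finset.sum_congr rfl fun b _ =>
      Finset.sum_congr rfl fun e _ => ?_
    rw [coevVec2, coevVec2, coevDual2, coevDual2, TAlg.m2_tmul, TAlg.m2_tmul, KDual.m2_tmul,
      KDual.m2_tmul]
    simp only [mul_assoc]
  -- The quadratic part `(α ⊗ 1 - 1 ⊗ α) z` and the linear part `(β ⊗ 1 - 1 ⊗ β) z` of the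
  -- difference of the two rewritings.
  let γ : BTensor k E E := ∑ j, tmul k (alpha J (q j)) (y j)
    - ∑ a, tmul k (coevVec k E a) (alpha J (qa a))
  let ε : E := ∑ j, beta J (q j) • y j
    - ∑ a, MulOpposite.op (beta J (qa a)) • coevVec k E a
  -- Nonhomogeneous relations are multiplied by `E` on the right and on the left and subtracted. The
  -- cubic terms cancel by `hid` and there is no constant term, so uniqueness of `α` and `β` yields
  -- `α(γ) = ε` and `β(γ) = 0`.
  have hγ : TAlg.m2 k E γ + TAlg.ι k E ε + TAlg.unit k E 0 ∈ J := by
    have m1 : ∑ j, (TAlg.m2 k E (q j).1 + TAlg.ι k E (alpha J (q j))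
        + TAlg.unit k E (beta J (q j))) * TAlg.ι k E (y j) ∈ J :=
      sum_mem fun j _ => J.mul_mem_right _ _ (alpha_beta_mem J (q j))
    have m2 : ∑ a, TAlg.ι k E (coevVec k E a) * (TAlg.m2 k E (qa a).1
        + TAlg.ι k E (alpha J (qa a)) + TAlg.unit k E (beta J (qa a))) ∈ J :=
      sum_mem fun a _ => J.mul_mem_left _ _ (alpha_beta_mem J (qa a))
    convert J.sub_mem m1 m2 using 1
    simp only [add_mul, mul_add, Finset.sum_add_distrib, hid, γ, ε, map_sub, map_sum, map_zero,
      TAlg.m2_tmul, TAlg.ι_op_smul, TAlg.ι_smul]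
    abel
  obtain ⟨hα, hβ⟩ := alpha_beta_unique hJ ⟨γ, ε, 0, hγ⟩ hγ
  refine ⟨⟨γ, ε, 0, hγ⟩, hβ, fun f g => ?_, fun f => ?_⟩
  · rw [map_sub, h3 _ _ (KDual.dGen_represents hJ g), h4 _ _ (KDual.dGen_represents hJ f)]
    change _ = - pairing (tmul k f g) γ
    rw [map_sub, map_sum, map_sum, neg_sub]
    congr 1
    refine Finset.sum_congr rfl fun a _ => ?_
    rw [(alpha_beta_left_smul hJ _ (qa a)).1, pairing_tmul]
  · rw [map_sub, h3 _ _ hC, h4 _ _ hC, hα, map_sub, map_sum, map_sum, neg_sub]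
    congr 1
    refine Finset.sum_congr rfl fun a _ => ?_
    rw [(alpha_beta_left_smul hJ _ (qa a)).2, RDual.map_op_smul]

end CurvedStructure

/-! ### Uniqueness and construction of the curved structure -/

section CurvedStructure

variable {k E : Type u} [Ring k] [AddCommGroup E] [Module k E] [Module kᵐᵒᵖ E]
  [SMulCommClass k kᵐᵒᵖ E] {J : TwoSidedIdeal (TAlg k E)}

/-- Curved structures on `A^!` are determined by their values on generators. -/
lemma IsKoszulDualStructure.unique {D D' : CDGA (KDual.deg J)} (hD : IsKoszulDualStructure J D)
    (hD' : IsKoszulDualStructure J D') : D = D' := by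
  -- The Leibniz rule gives `d(1) = 0`, and linearity over the base extends this to all scalars. The
  -- generators in degree one then determine `d`.
  have hunit : ∀ (D : CDGA (KDual.deg J)) r, D.d (KDual.unit J r) = 0 := by
    intro D r
    have h1 : D.d 1 = 0 := by
      have h := D.leibniz (i := 0) (a := 1) 1 (by
        rw [← map_one (KDual.unit J)]
        exact QAlg.unit_mem 1)
      rwa [pow_zero, one_mul, mul_one, one_mul, one_mul, left_eq_add] at h
    have h := D.d_base_mul 1 (QAlg.unit_mem (J := dualIdeal (relSpace J)) r)
    rwa [mul_one, h1, mul_zero] at h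
  have hdeg : ∀ n a, a ∈ KDual.deg J n → D.d a = D'.d a := by
    intro n a ha
    induction ha using KDual.deg_induction with
    | zero n => rw [map_zero, map_zero]
    | unit r => rw [hunit, hunit]
    | add n a b _ _ ha hb => rw [map_add, map_add, ha, hb]
    | mul_ι n a f ha h =>
      rw [D.leibniz _ ha, D'.leibniz _ ha, h, (hD.d_eq f).unique (hD'.d_eq f)]
  refine CDGA.ext (AddMonoidHom.ext fun a => ?_) (hD.c_eq.unique hD'.c_eq)
  obtain ⟨N, -, h⟩ := KDual.exists_sum_comp a
  rw [h, map_sum, map_sum]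
  exact Finset.sum_congr rfl fun n _ => hdeg n _ (KDual.comp_mem n a)

variable [IsSemisimpleRing k] [Module.Finite kᵐᵒᵖ E]

namespace KDual

lemma eq_zero_of_cog {i : ℕ} {a : KDual J} (ha : a ∈ KDual.deg J i)
    (h : ∀ c : Cog J i, c a = 0) : a = 0 := by
  rw [← comp_of_mem ha]
  exact comp_eq_zero_of_cog h

/-- The ring homomorphism `f ↦ (-f, d f; 0, f)` from the tensor algebra to matrices over `A^!`. -/
noncomputable def matT (hJ : IsNonhomQuadratic J) :
    TAlg k (RDual k E) →+* Matrix (Fin 2) (Fin 2) (KDual J) :=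
  TAlg.lift ((Matrix.scalar (Fin 2)).comp (unit J))
    (AddMonoidHom.mk' (fun f => !![-ι J f, dGen hJ f; 0, ι J f]) (fun f g => by
      ext i j
      fin_cases i <;> fin_cases j <;> simp [add_comm]))
    (fun r f => by
      ext i j
      fin_cases i <;> fin_cases j <;>
        simp [Matrix.mul_apply, Fin.sum_univ_two, QAlg.ι_smul, dGen_smul])
    (fun r f => by
      ext i j
      fin_cases i <;> fin_cases j <;>
        simp [Matrix.mul_apply, Fin.sum_univ_two, QAlg.ι_op_smul, dGen_op_smul])

lemma matT_unit (hJ : IsNonhomQuadratic J) (r : k) :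
    matT hJ (TAlg.unit k _ r) = !![unit J r, 0; 0, unit J r] := by
  rw [matT, TAlg.lift_unit]
  ext i j
  fin_cases i <;> fin_cases j <;> simp

lemma matT_ι (hJ : IsNonhomQuadratic J) (f : RDual k E) :
    matT hJ (TAlg.ι k _ f) = !![-ι J f, dGen hJ f; 0, ι J f] := by
  rw [matT, TAlg.lift_ι]
  rfl

lemma matT_ι_mul_ι (hJ : IsNonhomQuadratic J) (f g : RDual k E) :
    matT hJ (TAlg.ι k _ f * TAlg.ι k _ g)
      = !![ι J f * ι J g, dGen hJ f * ι J g - ι J f * dGen hJ g; 0, ι J f * ι J g] := by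
  rw [map_mul, matT_ι, matT_ι]
  ext i j
  fin_cases i <;> fin_cases j <;> simp [Matrix.mul_apply, Fin.sum_univ_two]
  abel

lemma dGen_mem (hJ : IsNonhomQuadratic J) (f : RDual k E) : dGen hJ f ∈ KDual.deg J 2 :=
  (dGen_represents hJ f).mem_deg

/-- On a product of two generators the signs on the diagonal cancel, so the diagonal is the product
itself. Only the upper right entry, of degree three, can obstruct the descent to `A^!`. -/
lemma matT_m2 (hJ : IsNonhomQuadratic J) (t : BTensor k (RDual k E) (RDual k E)) :
    matT hJ (TAlg.m2 k _ t) 0 0 = m2 J t ∧ matT hJ (TAlg.m2 k _ t) 1 0 = 0 ∧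
      matT hJ (TAlg.m2 k _ t) 1 1 = m2 J t ∧ matT hJ (TAlg.m2 k _ t) 0 1 ∈ KDual.deg J 3 := by
  induction t using BTensor.induction_on with
  | h0 => simp
  | ha s t hs ht =>
    simp only [map_add, Matrix.add_apply, hs, ht, add_zero, true_and]
    exact add_mem hs.2.2.2 ht.2.2.2
  | ht f g =>
    rw [TAlg.m2_tmul, matT_ι_mul_ι, m2_tmul]
    refine ⟨rfl, rfl, rfl, ?_⟩
    exact sub_mem (mul_ι_mem (dGen_mem hJ f) g) (mul_mem (p := 1) (n := 2) (ι_mem f) (dGen_mem hJ g))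

lemma cog_matT_m2 (hJ : IsNonhomQuadratic J) (c : Cog J 3) (γ : BTensor k E E)
    (h : ∀ f g, c (dGen hJ f * ι J g - ι J f * dGen hJ g) = - pairing (tmul k f g) γ)
    (t : BTensor k (RDual k E) (RDual k E)) :
    c (matT hJ (TAlg.m2 k _ t) 0 1) = - pairing t γ := by
  induction t using BTensor.induction_on with
  | h0 => simp
  | ha s t hs ht =>
    rw [map_add, map_add, Matrix.add_apply, map_add, hs, ht, map_add, AddMonoidHom.add_apply,
      neg_add]
  | ht f g => rw [TAlg.m2_tmul, matT_ι_mul_ι, ← h]; rfl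

/-- Every functional on `(A^!)^3` takes the upper right entry to minus the pairing of `t` with some
`γ` in `Q`, which vanishes for `t` in `Q^⊥`; functionals separate. -/
lemma matT_eq_zero (hJ : IsNonhomQuadratic J) {t : TAlg k (RDual k E)}
    (ht : t ∈ dualIdeal (relSpace J)) : matT hJ t = 0 := by
  refine map_eq_zero_of_mem_quadIdeal (Q := perp (relSpace J)) _ (fun t ht => ?_) ht
  obtain ⟨h1, h2, h3, h4⟩ := matT_m2 hJ t
  have h5 : matT hJ (TAlg.m2 k _ t) 0 1 = 0 := eq_zero_of_cog h4 fun c => by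
    obtain ⟨C, hC⟩ := exists_represents (betaLin hJ)
    obtain ⟨γ, -, h, -⟩ := exists_relation_of_cog hJ c hC
    rw [cog_matT_m2 hJ c γ.1 h, ht _ γ.2, neg_zero]
  rw [m2_eq_zero ht] at h1 h3
  ext i j
  fin_cases i <;> fin_cases j <;> assumption

/-- The ring homomorphism `f ↦ (-f, d f; 0, f)` from `A^!` to matrices over `A^!`. -/
noncomputable def mat (hJ : IsNonhomQuadratic J) :
    KDual J →+* Matrix (Fin 2) (Fin 2) (KDual J) :=
  QAlg.lift _ (matT hJ) (fun _ ht => matT_eq_zero hJ ht)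

lemma mat_unit (hJ : IsNonhomQuadratic J) (r : k) :
    mat hJ (unit J r) = !![unit J r, 0; 0, unit J r] := matT_unit hJ r

lemma mat_ι (hJ : IsNonhomQuadratic J) (f : RDual k E) :
    mat hJ (ι J f) = !![-ι J f, dGen hJ f; 0, ι J f] := matT_ι hJ f

lemma mat_m2 (hJ : IsNonhomQuadratic J) (t : BTensor k (RDual k E) (RDual k E)) :
    mat hJ (m2 J t) = matT hJ (TAlg.m2 k _ t) := rfl

/-- The derivation of `A^!` extending `f ↦ f ∘ α`. -/
noncomputable def dHom (hJ : IsNonhomQuadratic J) : KDual J →+ KDual J :=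
  AddMonoidHom.mk' (fun a => mat hJ a 0 1) (fun a b => by rw [map_add, Matrix.add_apply])

lemma dHom_apply (hJ : IsNonhomQuadratic J) (a : KDual J) : dHom hJ a = mat hJ a 0 1 := rfl

lemma mat_one_one (hJ : IsNonhomQuadratic J) (a : KDual J) :
    mat hJ a 1 0 = 0 ∧ mat hJ a 1 1 = a := by
  induction a using QAlg.induction_right with
  | unit r => rw [mat_unit]; exact ⟨rfl, rfl⟩
  | add a b ha hb => simp [map_add, ha, hb]
  | mul_ι a f ha =>
    rw [_root_.map_mul (mat hJ), mat_ι]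
    simp [Matrix.mul_apply, Fin.sum_univ_two, ha]

lemma mat_zero_zero (hJ : IsNonhomQuadratic J) {n : ℕ} {a : KDual J} (ha : a ∈ KDual.deg J n) :
    mat hJ a 0 0 = (-1) ^ n * a := by
  induction ha using deg_induction with
  | zero n => simp
  | unit r => rw [mat_unit, pow_zero, one_mul]; rfl
  | add n a b _ _ ha hb => rw [map_add, Matrix.add_apply, ha, hb, mul_add]
  | mul_ι n a f _ ha =>
    rw [_root_.map_mul (mat hJ), mat_ι]
    simp [Matrix.mul_apply, Fin.sum_univ_two, ha, pow_succ, mul_assoc]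

lemma dHom_unit (hJ : IsNonhomQuadratic J) (r : k) : dHom hJ (unit J r) = 0 := by
  rw [dHom_apply, mat_unit]
  rfl

lemma dHom_ι (hJ : IsNonhomQuadratic J) (f : RDual k E) : dHom hJ (ι J f) = dGen hJ f := by
  rw [dHom_apply, mat_ι]
  rfl

/-- The signed Leibniz rule is the upper right entry of a product of upper triangular matrices with
diagonal `((-1)^n a, a)`. -/
lemma dHom_mul (hJ : IsNonhomQuadratic J) {n : ℕ} {a : KDual J} (ha : a ∈ KDual.deg J n)
    (b : KDual J) : dHom hJ (a * b) = dHom hJ a * b + (-1) ^ n * (a * dHom hJ b) := by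
  rw [dHom_apply, _root_.map_mul (mat hJ), Matrix.mul_apply, Fin.sum_univ_two,
    mat_zero_zero hJ ha, (mat_one_one hJ b).2, add_comm, mul_assoc]
  rfl

lemma dHom_mul_unit (hJ : IsNonhomQuadratic J) (a : KDual J) (r : k) :
    dHom hJ (a * unit J r) = dHom hJ a * unit J r := by
  rw [dHom_apply, _root_.map_mul (mat hJ), Matrix.mul_apply, Fin.sum_univ_two, mat_unit]
  simp [dHom_apply]

lemma dHom_mem (hJ : IsNonhomQuadratic J) {n : ℕ} {a : KDual J} (ha : a ∈ KDual.deg J n) :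
    dHom hJ a ∈ KDual.deg J (n + 1) := by
  induction ha using deg_induction with
  | zero n => rw [map_zero]; exact zero_mem _
  | unit r => rw [dHom_unit]; exact zero_mem _
  | add n a b _ _ ha hb => rw [map_add]; exact add_mem ha hb
  | mul_ι n a f ha h =>
    rw [dHom_mul hJ ha, dHom_ι]
    refine add_mem (mul_ι_mem h f) ?_
    have h1 : a * dGen hJ f ∈ KDual.deg J (n + 1 + 1) := by
      have := mul_mem ha (dGen_mem hJ f)
      rwa [add_comm 2 n] at this
    rcases neg_one_pow_eq_or (KDual J) n with h | h
    · rwa [h, one_mul]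
    · rw [h, neg_one_mul]
      exact neg_mem h1

end KDual

/-- The curved structure on `A^!` given by `α` and `β`. -/
lemma exists_isKoszulDualStructure (hJ : IsNonhomQuadratic J) :
    ∃ D : CDGA (KDual.deg J), IsKoszulDualStructure J D := by
  obtain ⟨C, hC⟩ := KDual.exists_represents (betaLin hJ)
  have hC' : C.Represents (beta J) := hC
  have hcomm : ∀ r, C * KDual.unit J r = KDual.unit J r * C := by
    intro r
    refine (hC'.mul_unit r).unique ?_
    convert hC'.unit_mul r using 2 with q
    exact (alpha_beta_left_smul hJ r q).2
  have hzero : ∀ {a : KDual J}, a ∈ KDual.deg J 0 → ∃ r, a = KDual.unit J r := fun {a} ha =>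
    ⟨_, (KDual.comp_of_mem ha).symm.trans (KDual.comp_zero_eq a)⟩
  -- Both sides have degree three and are compared under a functional `c`. With `γ` the relation
  -- attached to `c`, each side becomes `- f(α(γ))`.
  have hgen : ∀ f, KDual.dHom hJ (KDual.dGen hJ f) = C * KDual.ι J f - KDual.ι J f * C := by
    intro f
    rw [← sub_eq_zero]
    refine KDual.eq_zero_of_cog (i := 3) (sub_mem (KDual.dHom_mem hJ (KDual.dGen_mem hJ f))
      (sub_mem (KDual.mul_ι_mem hC.mem_deg f) (KDual.mul_mem (p := 1) (n := 2) (KDual.ι_mem f) hC.mem_deg)))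
      fun c => ?_
    obtain ⟨γ, -, h, h'⟩ := exists_relation_of_cog hJ c hC'
    obtain ⟨t, ht, ht'⟩ := KDual.dGen_represents hJ f
    rw [map_sub, h', ht, KDual.dHom_apply, KDual.mat_m2, KDual.cog_matT_m2 hJ c γ.1 h, ht',
      sub_self]
  -- Both `d²` and the commutator with `C` are derivations without sign and vanish on scalars, so
  -- agreement on generators suffices; the two parities of `n` only change the signs that cancel.
  have hdd : ∀ n a, a ∈ KDual.deg J n → KDual.dHom hJ (KDual.dHom hJ a) = C * a - a * C := by
    intro n a ha
    induction ha using KDual.deg_induction with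
    | zero n => simp
    | unit r => rw [KDual.dHom_unit, map_zero, hcomm, sub_self]
    | add n a b _ _ ha hb => rw [map_add, map_add, ha, hb]; noncomm_ring
    | mul_ι n a f ha h =>
      have h1 := KDual.dHom_mul hJ ha
      have h2 := KDual.dHom_mul hJ (KDual.dHom_mem hJ ha)
      rw [pow_succ] at h2
      rcases neg_one_pow_eq_or (KDual J) n with hn | hn
      · rw [hn] at h1 h2
        rw [h1, map_add, h2, h, one_mul (a * _), h1, KDual.dHom_ι, hgen]
        noncomm_ring
      · rw [hn] at h1 h2
        rw [h1, map_add, h2, h, neg_one_mul (a * _), map_neg, h1, KDual.dHom_ι, hgen]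
        noncomm_ring
  refine ⟨{ d := KDual.dHom hJ
            c := C
            d_mem := KDual.dHom_mem hJ
            c_mem := hC.mem_deg
            d_base_mul := fun {r} a hr => ?_
            d_mul_base := fun {r} a hr => ?_
            leibniz := fun b ha => KDual.dHom_mul hJ ha b
            d_d := fun a => ?_
            d_c := ?_ }, ⟨fun f => ?_, hC⟩⟩
  · obtain ⟨s, rfl⟩ := hzero hr
    rw [KDual.dHom_mul hJ hr, KDual.dHom_unit, zero_mul, zero_add, pow_zero, one_mul]
  · obtain ⟨s, rfl⟩ := hzero hr
    exact KDual.dHom_mul_unit hJ a s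
  · obtain ⟨N, -, h⟩ := KDual.exists_sum_comp a
    rw [h, map_sum, map_sum, Finset.mul_sum, Finset.sum_mul, ← Finset.sum_sub_distrib]
    exact Finset.sum_congr rfl fun n _ => hdd n _ (KDual.comp_mem n a)
  -- A functional on degree three maps `d(C)` to `- β(γ)`, which is zero.
  · refine KDual.eq_zero_of_cog (KDual.dHom_mem hJ hC.mem_deg) fun c => ?_
    obtain ⟨γ, hγ, h, -⟩ := exists_relation_of_cog hJ c hC'
    obtain ⟨t, ht, ht'⟩ := hC'
    rw [ht, KDual.dHom_apply, KDual.mat_m2, KDual.cog_matT_m2 hJ c γ.1 h, ht', hγ, neg_zero]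
  · change (KDual.dHom hJ (KDual.ι J f)).Represents _
    rw [KDual.dHom_ι]
    exact KDual.dGen_represents hJ f

end CurvedStructure

/-! ## The Poincaré–Birkhoff–Witt property -/

section RightModules

/-- Prescribing `l` on `F` and zero on `N` is consistent exactly on `F ∩ N`: the kernel of `F ⊕ N →
M` consists of pairs `(x, -x)`. -/
lemma exists_extension_of_inf_le_ker {R M W : Type*} [Ring R] [IsSemisimpleRing R]
    [AddCommGroup M] [AddCommGroup W] [Module R M] [Module R W] (F N : Submodule R M)
    (l : M →ₗ[R] W) (h : F ⊓ N ≤ LinearMap.ker l) :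
    ∃ l' : M →ₗ[R] W, (∀ x ∈ F, l' x = l x) ∧ ∀ x ∈ N, l' x = 0 := by
  obtain ⟨l', hl'⟩ := exists_extension_of_ker_le (F.subtype.coprod N.subtype)
    (l ∘ₗ F.subtype ∘ₗ LinearMap.fst R F N) (fun x hx => by
      have hx' : (x.1 : M) = -x.2 := eq_neg_of_add_eq_zero_left hx
      exact h ⟨x.1.2, show (x.1 : M) ∈ N by rw [hx']; exact neg_mem x.2.2⟩)
  refine ⟨l', fun x hx => ?_, fun x hx => ?_⟩
  · simpa using hl' (⟨x, hx⟩, 0)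
  · simpa using hl' (0, ⟨x, hx⟩)

/-- Right linear functionals separate points from submodules: the cyclic submodule generated by the
class of `t` embeds in `k` as a complement of its annihilator, and this embedding extends. -/
lemma exists_functional_ne_zero {k M : Type*} [Ring k] [IsSemisimpleRing k] [AddCommGroup M]
    [Module kᵐᵒᵖ M] (N : Submodule kᵐᵒᵖ M) {t : M} (ht : t ∉ N) :
    ∃ l : M →ₗ[kᵐᵒᵖ] k, (∀ x ∈ N, l x = 0) ∧ l t ≠ 0 := by
  let f : k →ₗ[kᵐᵒᵖ] M ⧸ N :=
    { toFun := fun s => MulOpposite.op s • N.mkQ t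
      map_add' := fun s s' => by rw [MulOpposite.op_add, add_smul]
      map_smul' := fun r s => by
        rw [RingHom.id_apply, ← mul_smul]
        rfl }
  obtain ⟨C, hC⟩ := exists_isCompl (LinearMap.ker f)
  -- An endomorphism of `k` with the same kernel as `f`; it factors through `f`, and its value at
  -- `1` is nonzero unless `f 1 = 0`.
  let g : k →ₗ[kᵐᵒᵖ] k := C.subtype ∘ₗ Submodule.projectionOnto C _ hC.symm
  have hg : ∀ s, g s = 0 ↔ s ∈ LinearMap.ker f := fun s => by
    rw [← Submodule.ker_projectionOnto hC.symm, LinearMap.mem_ker]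
    exact ZeroMemClass.coe_eq_zero
  obtain ⟨g', hg'⟩ := exists_extension_of_ker_le f g fun s hs => (hg s).2 hs
  refine ⟨g' ∘ₗ N.mkQ, fun x hx => ?_, fun h0 => ht ?_⟩
  · rw [LinearMap.comp_apply, (Submodule.Quotient.mk_eq_zero N).2 hx |> (show N.mkQ x = 0 from ·),
      map_zero]
  · have h1 : f 1 = N.mkQ t := by
      change MulOpposite.op (1 : k) • N.mkQ t = _
      rw [MulOpposite.op_one, one_smul]
    have h2 : f 1 = 0 := (hg 1).1 (by rw [← hg', h1]; exact h0)
    rw [h1] at h2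
    exact (Submodule.Quotient.mk_eq_zero N).1 h2

end RightModules

/-! ### The filtration of the ideal by visibly generated elements -/

section Filtration

variable {k V : Type u} [Ring k] [AddCommGroup V] [Module k V] [Module kᵐᵒᵖ V]

namespace TAlg

instance opModule : Module kᵐᵒᵖ (TAlg k V) := Module.compHom (TAlg k V) (unit k V).op

lemma op_smul_def (r : k) (t : TAlg k V) : MulOpposite.op r • t = t * unit k V r := rfl

variable (k V) in
/-- The elements of `T_k(V)` all of whose components have degree less than `n`. -/
noncomputable def low (n : ℕ) : Submodule kᵐᵒᵖ (TAlg k V) where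
  carrier := {t | ∀ m ≥ n, comp m t = 0}
  zero_mem' _ _ := map_zero _
  add_mem' hs ht m hm := by rw [map_add, hs m hm, ht m hm, add_zero]
  smul_mem' r t ht m hm := by
    induction r using MulOpposite.rec' with
    | h r => rw [op_smul_def, comp_mul_unit, ht m hm, zero_mul]

lemma low_mono {m n : ℕ} (h : m ≤ n) : low k V m ≤ low k V n :=
  fun _ ht i hi => ht i (h.trans hi)

lemma mem_low_of_mem_deg {m n : ℕ} (h : m < n) {t : TAlg k V} (ht : t ∈ deg k V m) :
    t ∈ low k V n := fun i hi => comp_of_mem_ne ht (by omega)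

lemma comp_mem_low {m n : ℕ} (h : m < n) (t : TAlg k V) : comp m t ∈ low k V n :=
  mem_low_of_mem_deg h (comp_mem m t)

lemma unit_mem_low (r : k) : unit k V r ∈ low k V 1 := mem_low_of_mem_deg one_pos (unit_mem r)

lemma mul_ι_mem_low {n : ℕ} {t : TAlg k V} (ht : t ∈ low k V n) (x : V) :
    t * ι k V x ∈ low k V (n + 1) := by
  rintro (_ | m) hm
  · exact comp_zero_mul_ι t x
  · rw [comp_succ_mul_ι, ht m (by omega), zero_mul]

lemma mul_unit_mem_low {n : ℕ} {t : TAlg k V} (ht : t ∈ low k V n) (r : k) :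
    t * unit k V r ∈ low k V n := (low k V n).smul_mem (MulOpposite.op r) ht

lemma exists_mem_low (t : TAlg k V) : ∃ n, t ∈ low k V n :=
  ⟨_, (exists_sum_comp t).choose_spec.1⟩

lemma eq_zero_of_mem_low_zero {t : TAlg k V} (ht : t ∈ low k V 0) : t = 0 := by
  obtain ⟨N, -, h⟩ := exists_sum_comp t
  rw [h]
  exact Finset.sum_eq_zero fun n _ => ht n (Nat.zero_le n)

lemma sub_comp_mem_low {n : ℕ} {t : TAlg k V} (ht : t ∈ low k V (n + 1)) :
    t - comp n t ∈ low k V n := by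
  intro m hm
  rw [map_sub]
  rcases hm.eq_or_lt with rfl | h
  · rw [comp_of_mem (comp_mem n t), sub_self]
  · rw [ht m h, comp_of_mem_ne (comp_mem n t) (by omega), sub_zero]

/-- The ideal is additively spanned by the products `a s b`; expanding `b` as a right word leaves
only multiplication by scalars and by `V` to be checked. -/
lemma span_le_of_mul_ι {S : Set (TAlg k V)} (M : AddSubgroup (TAlg k V))
    (base : ∀ a, ∀ s ∈ S, ∀ r, a * s * unit k V r ∈ M) (mul_ι : ∀ t ∈ M, ∀ x, t * ι k V x ∈ M)
    {t : TAlg k V} (ht : t ∈ TwoSidedIdeal.span S) : t ∈ M := by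
  rw [TwoSidedIdeal.mem_span_iff_mem_addSubgroup_closure] at ht
  refine (AddSubgroup.closure_le M).2 ?_ ht
  rintro _ ⟨_, ⟨a, -, s, hs, rfl⟩, b, -, rfl⟩
  change a * s * b ∈ M
  induction b using induction_right with
  | unit r => exact base a s hs r
  | add b c hb hc => rw [mul_add]; exact add_mem hb hc
  | mul_ι b x hb => rw [← mul_assoc]; exact mul_ι _ hb x

lemma comp_low_degrees (t : TAlg k V) : (∃ r, comp 0 t = unit k V r) ∧ (∃ x, comp 1 t = ι k V x) ∧
    ∃ w, comp 2 t = m2 k V w := by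
  induction t using induction_right with
  | unit r =>
    exact ⟨⟨r, comp_zero_unit r⟩, ⟨0, by rw [comp_succ_unit, map_zero]⟩,
      ⟨0, by rw [comp_succ_unit, map_zero]⟩⟩
  | add s t hs ht =>
    obtain ⟨⟨r, hr⟩, ⟨x, hx⟩, ⟨w, hw⟩⟩ := hs
    obtain ⟨⟨r', hr'⟩, ⟨x', hx'⟩, ⟨w', hw'⟩⟩ := ht
    exact ⟨⟨r + r', by simp [hr, hr']⟩, ⟨x + x', by simp [hx, hx']⟩, ⟨w + w', by simp [hw, hw']⟩⟩
  | mul_ι t x ht =>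
    obtain ⟨⟨r, hr⟩, ⟨y, hy⟩, -⟩ := ht
    exact ⟨⟨0, by rw [comp_zero_mul_ι, map_zero]⟩,
      ⟨r • x, by rw [comp_succ_mul_ι, hr, ι_smul]⟩,
      ⟨tmul k y x, by rw [comp_succ_mul_ι, hy, m2_tmul]⟩⟩

lemma exists_of_mem_filt_two {t : TAlg k V} (ht : t ∈ filt k V 2) :
    ∃ w x r, t = m2 k V w + ι k V x + unit k V r := by
  obtain ⟨⟨r, hr⟩, ⟨x, hx⟩, ⟨w, hw⟩⟩ := comp_low_degrees t
  refine ⟨w, x, r, ?_⟩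
  obtain ⟨N, hN, h⟩ := exists_sum_comp t
  have h1 : t = ∑ n ∈ Finset.range 3, comp n t := by
    rcases le_total N 3 with h3 | h3
    · conv_lhs => rw [h]
      exact Finset.sum_subset (Finset.range_mono h3) fun m _ hm => hN m (by simpa using hm)
    · conv_lhs => rw [h]
      exact (Finset.sum_subset (Finset.range_mono h3) fun m _ hm =>
        mem_filt_iff.1 ht m (by rw [Finset.mem_range] at hm; omega)).symm
  rw [h1, Finset.sum_range_succ, Finset.sum_range_succ, Finset.sum_range_one, hr, hx, hw]
  abel

lemma comp_mul_m2 (n : ℕ) (t : TAlg k V) (w : BTensor k V V) :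
    comp (n + 2) (t * m2 k V w) = comp n t * m2 k V w := by
  induction w using BTensor.induction_on with
  | h0 => simp
  | ha x y hx hy => simp only [map_add, mul_add, hx, hy]
  | ht x y => rw [m2_tmul, ← mul_assoc, comp_succ_mul_ι, comp_succ_mul_ι, mul_assoc]

lemma comp_mul_m2_of_lt {n : ℕ} (h : n < 2) (t : TAlg k V) (w : BTensor k V V) :
    comp n (t * m2 k V w) = 0 := by
  induction w using BTensor.induction_on with
  | h0 => simp
  | ha x y hx hy => simp only [map_add, mul_add, hx, hy, add_zero]
  | ht x y =>
    rw [m2_tmul, ← mul_assoc]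
    interval_cases n
    · exact comp_zero_mul_ι _ _
    · rw [comp_succ_mul_ι, comp_zero_mul_ι, zero_mul]

end TAlg

/-- The nonhomogeneous relation `q + α(q) + β(q)`. -/
noncomputable def nhRel (J : TwoSidedIdeal (TAlg k V)) (q : relSpace J) : TAlg k V :=
  TAlg.m2 k V q + TAlg.ι k V (alpha J q) + TAlg.unit k V (beta J q)

/-- The part of `J` visibly generated in filtration degree `n`. -/
noncomputable def relFilt (J : TwoSidedIdeal (TAlg k V)) : ℕ → Submodule kᵐᵒᵖ (TAlg k V)
  | 0 => ⊥
  | 1 => ⊥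
  | n + 2 => Submodule.span kᵐᵒᵖ ({t | ∃ a ∈ TAlg.low k V (n + 1), ∃ q, t = a * nhRel J q} ∪
      {t | ∃ s ∈ relFilt J (n + 1), ∃ x, t = s * TAlg.ι k V x})

variable {J : TwoSidedIdeal (TAlg k V)} [SMulCommClass k kᵐᵒᵖ V]

lemma mul_nhRel_mem {n : ℕ} {a : TAlg k V} (ha : a ∈ TAlg.low k V (n + 1)) (q : relSpace J) :
    a * nhRel J q ∈ relFilt J (n + 2) :=
  Submodule.subset_span (Or.inl ⟨a, ha, q, rfl⟩)

lemma mul_ι_mem_relFilt {n : ℕ} {t : TAlg k V} (ht : t ∈ relFilt J n) (x : V) :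
    t * TAlg.ι k V x ∈ relFilt J (n + 1) := by
  cases n with
  | zero =>
    rw [show t = 0 from ht, zero_mul]
    exact zero_mem _
  | succ n => exact Submodule.subset_span (Or.inr ⟨t, ht, x, rfl⟩)

lemma mul_unit_mem_relFilt {n : ℕ} {t : TAlg k V} (ht : t ∈ relFilt J n) (r : k) :
    t * TAlg.unit k V r ∈ relFilt J n := (relFilt J n).smul_mem (MulOpposite.op r) ht

/-- A right submodule containing the generators of `relFilt J (n + 2)` contains it. -/
lemma relFilt_le {n : ℕ} (M : Submodule kᵐᵒᵖ (TAlg k V))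
    (h1 : ∀ a ∈ TAlg.low k V (n + 1), ∀ q, a * nhRel J q ∈ M)
    (h2 : ∀ s ∈ relFilt J (n + 1), ∀ x, s * TAlg.ι k V x ∈ M) : relFilt J (n + 2) ≤ M := by
  refine Submodule.span_le.2 ?_
  rintro _ (⟨a, ha, q, rfl⟩ | ⟨s, hs, x, rfl⟩)
  exacts [h1 a ha q, h2 s hs x]

lemma relFilt_mono : Monotone (relFilt J) := by
  refine monotone_nat_of_le_succ fun n => ?_
  induction n using Nat.strong_induction_on with
  | h n ih =>
    match n with
    | 0 => exact bot_le
    | 1 => exact bot_le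
    | n + 2 =>
      exact relFilt_le _ (fun a ha q => mul_nhRel_mem (TAlg.low_mono (by omega) ha) q)
        (fun s hs x => mul_ι_mem_relFilt (ih (n + 1) (by omega) hs) x)

variable (J) in
/-- `J` as a right submodule. -/
def idealSub : Submodule kᵐᵒᵖ (TAlg k V) where
  carrier := J
  zero_mem' := J.zero_mem
  add_mem' := J.add_mem
  smul_mem' _ t ht := J.mul_mem_right t _ ht

lemma relFilt_le_ideal (n : ℕ) : relFilt J n ≤ idealSub J := by
  induction n using Nat.strong_induction_on with
  | h n ih =>
    match n with
    | 0 => exact bot_le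
    | 1 => exact bot_le
    | n + 2 =>
      exact relFilt_le _ (fun a _ q => J.mul_mem_left _ _ (alpha_beta_mem J q))
        (fun s hs x => J.mul_mem_right _ _ (ih (n + 1) (by omega) hs))

/-- The ideal is generated by `J ∩ F_2`, whose elements are precisely the relations `q + α(q) +
β(q)`, and any product of such a relation lies in some step of the filtration. -/
lemma exists_mem_relFilt (hJ : IsNonhomQuadratic J) {t : TAlg k V} (ht : t ∈ J) :
    ∃ n, t ∈ relFilt J n := by
  rw [← hJ.span_eq] at ht
  refine (Submodule.mem_iSup_of_directed _ relFilt_mono.directed_le).1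
    (TAlg.span_le_of_mul_ι (⨆ n, relFilt J n).toAddSubgroup (fun a s hs r => ?_)
      (fun s hs x => ?_) ht)
  · obtain ⟨w, x, r', rfl⟩ := TAlg.exists_of_mem_filt_two hs.2
    have hw : w ∈ relSpace J := ⟨x, r', hs.1⟩
    obtain ⟨h1, h2⟩ := alpha_beta_unique hJ ⟨w, hw⟩ hs.1
    obtain ⟨n, hn⟩ := TAlg.exists_mem_low a
    have h3 := mul_nhRel_mem (J := J) (TAlg.low_mono (Nat.le_succ n) hn) ⟨w, hw⟩
    rw [nhRel, h1, h2] at h3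
    exact Submodule.mem_iSup_of_mem _ (mul_unit_mem_relFilt h3 r)
  · obtain ⟨n, hn⟩ := (Submodule.mem_iSup_of_directed _ relFilt_mono.directed_le).1 hs
    exact Submodule.mem_iSup_of_mem _ (mul_ι_mem_relFilt hn x)

/-- For `a` of degree at most `n`, only the top component of `a` and the quadratic part of the
relation meet in degree `n + 2`. -/
lemma comp_mul_nhRel {n : ℕ} {a : TAlg k V} (ha : a ∈ TAlg.low k V (n + 1)) (q : relSpace J) :
    TAlg.comp (n + 2) (a * nhRel J q) = TAlg.comp n a * TAlg.m2 k V q := by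
  rw [nhRel, mul_add, mul_add, map_add, map_add, TAlg.comp_mul_m2, TAlg.comp_succ_mul_ι,
    ha (n + 1) le_rfl, TAlg.comp_mul_unit, ha (n + 2) (by omega), zero_mul, zero_mul, add_zero,
    add_zero]

/-- The leading terms of `relFilt J n` are homogeneous relations. -/
lemma mk_comp_of_mem_relFilt {n : ℕ} {t : TAlg k V} (ht : t ∈ relFilt J n) :
    QAlg.mk (quadIdeal (relSpace J)) (TAlg.comp n t) = 0 := by
  let M (n : ℕ) : Submodule kᵐᵒᵖ (TAlg k V) :=
    { ((QAlg.mk (quadIdeal (relSpace J))).toAddMonoidHom.comp (TAlg.comp n)).ker with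
      smul_mem' := fun r t (ht : QAlg.mk (quadIdeal (relSpace J)) (TAlg.comp n t) = 0) => by
        induction r using MulOpposite.rec' with
        | h r =>
          change QAlg.mk (quadIdeal (relSpace J)) (TAlg.comp n (t * TAlg.unit k V r)) = 0
          rw [TAlg.comp_mul_unit, _root_.map_mul (QAlg.mk _), ht, zero_mul] }
  suffices h : relFilt J n ≤ M n from h ht
  clear ht
  induction n using Nat.strong_induction_on with
  | h n ih =>
    match n with
    | 0 => exact bot_le
    | 1 => exact bot_le
    | n + 2 =>
      refine relFilt_le _ (fun a ha q => ?_) (fun s hs x => ?_)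
      · change QAlg.mk _ (TAlg.comp _ _) = 0
        rw [comp_mul_nhRel ha, _root_.map_mul (QAlg.mk _),
          QAlg.mk_eq_zero _ (m2_mem_quadIdeal q.2), mul_zero]
      · have h : QAlg.mk _ (TAlg.comp (n + 1) s) = 0 := ih (n + 1) (by omega) hs
        change QAlg.mk _ (TAlg.comp _ _) = 0
        rw [TAlg.comp_succ_mul_ι, _root_.map_mul (QAlg.mk _), h, zero_mul]

/-- Homogeneous relations are leading terms of elements of `relFilt J n`. -/
lemma comp_mem_sup_of_mem_quadIdeal {t : TAlg k V} (ht : t ∈ quadIdeal (relSpace J)) (n : ℕ) :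
    TAlg.comp n t ∈ relFilt J n ⊔ TAlg.low k V n := by
  let M : AddSubgroup (TAlg k V) :=
    ⨅ n, (relFilt J n ⊔ TAlg.low k V n).toAddSubgroup.comap (TAlg.comp n)
  suffices h : t ∈ M from (AddSubgroup.mem_iInf.1 h) n
  refine TAlg.span_le_of_mul_ι M (fun a s hs r => AddSubgroup.mem_iInf.2 fun n => ?_)
    (fun s hs x => AddSubgroup.mem_iInf.2 fun n => ?_) ht
  · obtain ⟨q, hq, rfl⟩ := hs
    change TAlg.comp n _ ∈ relFilt J n ⊔ TAlg.low k V n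
    rw [TAlg.comp_mul_unit]
    refine (relFilt J n ⊔ TAlg.low k V n).smul_mem (MulOpposite.op r) ?_
    match n with
    | 0 => rw [TAlg.comp_mul_m2_of_lt (by decide)]; exact zero_mem _
    | 1 => rw [TAlg.comp_mul_m2_of_lt (by decide)]; exact zero_mem _
    | n + 2 =>
      rw [TAlg.comp_mul_m2]
      have ha : TAlg.comp n a ∈ TAlg.low k V (n + 1) := TAlg.comp_mem_low (Nat.lt_succ_self n) a
      -- Completing a homogeneous relation to a nonhomogeneous one costs terms of degree at most `n
      -- + 1`.
      have h : TAlg.comp n a * TAlg.m2 k V q = TAlg.comp n a * nhRel J ⟨q, hq⟩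
          - (TAlg.comp n a * TAlg.ι k V (alpha J ⟨q, hq⟩)
            + TAlg.comp n a * TAlg.unit k V (beta J ⟨q, hq⟩)) := by
        rw [nhRel]
        noncomm_ring
      rw [h]
      exact sub_mem (Submodule.mem_sup_left (mul_nhRel_mem ha _)) (Submodule.mem_sup_right
        (add_mem (TAlg.mul_ι_mem_low ha _)
          (TAlg.mul_unit_mem_low (TAlg.low_mono (Nat.le_succ _) ha) _)))
  · change TAlg.comp n _ ∈ relFilt J n ⊔ TAlg.low k V n
    cases n with
    | zero => rw [TAlg.comp_zero_mul_ι]; exact zero_mem _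
    | succ n =>
      rw [TAlg.comp_succ_mul_ι]
      obtain ⟨y, hy, z, hz, h⟩ := Submodule.mem_sup.1 ((AddSubgroup.mem_iInf.1 hs) n)
      rw [← h, add_mul]
      exact add_mem (Submodule.mem_sup_left (mul_ι_mem_relFilt hy x))
        (Submodule.mem_sup_right (TAlg.mul_ι_mem_low hz x))

end Filtration

/-! ### The obstruction to extending functionals that kill relations -/

section PBW

variable {k E : Type u} [Ring k] [AddCommGroup E] [Module k E] [Module kᵐᵒᵖ E]
  [SMulCommClass k kᵐᵒᵖ E] {J : TwoSidedIdeal (TAlg k E)}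

namespace KDual

variable (J) in
/-- The projection of `A^!` onto its degree one piece `E^*`. -/
noncomputable def pr : KDual J →+ RDual k E :=
  (QAlg.exists_pr (perp (relSpace J)) perp_op_smul_mem).choose

lemma pr_mul_ι (b : KDual J) (f : RDual k E) : pr J (b * ι J f) = aug J b • f :=
  (QAlg.exists_pr (perp (relSpace J)) perp_op_smul_mem).choose_spec.1 b f

lemma pr_unit (r : k) : pr J (unit J r) = 0 :=
  (QAlg.exists_pr (perp (relSpace J)) perp_op_smul_mem).choose_spec.2 r

lemma pr_mul_unit (b : KDual J) (r : k) :
    pr J (b * unit J r) = MulOpposite.op r • pr J b := by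
  induction b using QAlg.induction_right with
  | unit s => rw [← _root_.map_mul (unit J), pr_unit, pr_unit, smul_zero]
  | add a b ha hb => rw [add_mul, map_add, ha, hb, map_add, smul_add]
  | mul_ι b f _ => rw [mul_assoc, ← QAlg.ι_op_smul, pr_mul_ι, pr_mul_ι, smul_comm]

/-- The kernel of `E^* ⊗ E^* → (A^!)^2` is `Q^⊥`. -/
lemma pairing_eq_zero_of_m2 {t : BTensor k (RDual k E) (RDual k E)} (ht : m2 J t = 0)
    {q : BTensor k E E} (hq : q ∈ relSpace J) : pairing t q = 0 := by
  -- Pairing with a fixed `q` in `Q` is extended to a functional on all of `A^!` by reading off the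
  -- degree one part of the left factor.
  let ω : KDual J →+ RDual k E →+ k :=
    AddMonoidHom.mk' (fun b => AddMonoidHom.mk' (fun f => pairing (tmul k (pr J b) f) q)
      (fun f g => by rw [tmul_add, map_add, AddMonoidHom.add_apply]))
      (fun a b => by
        ext f
        change pairing (tmul k (pr J (a + b)) f) q = _
        rw [map_add, add_tmul, map_add, AddMonoidHom.add_apply]
        rfl)
  obtain ⟨φ, hφ, -⟩ := exists_hom ω (fun b r f => by
      change pairing (tmul k (pr J _) f) q = pairing (tmul k (pr J b) _) q
      rw [pr_mul_unit, smul_tmul])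
    (fun b Θ hΘ t ht => by
      have h : ∀ t, Θ t = aug J b * pairing t q := by
        intro t
        induction t using BTensor.induction_on with
        | h0 => simp
        | ha s t hs ht => rw [map_add, hs, ht, map_add, AddMonoidHom.add_apply, mul_add]
        | ht f g =>
          rw [hΘ]
          change pairing (tmul k (pr J _) g) q = _
          rw [pr_mul_ι, ← left_smul_tmul, pairing_smul]
      rw [h, ht q hq, mul_zero])
  have h : ∀ t, φ (m2 J t) = pairing t q := by
    intro t
    induction t using BTensor.induction_on with
    | h0 => simp
    | ha s t hs ht => rw [map_add, map_add, hs, ht, map_add, AddMonoidHom.add_apply]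
    | ht f g =>
      rw [m2_tmul, hφ]
      change pairing (tmul k (pr J _) g) q = _
      rw [← one_mul (ι J f), pr_mul_ι, map_one, one_smul]
  rw [← h, ht, map_zero]

lemma Represents.apply_eq_zero {φ : relSpace J → k} (h : Represents (0 : KDual J) φ)
    (q : relSpace J) : φ q = 0 := by
  obtain ⟨t, ht, ht'⟩ := h
  rw [← ht', pairing_eq_zero_of_m2 ht.symm q.2]

lemma Represents.eq_zero {w : KDual J} {φ : relSpace J → k} (h : Represents w φ)
    (h' : ∀ q, φ q = 0) : w = 0 :=
  h.unique ⟨0, (map_zero _).symm, fun q => by rw [map_zero, h']; rfl⟩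

end KDual

/-- The map `u ↦ (x ↦ l(u x))`. -/
def rowMap (l : TAlg k E →ₗ[kᵐᵒᵖ] k) : TAlg k E →ₗ[kᵐᵒᵖ] RDual k E where
  toFun u := ({ toFun := fun x => l (u * TAlg.ι k E x)
                map_add' := fun x y => by rw [map_add, mul_add, map_add]
                map_smul' := fun r x => by
                  induction r using MulOpposite.rec' with
                  | h r =>
                    rw [TAlg.ι_op_smul, ← mul_assoc, ← TAlg.op_smul_def, LinearMap.map_smul]
                    rfl } : E →ₗ[kᵐᵒᵖ] k)
  map_add' u v := RDual.ext fun x => by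
    change l ((u + v) * _) = l (u * _) + l (v * _)
    rw [add_mul, map_add]
  map_smul' r u := RDual.ext fun x => by
    induction r using MulOpposite.rec' with
    | h r =>
      change l (u * TAlg.unit k E r * _) = l (u * TAlg.ι k E (r • x))
      rw [TAlg.ι_smul, mul_assoc]

lemma rowMap_apply (l : TAlg k E →ₗ[kᵐᵒᵖ] k) (u : TAlg k E) (x : E) :
    rowMap l u x = l (u * TAlg.ι k E x) := rfl

/-- Since `T = k ⊕ (T ⊗ E)`, a functional can be prescribed freely on scalars and, through its rows
`u ↦ l'(u ·)`, on the products `u x`. -/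
lemma exists_linearMap_of_row (ν : TAlg k E →ₗ[kᵐᵒᵖ] RDual k E) (l : TAlg k E →ₗ[kᵐᵒᵖ] k) :
    ∃ l' : TAlg k E →ₗ[kᵐᵒᵖ] k, (∀ u x, l' (u * TAlg.ι k E x) = ν u x) ∧
      ∀ r, l' (TAlg.unit k E r) = l (TAlg.unit k E r) := by
  obtain ⟨φ, -, h1, h2, -⟩ := TAlg.exists_hom (RingHom.id (TAlg k E))
    (AddMonoidHom.mk' (fun u => ((ν u : E →ₗ[kᵐᵒᵖ] k).toAddMonoidHom : E →+ k))
      (fun u v => by ext x; exact congrArg (fun f : RDual k E => f x) (map_add ν u v)))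
    (fun b r v => by
      change ν (b * TAlg.unit k E r) v = ν b (r • v)
      rw [← TAlg.op_smul_def, LinearMap.map_smul]
      rfl)
  have h1' : ∀ u x, φ (u * TAlg.ι k E x) = ν u x := h1
  -- The map `φ` carries the prescribed rows and vanishes on scalars; the degree zero part of `l`
  -- adds the values on scalars without changing the rows.
  let l₀ : TAlg k E →+ k := φ + l.toAddMonoidHom.comp (TAlg.comp 0)
  have h3 : ∀ t, l₀ t = φ t + l (TAlg.comp 0 t) := fun _ => rfl
  have h4 : ∀ u x, l₀ (u * TAlg.ι k E x) = ν u x := fun u x => by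
    rw [h3, TAlg.comp_zero_mul_ι, map_zero, add_zero, h1']
  have h5 : ∀ r, l₀ (TAlg.unit k E r) = l (TAlg.unit k E r) := fun r => by
    rw [h3, TAlg.comp_zero_unit, h2, zero_add]
  refine ⟨{ l₀ with map_smul' := fun r t => ?_ }, h4, h5⟩
  induction r using MulOpposite.rec' with
  | h r =>
  change l₀ (t * TAlg.unit k E r) = l₀ t * r
  induction t using TAlg.induction_right with
  | unit s =>
    rw [h5, ← _root_.map_mul (TAlg.unit k E), h5, _root_.map_mul (TAlg.unit k E),
      ← TAlg.op_smul_def, LinearMap.map_smul]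
    rfl
  | add s t hs ht => rw [add_mul, map_add, hs, ht, map_add, add_mul]
  | mul_ι t x _ => rw [mul_assoc, ← TAlg.ι_op_smul, h4, h4, RDual.map_op_smul]

variable [IsSemisimpleRing k] [Module.Finite kᵐᵒᵖ E]

lemma KDual.ι_pr (b : KDual J) : KDual.ι J (pr J b) = comp 1 b := by
  induction b using QAlg.induction_right with
  | unit s => rw [pr_unit, map_zero, comp_succ_unit]
  | add a b ha hb => rw [map_add, map_add, ha, hb, map_add]
  | mul_ι b f _ => rw [pr_mul_ι, QAlg.ι_smul, comp_succ_mul_ι, comp_zero_eq]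

/-- Since `l(u x y) = ν(u x)(y)`, expanding `x` by coevaluation writes the functional `q ↦ l(u q)`
as a sum of products of degree one elements of `A^!`. -/
lemma represents_row (ν : TAlg k E →ₗ[kᵐᵒᵖ] RDual k E) (l : TAlg k E →ₗ[kᵐᵒᵖ] k)
    (h : ∀ u x, l (u * TAlg.ι k E x) = ν u x) (u : TAlg k E) :
    KDual.Represents (J := J) (∑ b, KDual.ι J (ν (u * TAlg.ι k E (coevVec k E b))) *
      KDual.ι J (coevDual k E b)) (fun q => l (u * TAlg.m2 k E q)) := by
  refine ⟨∑ b, tmul k (ν (u * TAlg.ι k E (coevVec k E b))) (coevDual k E b), ?_, fun q => ?_⟩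
  · rw [map_sum]
    exact Finset.sum_congr rfl fun b _ => (KDual.m2_tmul _ _).symm
  · change _ = l (u * TAlg.m2 k E q.1)
    generalize q.1 = w
    induction w using BTensor.induction_on with
    | h0 => simp
    | ha w w' hw hw' => rw [map_add, hw, hw', map_add, mul_add, map_add]
    | ht x y =>
      rw [map_sum, AddMonoidHom.finsetSum_apply, TAlg.m2_tmul, ← mul_assoc, h]
      conv_rhs => rw [coev_spec k x, map_sum, Finset.mul_sum, map_sum]
      have hs : ∀ (g : Fin (coevCard k E) → RDual k E), (∑ b, g b) y = ∑ b, g b y := fun g =>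
        map_sum (AddMonoidHom.mk' (fun f : RDual k E => f y) (fun _ _ => rfl)) _ _
      rw [hs]
      refine Finset.sum_congr rfl fun b _ => ?_
      rw [pairing_tmul, TAlg.ι_op_smul, ← mul_assoc, ← TAlg.op_smul_def, LinearMap.map_smul]
      rfl

lemma KDual.represents_eq_sum {N : ℕ} {q : Fin N → relSub J}
    {t : Fin N → BTensor k (RDual k E) (RDual k E)}
    (ht : ∀ φ : relSub J →ₗ[kᵐᵒᵖ] k, ∀ w : relSub J, pairing (∑ j, φ (q j) • t j) w = φ w)
    {w : KDual J} (φ : relSub J →ₗ[kᵐᵒᵖ] k) (hw : w.Represents (fun q => φ q)) :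
    w = ∑ j, KDual.unit J (φ (q j)) * KDual.m2 J (t j) := by
  rw [← hw.eq (ht φ), map_sum]
  exact Finset.sum_congr rfl fun j _ => KDual.m2_smul _ _

section Step

variable {n : ℕ} {l : TAlg k E →ₗ[kᵐᵒᵖ] k}
  {ν : TAlg k E →ₗ[kᵐᵒᵖ] RDual k E}

/-- The obstruction to killing `u(q + α(q) + β(q))`, `q ∈ Q`, as an element of `(A^!)^2`. -/
noncomputable def obstr (hJ : IsNonhomQuadratic J) (l : TAlg k E →ₗ[kᵐᵒᵖ] k) (ν : TAlg k E →ₗ[kᵐᵒᵖ] RDual k E)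
    (C : KDual J) : TAlg k E →+ KDual J :=
  AddMonoidHom.mk' (fun u => ∑ b, KDual.ι J (ν (u * TAlg.ι k E (coevVec k E b))) *
      KDual.ι J (coevDual k E b) + KDual.dGen hJ (rowMap l u) + KDual.unit J (l u) * C)
    (fun u v => by
      simp only [add_mul, map_add, Finset.sum_add_distrib]
      abel)

lemma obstr_apply (hJ : IsNonhomQuadratic J) (C : KDual J) (u : TAlg k E) :
    obstr hJ l ν C u = ∑ b, KDual.ι J (ν (u * TAlg.ι k E (coevVec k E b))) *
      KDual.ι J (coevDual k E b) + KDual.dGen hJ (rowMap l u) + KDual.unit J (l u) * C := rfl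

variable {C : KDual J}

/-- What the obstruction measures: with the quadratic term evaluated by the new functional `l'` and
the lower terms by the old `l`, it is the value on `u (q + α(q) + β(q))`. -/
lemma represents_obstr (hJ : IsNonhomQuadratic J) (hC : C.Represents (beta J))
    {l' : TAlg k E →ₗ[kᵐᵒᵖ] k}
    (h : ∀ u x, l' (u * TAlg.ι k E x) = ν u x) (u : TAlg k E) :
    (obstr hJ l ν C u).Represents (fun q => l' (u * TAlg.m2 k E q)
      + l (u * TAlg.ι k E (alpha J q)) + l (u * TAlg.unit k E (beta J q))) := by
  rw [obstr_apply]
  convert ((represents_row ν l' h u).add (KDual.dGen_represents hJ (rowMap l u))).add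
    (hC.unit_mul (l u)) using 2 with q
  congr 1
  rw [← TAlg.op_smul_def, LinearMap.map_smul]
  rfl

lemma KDual.mul_unit_comm_of_represents (hJ : IsNonhomQuadratic J) (hC : C.Represents (beta J))
    (r : k) :
    C * KDual.unit J r = KDual.unit J r * C := by
  refine (hC.mul_unit r).unique ?_
  convert hC.unit_mul r using 2 with q
  exact (alpha_beta_left_smul hJ r q).2

/-- Centrality of the coevaluation element handles the sum; the curvature commutes with `k` because
`β` is a bimodule map. -/
lemma obstr_mul_unit (hJ : IsNonhomQuadratic J) (hC : C.Represents (beta J))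
    (u : TAlg k E) (r : k) :
    obstr hJ l ν C (u * TAlg.unit k E r) = obstr hJ l ν C u * KDual.unit J r := by
  have h1 : rowMap l (u * TAlg.unit k E r) = MulOpposite.op r • rowMap l u := by
    rw [← TAlg.op_smul_def, LinearMap.map_smul]
  have h2 : l (u * TAlg.unit k E r) = l u * r := by
    rw [← TAlg.op_smul_def, LinearMap.map_smul]
    rfl
  let G : E →+ RDual k E →+ KDual J := AddMonoidHom.mk' (fun x => AddMonoidHom.mk' (fun f =>
      KDual.ι J (ν (u * TAlg.ι k E x)) * KDual.ι J f)
      (fun f f' => by rw [map_add, mul_add]))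
      (fun x x' => by
        ext f
        simp only [AddMonoidHom.mk'_apply, AddMonoidHom.add_apply, map_add, add_mul, mul_add])
  have hG := coev_move G (fun e s f => by
    change KDual.ι J (ν (u * TAlg.ι k E _)) * KDual.ι J f
      = KDual.ι J (ν (u * TAlg.ι k E _)) * KDual.ι J (s • f)
    rw [TAlg.ι_op_smul, ← mul_assoc, ← TAlg.op_smul_def, LinearMap.map_smul, QAlg.ι_op_smul,
      QAlg.ι_smul, mul_assoc]) r
  rw [obstr_apply, obstr_apply, h1, h2, KDual.dGen_op_smul, add_mul, add_mul, mul_assoc _ C,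
    KDual.mul_unit_comm_of_represents hJ hC, ← mul_assoc, ← _root_.map_mul (KDual.unit J)]
  congr 2
  rw [Finset.sum_mul]
  refine (Finset.sum_congr rfl fun a _ => ?_).trans (hG.trans
    (Finset.sum_congr rfl fun a _ => ?_))
  · change _ = KDual.ι J (ν (u * TAlg.ι k E _)) * KDual.ι J _
    rw [TAlg.ι_smul, mul_assoc]
  · change KDual.ι J (ν (u * TAlg.ι k E _)) * KDual.ι J _ = _
    rw [QAlg.ι_op_smul, mul_assoc]

lemma row_eq_of_low {l' : TAlg k E →ₗ[kᵐᵒᵖ] k}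
    (h : ∀ u x, l' (u * TAlg.ι k E x) = ν u x) (hν : ∀ u ∈ TAlg.low k E (n + 2), ν u = rowMap l u)
    {u : TAlg k E} (hu : u ∈ TAlg.low k E (n + 1)) (w : BTensor k E E) :
    l' (u * TAlg.m2 k E w) = l (u * TAlg.m2 k E w) := by
  induction w using BTensor.induction_on with
  | h0 => simp
  | ha w w' hw hw' => rw [map_add, mul_add, map_add, hw, hw', map_add]
  | ht x y =>
    rw [TAlg.m2_tmul, ← mul_assoc, h, hν _ (TAlg.mul_ι_mem_low hu x)]
    rfl

/-- For `u` of degree at most `n`, the new functional agrees with `l` on `u q`, and `u (q + α(q) +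
β(q))` is already among the relations that `l` kills. -/
lemma obstr_eq_zero_of_low (hJ : IsNonhomQuadratic J) (hC : C.Represents (beta J))
    (hν : ∀ u ∈ TAlg.low k E (n + 2), ν u = rowMap l u)
    (hl : ∀ t ∈ relFilt J (n + 2), l t = 0) {u : TAlg k E} (hu : u ∈ TAlg.low k E (n + 1)) :
    obstr hJ l ν C u = 0 := by
  obtain ⟨l', h, -⟩ := exists_linearMap_of_row ν l
  refine (represents_obstr hJ hC h u).eq_zero fun q => ?_
  rw [row_eq_of_low h hν hu, ← map_add, ← map_add, ← mul_add, ← mul_add]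
  exact hl _ (mul_nhRel_mem hu q)

/-- The obstruction is a cocycle. -/
lemma sum_obstr_mul_eq_zero (hJ : IsNonhomQuadratic J) (hC : C.Represents (beta J))
    (hν : ∀ u ∈ TAlg.low k E (n + 2), ν u = rowMap l u)
    (hν' : ∀ u ∈ relFilt J (n + 2), ν u = 0)
    (hl : ∀ t ∈ relFilt J (n + 2), l t = 0) {u : TAlg k E} (hu : u ∈ TAlg.low k E (n + 1)) :
    ∑ b, obstr hJ l ν C (u * TAlg.ι k E (coevVec k E b)) * KDual.ι J (coevDual k E b) = 0 := by
  obtain ⟨D, hD⟩ := exists_isKoszulDualStructure hJ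
  have hDι : ∀ f, D.d (KDual.ι J f) = KDual.dGen hJ f := fun f =>
    (hD.d_eq f).unique (KDual.dGen_represents hJ f)
  have hDC : D.c = C := hD.c_eq.unique hC
  obtain ⟨N, q, t, ht, hΘ⟩ := exists_coev_rel J
  have hνr : ∀ v r, ν (v * TAlg.unit k E r) = MulOpposite.op r • ν v := fun v r => by
    rw [← TAlg.op_smul_def, LinearMap.map_smul]
  let Θ : BTensor k E E →+ BTensor k (RDual k E) (RDual k E) →+ KDual J :=
    AddMonoidHom.mk' (fun w => (AddMonoidHom.mulLeft (KDual.ι J (ν (u * TAlg.m2 k E w)))).comp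
      (KDual.m2 J)) (fun w w' => by
        ext s
        simp [mul_add, add_mul])
  have hΘ' : ∀ w s, Θ w s = KDual.ι J (ν (u * TAlg.m2 k E w)) * KDual.m2 J s := fun _ _ => rfl
  -- The double sum over `E ⊗ E` is replaced by a sum over `Q`, where the relations can be used.
  have e1 := hΘ Θ (fun w r s => by
      rw [hΘ', hΘ', m2_op_smul, ← mul_assoc, hνr, QAlg.ι_op_smul, KDual.m2_smul, mul_assoc])
    (fun w s hs => by rw [hΘ', KDual.m2_eq_zero hs, mul_zero])
  -- Because `ν` kills `u (q + α(q) + β(q))`, its value on `u q` is expressed through its values on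
  -- `u α(q)` and `u β(q)`.
  have e2 : ∀ j, ν (u * TAlg.m2 k E (q j)) = - ∑ b, MulOpposite.op (coevDual k E b (alpha J (q j)))
      • ν (u * TAlg.ι k E (coevVec k E b)) - MulOpposite.op (beta J (q j)) • ν u := by
    intro j
    have h : ν (u * (TAlg.m2 k E (q j) + TAlg.ι k E (alpha J (q j)) +
        TAlg.unit k E (beta J (q j)))) = 0 := hν' _ (mul_nhRel_mem hu (q j))
    rw [mul_add, mul_add, map_add, map_add, hνr] at h
    have h2 : ν (u * TAlg.ι k E (alpha J (q j))) = ∑ b, MulOpposite.op (coevDual k E b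
        (alpha J (q j))) • ν (u * TAlg.ι k E (coevVec k E b)) := by
      conv_lhs => rw [coev_spec k (alpha J (q j)), map_sum, Finset.mul_sum, map_sum]
      refine Finset.sum_congr rfl fun b _ => ?_
      rw [TAlg.ι_op_smul, ← mul_assoc, hνr]
    rw [← h2, ← sub_eq_zero, ← h]
    abel
  have e3 : ∑ j, KDual.ι J (ν (u * TAlg.m2 k E (q j))) * KDual.m2 J (t j)
      = - ∑ b, KDual.ι J (ν (u * TAlg.ι k E (coevVec k E b))) * KDual.dGen hJ (coevDual k E b)
        - KDual.ι J (ν u) * C := by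
    rw [KDual.represents_eq_sum ht (betaLin hJ) hC]
    have h1 : ∀ b, KDual.dGen hJ (coevDual k E b)
        = ∑ j, KDual.unit J (coevDual k E b (alpha J (q j))) * KDual.m2 J (t j) := fun b =>
      KDual.represents_eq_sum ht ((coevDual k E b : E →ₗ[kᵐᵒᵖ] k) ∘ₗ alphaLin hJ)
        (KDual.dGen_represents hJ _)
    simp only [h1, Finset.mul_sum]
    rw [Finset.sum_comm, ← Finset.sum_neg_distrib, ← Finset.sum_sub_distrib]
    refine Finset.sum_congr rfl fun j _ => ?_
    rw [e2, map_sub, map_neg, map_sum, sub_mul, neg_mul, Finset.sum_mul]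
    refine congrArg₂ (fun x y => -x - y) (Finset.sum_congr rfl fun b _ => ?_) ?_
    · rw [QAlg.ι_op_smul, mul_assoc]
    · rw [QAlg.ι_op_smul]
      exact mul_assoc _ _ _
  have e4 : ∑ b, KDual.unit J (l (u * TAlg.ι k E (coevVec k E b))) * C * KDual.ι J (coevDual k E b)
      = C * KDual.ι J (rowMap l u) := by
    conv_rhs => rw [coev_spec_dual (rowMap l u), map_sum, Finset.mul_sum]
    refine Finset.sum_congr rfl fun b _ => ?_
    rw [QAlg.ι_smul, ← mul_assoc, KDual.mul_unit_comm_of_represents hJ hC, rowMap_apply]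
  -- The differential of `A^!` is applied to the vanishing obstruction at `u` itself. The Leibniz
  -- rule, `d² = [C, ·]` and `d(C) = 0` turn it into an identity in degree three, which is the
  -- cocycle identity up to rewriting.
  have e5 := congrArg D.d (obstr_eq_zero_of_low hJ hC hν hl hu)
  rw [map_zero, obstr_apply, map_add, map_add, map_sum, ← hDι, D.d_d, ← hDC,
    D.d_base_mul _ (QAlg.unit_mem _), D.d_c, mul_zero, add_zero, hDC] at e5
  have e6 : ∀ f g, D.d (KDual.ι J f * KDual.ι J g)
      = KDual.dGen hJ f * KDual.ι J g - KDual.ι J f * KDual.dGen hJ g := by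
    intro f g
    rw [D.leibniz _ (KDual.ι_mem f), hDι, hDι, pow_one, neg_one_mul, sub_eq_add_neg]
  simp only [e6, Finset.sum_sub_distrib] at e5
  simp only [obstr_apply, add_mul, Finset.sum_add_distrib, e4]
  have e7 : ∑ b, (∑ e, KDual.ι J (ν (u * TAlg.ι k E (coevVec k E b) *
      TAlg.ι k E (coevVec k E e))) * KDual.ι J (coevDual k E e)) * KDual.ι J (coevDual k E b)
      = ∑ j, KDual.ι J (ν (u * TAlg.m2 k E (q j))) * KDual.m2 J (t j) := by
    refine Eq.trans ?_ e1
    rw [Fintype.sum_prod_type]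
    refine Finset.sum_congr rfl fun b _ => ?_
    rw [Finset.sum_mul]
    refine Finset.sum_congr rfl fun e _ => ?_
    rw [hΘ', coevVec2, coevDual2, KDual.m2_tmul, TAlg.m2_tmul, mul_assoc, mul_assoc]
  -- The quadratic terms contribute `-∑ ν(u x_b) d(x̂_b) - ν(u) C`; the rest matches `e5`, because
  -- on these low degrees `ν` is the row of `l`.
  rw [e7, e3, ← e5, hν u (TAlg.low_mono (by omega) hu)]
  have e8 : ∀ b, rowMap l (u * TAlg.ι k E (coevVec k E b)) = ν (u * TAlg.ι k E (coevVec k E b)) :=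
    fun b => (hν _ (TAlg.mul_ι_mem_low hu _)).symm
  simp only [e8]
  abel

end Step

end PBW

/-! ### The Poincaré–Birkhoff–Witt theorem -/

section PBW

variable {k E : Type u} [Ring k] [AddCommGroup E] [Module k E] [Module kᵐᵒᵖ E]
  [SMulCommClass k kᵐᵒᵖ E] {J : TwoSidedIdeal (TAlg k E)}
  [IsSemisimpleRing k] [Module.Finite kᵐᵒᵖ E]

/-- Koszulness provides a correction of a cocycle defined on degree `n + 1`. -/
lemma exists_correction (hK : IsKoszul (QAlg.deg (quadIdeal (relSpace J)))) {n : ℕ}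
    (δ : TAlg k E →+ KDual J) (hr : ∀ u r, δ (u * TAlg.unit k E r) = δ u * KDual.unit J r)
    (hdeg : ∀ u, δ u ∈ KDual.deg J 2) (hlow : ∀ u ∈ TAlg.low k E (n + 1), δ u = 0)
    (hrel : ∀ u ∈ relFilt J (n + 1), δ u = 0)
    (hcoc : ∀ u ∈ TAlg.low k E (n + 1),
      ∑ b, δ (u * TAlg.ι k E (coevVec k E b)) * KDual.ι J (coevDual k E b) = 0) :
    ∃ η : Assoc J →+ RDual k E, (∀ a r, η (a * Assoc.unit J r) = MulOpposite.op r • η a) ∧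
      ∀ t, ∑ b, KDual.ι J (η (QAlg.mk _ (t * TAlg.ι k E (coevVec k E b)))) *
        KDual.ι J (coevDual k E b) = - δ (TAlg.comp (n + 1) t) := by
  -- In degree `n + 1` a homogeneous relation is an element of `relFilt J (n + 1)` up to lower
  -- terms, and `δ` kills both. So `δ`, restricted to components of degree `n + 1`, descends to `A`.
  have hQ : ∀ t ∈ quadIdeal (relSpace J), δ (TAlg.comp (n + 1) t) = 0 := by
    intro t ht
    obtain ⟨y, hy, z, hz, h⟩ := Submodule.mem_sup.1 (comp_mem_sup_of_mem_quadIdeal ht (n + 1))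
    rw [← h, map_add, hrel y hy, hlow z hz, add_zero]
  obtain ⟨ψ, hψ⟩ := exists_addMonoidHom_of_rel
    (fun (a : Assoc J) b => ∃ t, QAlg.mk _ t = a ∧ b = - δ (TAlg.comp (n + 1) t))
    (by
      rintro _ _ _ _ ⟨t, rfl, rfl⟩ ⟨t', rfl, rfl⟩
      exact ⟨t + t', map_add _ _ _, by rw [map_add, map_add, neg_add]⟩)
    (fun a => by
      obtain ⟨t, rfl⟩ := QAlg.mk_surjective _ a
      exact ⟨_, t, rfl, rfl⟩)
    (by
      rintro _ _ _ ⟨t, rfl, rfl⟩ ⟨t', h, rfl⟩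
      rw [neg_inj, ← sub_eq_zero, ← map_sub, ← map_sub]
      refine hQ _ ((QAlg.mk_eq_zero_iff _).1 ?_)
      rw [map_sub, h, sub_self])
  have hψ' : ∀ t, ψ (QAlg.mk _ t) = - δ (TAlg.comp (n + 1) t) := by
    intro t
    obtain ⟨t', h, h'⟩ := hψ (QAlg.mk _ t)
    rw [h', neg_inj, ← sub_eq_zero, ← map_sub, ← map_sub]
    refine hQ _ ((QAlg.mk_eq_zero_iff _).1 ?_)
    rw [map_sub, h, sub_self]
  -- Exactness at `Hom(A_{n+1}, (A^!)^2)`: the cocycle `-δ` is the coboundary of a map with values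
  -- in `(A^!)^1 = E^*`.
  obtain ⟨η, h1, h2, h3⟩ := exists_of_cocycle hK (i := 1) ψ (fun a r => by
      obtain ⟨t, rfl⟩ := QAlg.mk_surjective _ a
      have := hψ' (t * TAlg.unit k E r)
      rw [_root_.map_mul (QAlg.mk _)] at this
      refine this.trans ?_
      rw [hψ', TAlg.comp_mul_unit, hr, neg_mul])
    (fun a => by
      obtain ⟨t, rfl⟩ := QAlg.mk_surjective _ a
      rw [hψ']
      exact KDual.comp_of_mem (neg_mem (hdeg _)))
    (fun a => by
      obtain ⟨t, rfl⟩ := QAlg.mk_surjective _ a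
      have h : ∀ b, ψ (QAlg.mk _ t * Assoc.ι J (coevVec k E b))
          = - δ (TAlg.comp n t * TAlg.ι k E (coevVec k E b)) := fun b => by
        rw [← TAlg.comp_succ_mul_ι, ← hψ', _root_.map_mul (QAlg.mk _)]
        rfl
      simp only [h, neg_mul, Finset.sum_neg_distrib]
      rw [hcoc _ (TAlg.comp_mem_low (Nat.lt_succ_self n) t), neg_zero])
  refine ⟨(KDual.pr J).comp η, fun a r => ?_, fun t => ?_⟩
  · change KDual.pr J (η (a * Assoc.unit J r)) = _
    rw [h1, KDual.pr_mul_unit]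
    rfl
  · rw [← hψ', ← h3]
    refine Finset.sum_congr rfl fun b _ => ?_
    change KDual.ι J (KDual.pr J (η _)) * _ = _
    rw [KDual.ι_pr, h2, _root_.map_mul (QAlg.mk _)]
    rfl

/-- Functionals on `T / relFilt J (n + 2)` extend to functionals on `T / relFilt J (n + 3)`. -/
lemma exists_extension_relFilt (hJ : IsNonhomKoszul J) {n : ℕ}
    (h : relFilt J (n + 2) ⊓ TAlg.low k E (n + 2) ≤ relFilt J (n + 1))
    (l : TAlg k E →ₗ[kᵐᵒᵖ] k) (hl : ∀ t ∈ relFilt J (n + 2), l t = 0) :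
    ∃ l' : TAlg k E →ₗ[kᵐᵒᵖ] k, (∀ t ∈ TAlg.low k E (n + 3), l' t = l t) ∧
      ∀ t ∈ relFilt J (n + 3), l' t = 0 := by
  have hJ' := hJ.toIsNonhomQuadratic
  obtain ⟨C, hC⟩ := KDual.exists_represents (betaLin hJ')
  have hC' : C.Represents (beta J) := hC
  have hrow : ∀ t ∈ relFilt J (n + 1), rowMap l t = 0 := fun t ht =>
    RDual.ext fun x => hl _ (mul_ι_mem_relFilt ht x)
  -- First guess for the rows of the new functional: those of `l` in degrees at most `n + 1`, and
  -- zero on `relFilt J (n + 2)`. The hypothesis `h` makes the two prescriptions compatible.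
  obtain ⟨ν₀, h1, h2⟩ := exists_extension_of_inf_le_ker (TAlg.low k E (n + 2)) (relFilt J (n + 2))
    (rowMap l) (fun t ht => hrow t (h ⟨ht.2, ht.1⟩))
  let δ := obstr hJ' l ν₀ C
  have hδlow : ∀ u ∈ TAlg.low k E (n + 1), δ u = 0 := fun u hu =>
    obstr_eq_zero_of_low hJ' hC' h1 hl hu
  obtain ⟨η, hηr, hη⟩ := exists_correction hJ.koszul δ (obstr_mul_unit hJ' hC')
    (fun u => by
      obtain ⟨l', hl', -⟩ := exists_linearMap_of_row ν₀ l
      exact (represents_obstr hJ' hC' hl' u).mem_deg)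
    hδlow
    (fun u hu => by
      change obstr hJ' l ν₀ C u = 0
      rw [obstr_apply, hrow u hu, hl u (relFilt_mono (Nat.le_succ _) hu), map_zero, map_zero,
        zero_mul, add_zero, add_zero]
      exact Finset.sum_eq_zero fun b _ => by
        rw [h2 _ (mul_ι_mem_relFilt hu _), map_zero, zero_mul])
    (fun u hu => sum_obstr_mul_eq_zero hJ' hC' h1 h2 hl hu)
  -- The correction sees only the class in `A` of the component of degree `n + 2`. So it changes
  -- nothing in lower degrees, and it vanishes on `relFilt J (n + 2)`, whose leading terms are
  -- homogeneous relations.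
  let ν : TAlg k E →ₗ[kᵐᵒᵖ] RDual k E :=
    { toFun := fun u => ν₀ u + η (QAlg.mk _ (TAlg.comp (n + 2) u))
      map_add' := fun u v => by
        simp only [map_add]
        abel
      map_smul' := fun r u => by
        induction r using MulOpposite.rec' with
        | h r =>
          have h3 := hηr (QAlg.mk _ (TAlg.comp (n + 2) u)) r
          rw [RingHom.id_apply, smul_add, LinearMap.map_smul, ← h3, TAlg.op_smul_def,
            TAlg.comp_mul_unit, _root_.map_mul (QAlg.mk _)]
          rfl }
  have hν : ∀ u, ν u = ν₀ u + η (QAlg.mk _ (TAlg.comp (n + 2) u)) := fun _ => rfl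
  obtain ⟨l', hl'1, hl'2⟩ := exists_linearMap_of_row ν l
  have hcomp : ∀ t, ∀ m < n + 3, l' (TAlg.comp m t) = l (TAlg.comp m t) := by
    intro t
    induction t using TAlg.induction_right with
    | unit r =>
      rintro (_ | m) -
      · rw [TAlg.comp_zero_unit, hl'2]
      · rw [TAlg.comp_succ_unit, map_zero, map_zero]
    | add s t hs ht =>
      intro m hm
      rw [map_add, map_add, map_add, hs m hm, ht m hm]
    | mul_ι t x _ =>
      rintro (_ | m) hm
      · rw [TAlg.comp_zero_mul_ι, map_zero, map_zero]
      · rw [TAlg.comp_succ_mul_ι, hl'1, hν, h1 _ (TAlg.comp_mem_low (by omega) t),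
          TAlg.comp_of_mem_ne (TAlg.comp_mem m t) (by omega), map_zero, map_zero, add_zero]
        rfl
  have heq : ∀ t ∈ TAlg.low k E (n + 3), l' t = l t := by
    intro t ht
    obtain ⟨N, -, h⟩ := TAlg.exists_sum_comp t
    rw [h, map_sum, map_sum]
    refine Finset.sum_congr rfl fun m _ => ?_
    by_cases hm : m < n + 3
    · exact hcomp t m hm
    · rw [ht m (by omega), map_zero, map_zero]
  refine ⟨l', heq, fun t ht => ?_⟩
  refine relFilt_le (n := n + 1) (LinearMap.ker l') (fun a ha q => ?_) (fun s hs x => ?_) ht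
  -- For `a` of degree at most `n + 1`, the corrected obstruction is `δ` of `a` minus its top
  -- component. That difference has degree at most `n`, where `δ` vanishes.
  · have hr : (0 : KDual J).Represents (fun q => l' (a * nhRel J q)) := by
      convert represents_obstr hJ' hC' (l := l) hl'1 a using 1
      · have h3 : obstr hJ' l ν C a = δ a + ∑ b, KDual.ι J (η (QAlg.mk _
            (TAlg.comp (n + 1) a * TAlg.ι k E (coevVec k E b)))) * KDual.ι J (coevDual k E b) := by
          change obstr hJ' l ν C a = obstr hJ' l ν₀ C a + _
          rw [obstr_apply, obstr_apply]
          simp only [hν, TAlg.comp_succ_mul_ι, map_add, add_mul, Finset.sum_add_distrib]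
          abel
        rw [h3, hη, TAlg.comp_of_mem (TAlg.comp_mem _ _), ← sub_eq_add_neg, ← map_sub,
          hδlow _ (TAlg.sub_comp_mem_low ha)]
      · funext q
        rw [nhRel, mul_add, mul_add, map_add, map_add, heq _ (TAlg.mul_ι_mem_low ha _),
          heq _ (TAlg.mul_unit_mem_low (TAlg.low_mono (by omega) ha) _)]
    exact hr.apply_eq_zero q
  · rw [LinearMap.mem_ker, hl'1, hν, h2 s hs, mk_comp_of_mem_relFilt hs, map_zero, add_zero]
    rfl

/-- Suppose an element of `relFilt J (n + 1)` of degree at most `n` were not in `relFilt J n`. Some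
functional would kill `relFilt J n` but not this element; its extension killing `relFilt J (n + 1)`
agrees with it in degrees at most `n`, a contradiction. The extension at each stage uses the
previous case, and the induction starts from `J ∩ F_1 = 0`. -/
lemma relFilt_inf_low_le (hJ : IsNonhomKoszul J) (n : ℕ) :
    relFilt J (n + 1) ⊓ TAlg.low k E (n + 1) ≤ relFilt J n := by
  induction n using Nat.strong_induction_on with
  | h n ih =>
    match n with
    | 0 => exact fun t ht => ht.1
    | 1 =>
      rintro t ⟨h1, h2⟩
      obtain ⟨w, x, r, rfl⟩ := TAlg.exists_of_mem_filt_two (t := t)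
        (TAlg.mem_filt_iff.2 fun m hm => h2 m (by omega))
      have hw : TAlg.m2 k E w = 0 := by
        have := h2 2 le_rfl
        rwa [map_add, map_add, TAlg.comp_of_mem (m2_mem w), TAlg.comp_succ_unit,
          ← one_mul (TAlg.ι k E x), TAlg.comp_succ_mul_ι, ← map_one (TAlg.unit k E),
          TAlg.comp_succ_unit, zero_mul, add_zero, add_zero] at this
      have h3 := relFilt_le_ideal _ h1
      rw [hw, zero_add] at h3 ⊢
      obtain ⟨rfl, rfl⟩ := hJ.injective x r h3
      rw [map_zero, map_zero, add_zero]
      exact zero_mem _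
    | n + 2 =>
      rintro t ⟨h1, h2⟩
      by_contra ht
      obtain ⟨l, hl, hlt⟩ := exists_functional_ne_zero (k := k) _ ht
      obtain ⟨l', hl', hl''⟩ := exists_extension_relFilt hJ (ih (n + 1) (by omega)) l hl
      exact hlt (by rw [← hl' t h2, hl'' t h1])

/-- The Poincaré–Birkhoff–Witt property: leading terms of elements of `J` are relations of the
associated quadratic algebra. -/
lemma comp_mem_quadIdeal_of_mem (hJ : IsNonhomKoszul J) {n : ℕ} {t : TAlg k E} (ht : t ∈ J)
    (h : t ∈ TAlg.low k E (n + 1)) : TAlg.comp n t ∈ quadIdeal (relSpace J) := by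
  obtain ⟨N, hN⟩ := exists_mem_relFilt hJ.toIsNonhomQuadratic ht
  -- The element lies in some step of the filtration; as its degree is at most `n`, it descends one
  -- step at a time to step `n`.
  have hd : ∀ m, t ∈ relFilt J (n + m) → t ∈ relFilt J n := by
    intro m
    induction m with
    | zero => exact id
    | succ m ih => exact fun hm => ih (relFilt_inf_low_le hJ (n + m)
        ⟨hm, TAlg.low_mono (by omega) h⟩)
  exact (QAlg.mk_eq_zero_iff _).1 (mk_comp_of_mem_relFilt
    (hd N (relFilt_mono (Nat.le_add_left N n) hN)))

end PBW

/-! ## Exactness for graded injective modules -/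

section Factor

variable {Λ : Type u} [Ring Λ] {𝒜 : ℕ → AddSubgroup Λ}

/-- The range of a morphism of graded modules. -/
noncomputable def GrMod.rangeGr {X Y : GrMod 𝒜} (f : X.carrier →ₗ[Λ] Y.carrier)
    (hf : GrMod.IsGraded f) : GrMod 𝒜 where
  carrier := LinearMap.range f
  deg j := (Y.deg j).comap (LinearMap.range f).subtype.toAddMonoidHom
  isInternal := by
    have h : ∀ j, ∀ z ∈ LinearMap.range f, Y.comp j z ∈ LinearMap.range f := by
      rintro j _ ⟨x, rfl⟩
      exact ⟨_, hf.map_comp j x⟩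
    refine isInternal_of_proj _ (fun j => AddMonoidHom.mk' (fun z => ⟨Y.comp j z.1, h j _ z.2⟩)
      (fun z z' => Subtype.ext (map_add _ _ _))) ?_ ?_ ?_
    · exact fun n z hz => Subtype.ext (Y.comp_of_mem hz)
    · exact fun n m hnm z hz => Subtype.ext (Y.comp_of_mem_ne hz hnm)
    · rintro ⟨_, x, rfl⟩
      induction x using X.induction with
      | mem j m hm => exact AddSubgroup.mem_iSup_of_mem j (hf j m hm)
      | add m m' h h' =>
        have := add_mem h h'
        convert this using 1
        exact Subtype.ext (map_add f m m')
  smul_mem ha hm := Y.smul_mem ha hm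

/-- Injectivity along a map that is not injective: `g` factors through the range of `f`, a graded
submodule of `Y`, and extends from there. -/
lemma GrMod.IsInjective.exists_factor {I X Y : GrMod 𝒜} (hI : I.IsInjective)
    (f : X.carrier →ₗ[Λ] Y.carrier) (g : X.carrier →ₗ[Λ] I.carrier) (hf : GrMod.IsGraded f)
    (hg : GrMod.IsGraded g) (hker : LinearMap.ker f ≤ LinearMap.ker g) :
    ∃ h : Y.carrier →ₗ[Λ] I.carrier, GrMod.IsGraded h ∧ ∀ x, h (f x) = g x := by
  let g' : LinearMap.range f →ₗ[Λ] I.carrier :=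
    (LinearMap.ker f).liftQ g hker ∘ₗ f.quotKerEquivRange.symm.toLinearMap
  have hg' : ∀ x hx, g' ⟨f x, hx⟩ = g x := by
    intro x hx
    have : f.quotKerEquivRange.symm ⟨f x, hx⟩ = Submodule.Quotient.mk x := by
      rw [LinearEquiv.symm_apply_eq]
      rfl
    change (LinearMap.ker f).liftQ g hker (f.quotKerEquivRange.symm ⟨f x, hx⟩) = _
    rw [this]
    exact Submodule.liftQ_apply _ _ _
  obtain ⟨h, h1, h2⟩ := hI (GrMod.rangeGr f hf) Y (LinearMap.range f).subtype g'
    (fun j m hm => hm) Subtype.val_injective (by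
      rintro j ⟨_, x, rfl⟩ hm
      change f x ∈ Y.deg j at hm
      have h3 : (⟨f x, x, rfl⟩ : LinearMap.range f) = ⟨f (X.comp j x), X.comp j x, rfl⟩ :=
        Subtype.ext ((Y.comp_of_mem hm).symm.trans (hf.map_comp j x).symm)
      have h4 : g' ⟨f x, x, rfl⟩ = g (X.comp j x) := (congrArg g' h3).trans (hg' _ _)
      exact (congrArg (· ∈ I.deg j) h4).mpr (hg j _ (X.comp_mem j x)))
  exact ⟨h, h1, fun x => (LinearMap.congr_fun h2 ⟨f x, x, rfl⟩).trans (hg' x _)⟩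

end Factor

/-! ### The complex of graded modules `Hom_{-k}(A_j, A^!)` -/

section HomModules

variable {k E : Type u} [Ring k] [AddCommGroup E] [Module k E] [Module kᵐᵒᵖ E]
  [SMulCommClass k kᵐᵒᵖ E] {J : TwoSidedIdeal (TAlg k E)}

namespace KDual

lemma comp_mul_of_mem {p : ℕ} {a : KDual J} (ha : a ∈ KDual.deg J p) (n : ℕ) (b : KDual J) :
    comp (n + p) (a * b) = a * comp n b := QAlg.comp_mul_of_mem (Q := perp (relSpace J)) ha n b

lemma comp_mul_of_mem_of_lt {p n : ℕ} {a : KDual J} (ha : a ∈ KDual.deg J p) (h : n < p)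
    (b : KDual J) : comp n (a * b) = 0 :=
  QAlg.comp_mul_of_mem_of_lt (Q := perp (relSpace J)) ha h b

lemma comp_comp (n : ℕ) (b : KDual J) : comp n (comp n b) = comp n b :=
  comp_of_mem (comp_mem n b)

lemma comp_comp_ne {n m : ℕ} (h : n ≠ m) (b : KDual J) : comp n (comp m b) = 0 :=
  comp_of_mem_ne (comp_mem m b) h

/-- Multiplication by `b` raises degrees by at most the degree of `b`, which keeps boundedness of
values stable under the module structure. -/
lemma exists_bound (b : KDual J) {N : ℕ} : ∃ M, ∀ x : KDual J, (∀ n ≥ N, comp n x = 0) →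
    ∀ n ≥ M, comp n (b * x) = 0 := by
  obtain ⟨B, -, hb⟩ := exists_sum_comp b
  refine ⟨N + B, fun x hx n hn => ?_⟩
  rw [hb, Finset.sum_mul, map_sum]
  refine Finset.sum_eq_zero fun p hp => ?_
  have := Finset.mem_range.1 hp
  obtain ⟨m, rfl⟩ : ∃ m, n = m + p := ⟨n - p, by omega⟩
  rw [comp_mul_of_mem (comp_mem p b), hx m (by omega), mul_zero]

end KDual

/-- The right `k`-linear maps `A_j → A^!` with bounded values. -/
noncomputable def homSub (J : TwoSidedIdeal (TAlg k E)) (j : ℕ) :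
    Submodule (KDual J) (Assoc J →+ KDual J) where
  carrier := {ψ | (∀ a r, ψ (a * Assoc.unit J r) = ψ a * KDual.unit J r) ∧
    (∀ a, ψ (QAlg.comp j a) = ψ a) ∧ ∃ N, ∀ a, ∀ n ≥ N, KDual.comp n (ψ a) = 0}
  zero_mem' := ⟨fun _ _ => (zero_mul _).symm, fun _ => rfl, 0, fun _ _ _ => map_zero _⟩
  add_mem' := by
    rintro ψ φ ⟨h1, h2, N, h3⟩ ⟨h1', h2', N', h3'⟩
    refine ⟨fun a r => ?_, fun a => ?_, max N N', fun a n hn => ?_⟩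
    · rw [AddMonoidHom.add_apply, h1, h1', AddMonoidHom.add_apply, add_mul]
    · rw [AddMonoidHom.add_apply, h2, h2', AddMonoidHom.add_apply]
    · rw [AddMonoidHom.add_apply, map_add, h3 _ _ (le_trans (le_max_left _ _) hn),
        h3' _ _ (le_trans (le_max_right _ _) hn), add_zero]
  smul_mem' := by
    rintro b ψ ⟨h1, h2, N, h3⟩
    obtain ⟨M, hM⟩ := KDual.exists_bound b (N := N)
    refine ⟨fun a r => ?_, fun a => ?_, M, fun a => hM _ (h3 a)⟩
    · change b * ψ _ = b * ψ _ * _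
      rw [h1, mul_assoc]
    · change b * ψ _ = b * ψ _
      rw [h2]

namespace homSub

variable {j : ℕ}

lemma mem_iff {ψ : Assoc J →+ KDual J} : ψ ∈ homSub J j ↔
    (∀ a r, ψ (a * Assoc.unit J r) = ψ a * KDual.unit J r) ∧
    (∀ a, ψ (QAlg.comp j a) = ψ a) ∧ ∃ N, ∀ a, ∀ n ≥ N, KDual.comp n (ψ a) = 0 := Iff.rfl

lemma map_mul_unit (ψ : homSub J j) (a : Assoc J) (r : k) :
    ψ.1 (a * Assoc.unit J r) = ψ.1 a * KDual.unit J r := (mem_iff.1 ψ.2).1 a r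

lemma map_comp (ψ : homSub J j) (a : Assoc J) : ψ.1 (QAlg.comp j a) = ψ.1 a :=
  (mem_iff.1 ψ.2).2.1 a

lemma exists_bound (ψ : homSub J j) : ∃ N, ∀ a, ∀ n ≥ N, KDual.comp n (ψ.1 a) = 0 :=
  (mem_iff.1 ψ.2).2.2

lemma mk_comp (n : ℕ) (ψ : homSub J j) : (KDual.comp n).comp ψ.1 ∈ homSub J j := by
  have h3 : ∀ a, ∀ m ≥ n + 1, KDual.comp m (KDual.comp n (ψ.1 a)) = 0 := fun a m hm =>
    KDual.comp_comp_ne (by omega) _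
  have h1 : ∀ a r, KDual.comp n (ψ.1 (a * Assoc.unit J r))
      = KDual.comp n (ψ.1 a) * KDual.unit J r := fun a r => by
    rw [map_mul_unit, KDual.comp_mul_unit]
  have h2 : ∀ a, KDual.comp n (ψ.1 (QAlg.comp j a)) = KDual.comp n (ψ.1 a) := fun a => by
    rw [map_comp]
  exact mem_iff.2 ⟨h1, h2, n + 1, h3⟩

/-- The components of an element of `homSub`. -/
noncomputable def comp (n : ℕ) : homSub J j →+ homSub J j :=
  AddMonoidHom.mk' (fun ψ => ⟨(KDual.comp n).comp ψ.1, mk_comp n ψ⟩)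
    (fun ψ φ => Subtype.ext (AddMonoidHom.ext fun a => map_add (KDual.comp n) (ψ.1 a) (φ.1 a)))

lemma comp_apply (n : ℕ) (ψ : homSub J j) (a : Assoc J) :
    (comp n ψ).1 a = KDual.comp n (ψ.1 a) := rfl

lemma ext {ψ φ : homSub J j} (h : ∀ a, ψ.1 a = φ.1 a) : ψ = φ :=
  Subtype.ext (AddMonoidHom.ext h)

lemma sum_apply {ι : Type*} (s : Finset ι) (ψ : ι → homSub J j) (a : Assoc J) :
    (∑ i ∈ s, ψ i).1 a = ∑ i ∈ s, (ψ i).1 a :=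
  map_sum (AddMonoidHom.mk' (fun ψ : homSub J j => ψ.1 a) (fun _ _ => rfl)) ψ s

/-- A uniform bound on the degrees of the values makes the sum of components finite, so that the
module is a direct sum of its pieces. -/
lemma exists_sum_comp (ψ : homSub J j) :
    ∃ M, (∀ n ≥ M, comp n ψ = 0) ∧ ψ = ∑ n ∈ Finset.range M, comp n ψ := by
  obtain ⟨M, hM⟩ := exists_bound ψ
  refine ⟨M, fun n hn => ext fun a => hM a n hn, ext fun a => ?_⟩
  obtain ⟨N, hN, hN'⟩ := KDual.exists_sum_comp (ψ.1 a)
  rw [sum_apply]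
  change _ = ∑ n ∈ Finset.range M, KDual.comp n (ψ.1 a)
  conv_lhs => rw [hN']
  rcases le_total M N with h | h
  · exact (Finset.sum_subset (Finset.range_mono h) fun n _ hn =>
      hM a n (by simpa using hn)).symm
  · exact Finset.sum_subset (Finset.range_mono h) fun n _ hn => hN n (by simpa using hn)

lemma comp_comp_ne {n m : ℕ} (h : n ≠ m) (ψ : homSub J j) : comp n (comp m ψ) = 0 :=
  ext fun a => by
    rw [comp_apply, comp_apply, KDual.comp_comp_ne h]
    rfl

end homSub

/-- The graded `A^!`-module of right `k`-linear maps `A_j → A^!`, shifted by `s`. -/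
noncomputable def homGr (J : TwoSidedIdeal (TAlg k E)) (j : ℕ) (s : ℤ) :
    GrMod (KDual.deg J) where
  carrier := homSub J j
  deg q :=
    { carrier := {ψ | ∀ m : ℕ, (m : ℤ) + s ≠ q → homSub.comp m ψ = 0}
      zero_mem' := fun m _ => map_zero _
      add_mem' := fun hx hy m hm => by rw [map_add, hx m hm, hy m hm, add_zero]
      neg_mem' := fun hx m hm =>
        AddMonoidHom.mem_ker.1 (neg_mem (AddMonoidHom.mem_ker.2 (hx m hm))) }
  isInternal := by
    have hmem : ∀ (m : ℕ) (x : homSub J j) (m' : ℕ),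
        (m' : ℤ) + s ≠ m + s → homSub.comp m' (homSub.comp m x) = 0 := fun m x m' h =>
      homSub.comp_comp_ne (by rintro rfl; exact h rfl) x
    refine isInternal_of_proj _ (fun n => if s ≤ n then homSub.comp (n - s).toNat else 0)
      ?_ ?_ ?_
    · intro n x hx
      obtain ⟨M, hM, hsum⟩ := homSub.exists_sum_comp x
      split_ifs with h
      · conv_rhs => rw [hsum]
        by_cases hn : (n - s).toNat < M
        · rw [Finset.sum_eq_single_of_mem _ (Finset.mem_range.2 hn)]
          intro m _ hm
          exact hx m (by omega)
        · rw [hM _ (by omega)]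
          refine (Finset.sum_eq_zero fun m hm => hx m ?_).symm
          have := Finset.mem_range.1 hm
          omega
      · rw [hsum]
        exact (Finset.sum_eq_zero fun m _ => hx m (by omega)).symm
    · intro n m hnm x hx
      split_ifs with h
      · exact hx _ (by omega)
      · rfl
    · intro x
      obtain ⟨M, -, hsum⟩ := homSub.exists_sum_comp x
      rw [hsum]
      exact sum_mem fun m _ => AddSubgroup.mem_iSup_of_mem ((m : ℤ) + s) (hmem m x)
  smul_mem {p q b x} hb hx m hm := by
    refine homSub.ext fun a => ?_
    change KDual.comp m (b * x.1 a) = 0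
    by_cases h : m < p
    · exact KDual.comp_mul_of_mem_of_lt hb h _
    · obtain ⟨n, rfl⟩ : ∃ n, m = n + p := ⟨m - p, by omega⟩
      have h0 : KDual.comp n (x.1 a) = 0 :=
        congrArg (fun ψ : homSub J j => ψ.1 a) (hx n (by push_cast at hm; omega))
      rw [KDual.comp_mul_of_mem hb, h0, mul_zero]

lemma homGr_mem_iff {j : ℕ} {s q : ℤ} {ψ : homSub J j} :
    ψ ∈ (homGr J j s).deg q ↔ ∀ m : ℕ, (m : ℤ) + s ≠ q → ∀ a, KDual.comp m (ψ.1 a) = 0 :=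
  ⟨fun h m hm a => congrArg (fun ψ : homSub J j => ψ.1 a) (h m hm),
    fun h m hm => homSub.ext fun a => h m hm a⟩

variable [IsSemisimpleRing k] [Module.Finite kᵐᵒᵖ E]

/-- The map `ψ ↦ (a ↦ ∑ ψ(a x_b) x̂_b)`. -/
noncomputable def homD (J : TwoSidedIdeal (TAlg k E)) (j : ℕ) :
    homSub J (j + 1) →ₗ[KDual J] homSub J j where
  toFun ψ := ⟨∑ b, (AddMonoidHom.mulRight (KDual.ι J (coevDual k E b))).comp
      (ψ.1.comp (AddMonoidHom.mulRight (Assoc.ι J (coevVec k E b)))), by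
    have happ : ∀ a, (∑ b, (AddMonoidHom.mulRight (KDual.ι J (coevDual k E b))).comp
      (ψ.1.comp (AddMonoidHom.mulRight (Assoc.ι J (coevVec k E b))))) a
        = ∑ b, ψ.1 (a * Assoc.ι J (coevVec k E b)) * KDual.ι J (coevDual k E b) := fun a =>
      AddMonoidHom.finsetSum_apply _ _ _
    obtain ⟨N, hN⟩ := homSub.exists_bound ψ
    refine ⟨fun a r => ?_, fun a => ?_, N + 1, fun a n hn => ?_⟩
    · rw [happ, happ, Finset.sum_mul]
      let G : E →+ RDual k E →+ KDual J := AddMonoidHom.mk' (fun x =>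
        (AddMonoidHom.mulLeft (ψ.1 (a * Assoc.ι J x))).comp (KDual.ι J)) (fun x y => by
          ext f
          simp [mul_add, add_mul])
      have hG := coev_move G (fun e s f => by
        change ψ.1 (a * Assoc.ι J _) * KDual.ι J f = ψ.1 (a * Assoc.ι J _) * KDual.ι J _
        rw [QAlg.ι_op_smul, ← mul_assoc, homSub.map_mul_unit, QAlg.ι_smul, mul_assoc]) r
      refine (Finset.sum_congr rfl fun b _ => ?_).trans (hG.trans
        (Finset.sum_congr rfl fun b _ => ?_))
      · change _ = ψ.1 (a * Assoc.ι J _) * KDual.ι J _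
        rw [QAlg.ι_smul, mul_assoc]
      · change ψ.1 (a * Assoc.ι J _) * KDual.ι J _ = _
        rw [QAlg.ι_op_smul, mul_assoc]
    · rw [happ, happ]
      refine Finset.sum_congr rfl fun b _ => ?_
      rw [← QAlg.comp_succ_mul_ι, homSub.map_comp]
    · rw [happ, map_sum]
      refine Finset.sum_eq_zero fun b _ => ?_
      obtain ⟨m, rfl⟩ : ∃ m, n = m + 1 := ⟨n - 1, by omega⟩
      rw [KDual.comp_succ_mul_ι, hN _ m (by omega), zero_mul]⟩
  map_add' ψ φ := Subtype.ext (by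
    ext a
    simp [AddMonoidHom.finsetSum_apply, add_mul, Finset.sum_add_distrib])
  map_smul' c ψ := Subtype.ext (by
    ext a
    simp [AddMonoidHom.finsetSum_apply, Finset.mul_sum, mul_assoc])

lemma homD_apply {j : ℕ} (ψ : homSub J (j + 1)) (a : Assoc J) :
    (homD J j ψ).1 a
      = ∑ b, ψ.1 (a * Assoc.ι J (coevVec k E b)) * KDual.ι J (coevDual k E b) :=
  AddMonoidHom.finsetSum_apply _ _ _

/-- Right multiplication by `x̂_b` raises the degree in `A^!` by one; the shift by `s + 1` on the
source makes the map homogeneous of degree zero. -/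
lemma homD_isGraded (j : ℕ) (s : ℤ) :
    GrMod.IsGraded (M := homGr J (j + 1) (s + 1)) (N := homGr J j s) (homD J j) := by
  intro q (ψ : homSub J (j + 1)) hψ
  have key : ∀ m : ℕ, (m : ℤ) + s ≠ q → ∀ a, KDual.comp m ((homD J j ψ).1 a) = 0 := by
    intro m hm a
    rw [homD_apply, map_sum]
    refine Finset.sum_eq_zero fun b _ => ?_
    cases m with
    | zero => exact KDual.comp_zero_mul_ι _ _
    | succ m =>
      rw [KDual.comp_succ_mul_ι, homGr_mem_iff.1 hψ m (by push_cast at hm; omega), zero_mul]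
  exact homGr_mem_iff.2 key

/-- The complex of the modules `homSub J j` is exact for `j ≥ 1`. -/
lemma exists_homD_eq (hK : IsKoszul (QAlg.deg (quadIdeal (relSpace J)))) {j : ℕ}
    (ψ : homSub J (j + 1)) (hψ : homD J j ψ = 0) : ∃ φ, homD J (j + 1) φ = ψ := by
  have hD : ∀ n a, ∑ b, KDual.comp n (ψ.1 (a * Assoc.ι J (coevVec k E b))) *
      KDual.ι J (coevDual k E b) = 0 := by
    intro n a
    have h : KDual.comp (n + 1) ((homD J j ψ).1 a) = 0 := by
      rw [hψ]
      exact map_zero _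
    rw [homD_apply, map_sum] at h
    simpa only [KDual.comp_succ_mul_ι] using h
  -- Exactness is available only for values in positive degrees of `A^!`. The degree zero part of a
  -- cocycle vanishes by itself: it kills each `a x`, as seen by evaluating the cocycle identity at
  -- `x`, and such products span `A_{j+1}`.
  have h0 : homSub.comp 0 ψ = 0 := by
    have h1 : ∀ a x, KDual.aug J (ψ.1 (a * Assoc.ι J x)) = 0 := by
      intro a x
      have h2 : ∑ b, KDual.aug J (ψ.1 (a * Assoc.ι J (coevVec k E b))) • coevDual k E b = 0 := by
        have h3 := congrArg (KDual.pr J) (hD 0 a)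
        simpa only [KDual.comp_zero_eq, map_sum, KDual.pr_mul_ι, KDual.aug_unit, map_zero] using h3
      have h4 := congrArg (fun f : RDual k E => f x) h2
      simp only [RDual.sum_apply, RDual.zero_apply] at h4
      rw [← h4]
      conv_lhs => rw [coev_spec k x, map_sum, Finset.mul_sum, map_sum, map_sum]
      refine Finset.sum_congr rfl fun b _ => ?_
      rw [QAlg.ι_op_smul, ← mul_assoc, homSub.map_mul_unit, _root_.map_mul (KDual.aug J), KDual.aug_unit]
    refine homSub.ext fun a => ?_
    rw [homSub.comp_apply, KDual.comp_zero_eq]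
    change KDual.unit J _ = 0
    rw [← homSub.map_comp]
    suffices h : KDual.aug J (ψ.1 (QAlg.comp (j + 1) a)) = 0 by rw [h, map_zero]
    induction a using QAlg.induction_right with
    | unit r => rw [QAlg.comp_succ_unit, map_zero, map_zero]
    | add a b ha hb => rw [map_add, map_add, map_add, ha, hb, add_zero]
    | mul_ι a x _ => rw [QAlg.comp_succ_mul_ι, h1]
  -- Each component has a primitive on all of `A`; composing with the projection to degree `j + 2`
  -- makes it an element of `homSub` without affecting the identity on `A_{j+1}`.
  have hsucc : ∀ n, ∃ φ, homD J (j + 1) φ = homSub.comp (n + 1) ψ := by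
    intro n
    obtain ⟨φ, h1, h2, h3⟩ := exists_of_cocycle hK (i := n) (homSub.comp (n + 1) ψ).1
      (homSub.comp (n + 1) ψ).2.1
      (fun a => by rw [homSub.comp_apply, KDual.comp_comp]) (hD (n + 1))
    refine ⟨⟨φ.comp (QAlg.comp (j + 1 + 1)), fun a r => ?_, fun a => ?_, n + 1, fun a m hm => ?_⟩,
      homSub.ext fun a => ?_⟩
    · change φ (QAlg.comp _ _) = φ (QAlg.comp _ _) * _
      rw [QAlg.comp_mul_unit, h1]
    · change φ (QAlg.comp _ (QAlg.comp _ a)) = φ (QAlg.comp _ a)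
      rw [QAlg.comp_of_mem (QAlg.comp_mem _ a)]
    · change KDual.comp m (φ _) = 0
      rw [← h2, KDual.comp_comp_ne (by omega)]
    · rw [homD_apply, ← (homSub.comp (n + 1) ψ).2.2.1, ← h3]
      refine Finset.sum_congr rfl fun b _ => ?_
      change φ (QAlg.comp (j + 1 + 1) _) * _ = _
      rw [QAlg.comp_succ_mul_ι]
  choose φ hφ using hsucc
  obtain ⟨M, hM, h⟩ := homSub.exists_sum_comp ψ
  have h' : ψ = ∑ n ∈ Finset.range (M + 1), homSub.comp n ψ := by
    rw [Finset.sum_range_succ, hM M le_rfl, add_zero]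
    exact h
  refine ⟨∑ n ∈ Finset.range M, φ n, ?_⟩
  rw [map_sum, Finset.sum_congr rfl fun n _ => hφ n]
  rw [Finset.sum_range_succ', h0, add_zero] at h'
  exact h'.symm

end HomModules

/-! ## The Koszul complex of a graded injective module -/

section KoszulInjective

variable {k E : Type u} [Ring k] [AddCommGroup E] [Module k E] [Module kᵐᵒᵖ E]
  [SMulCommClass k kᵐᵒᵖ E] {J : TwoSidedIdeal (TAlg k E)}

namespace Assoc

/-- The degree `j` piece of `A` as a right `k`-module. -/
noncomputable def piece (J : TwoSidedIdeal (TAlg k E)) (j : ℕ) : Submodule kᵐᵒᵖ (Assoc J) where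
  __ := QAlg.deg (quadIdeal (relSpace J)) j
  smul_mem' r a ha := by
    induction r using MulOpposite.rec' with
    | h r =>
      change MulOpposite.op r • a ∈ QAlg.deg (quadIdeal (relSpace J)) j
      rw [QAlg.op_smul_def]
      exact QAlg.mul_unit_mem ha r

lemma mem_piece {j : ℕ} {a : Assoc J} :
    a ∈ piece J j ↔ a ∈ QAlg.deg (quadIdeal (relSpace J)) j := Iff.rfl

variable [IsSemisimpleRing k] [Module.Finite kᵐᵒᵖ E]

lemma exists_dualBasis_of_fg {j : ℕ} (h : (piece J j).FG) :
    ∃ (n : ℕ) (x : Fin n → Assoc J) (f : Fin n → Assoc J →+ k),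
      (∀ s a r, f s (a * unit J r) = f s a * r) ∧ (∀ s a, f s (QAlg.comp j a) = f s a) ∧
      (∀ s, x s ∈ QAlg.deg (quadIdeal (relSpace J)) j) ∧
      ∀ a, QAlg.comp j a = ∑ s, x s * unit J (f s a) := by
  have := Module.Finite.iff_fg.2 h
  obtain ⟨n, x, f, hx⟩ := NHKoszul.exists_dualBasis k (piece J j)
  let p : Assoc J →+ piece J j := AddMonoidHom.mk' (fun a => ⟨QAlg.comp j a, QAlg.comp_mem j a⟩)
    (fun a b => Subtype.ext (map_add (QAlg.comp j) a b))
  let f' : Fin n → Assoc J →+ k := fun s => AddMonoidHom.mk' (fun a => f s (p a))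
    (fun a b => by rw [map_add, map_add])
  refine ⟨n, fun s => (x s).1, f', fun s a r => ?_, fun s a => ?_, fun s => (x s).2, fun a => ?_⟩
  · change f s (p (a * unit J r)) = f s (p a) * r
    rw [← RDual.map_op_smul]
    congr 1
    exact Subtype.ext (QAlg.comp_mul_unit j a r)
  · change f s (p (QAlg.comp j a)) = f s (p a)
    congr 1
    exact Subtype.ext (QAlg.comp_of_mem (QAlg.comp_mem j a))
  · exact (congrArg (piece J j).subtype (hx (p a))).trans (map_sum _ _ _)

/-- If the `x_s` generate `A_j` on the right, the products `x_s x_b` generate `A_{j+1}`: scalars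
produced between the factors are absorbed into `E` and then moved to the right by coevaluation. -/
lemma piece_fg (j : ℕ) : (piece J j).FG := by
  induction j with
  | zero =>
    have : piece J 0 = Submodule.span kᵐᵒᵖ {1} := by
      refine le_antisymm (fun a ha => ?_) (Submodule.span_le.2 ?_)
      · rw [← QAlg.comp_of_mem (mem_piece.1 ha), QAlg.comp_zero_eq, ← one_mul (QAlg.unit _ _),
          ← QAlg.op_smul_def]
        exact Submodule.smul_mem _ _ (Submodule.subset_span rfl)
      · rintro _ rfl
        change (1 : Assoc J) ∈ QAlg.deg (quadIdeal (relSpace J)) 0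
        rw [← map_one (QAlg.unit (quadIdeal (relSpace J)))]
        exact QAlg.unit_mem 1
    rw [this]
    exact Submodule.fg_span_singleton 1
  | succ j ih =>
    obtain ⟨n, x, f, -, -, h3, h4⟩ := exists_dualBasis_of_fg ih
    refine ⟨(Set.finite_range fun q : Fin n × Fin (coevCard k E) =>
      x q.1 * ι J (coevVec k E q.2)).toFinset, ?_⟩
    rw [Set.Finite.coe_toFinset]
    refine le_antisymm (Submodule.span_le.2 ?_) (fun a ha => ?_)
    · rintro _ ⟨q, rfl⟩
      exact QAlg.mul_ι_mem (h3 _) _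
    · rw [← QAlg.comp_of_mem (mem_piece.1 ha)]
      clear ha
      induction a using QAlg.induction_right with
      | unit r => rw [QAlg.comp_succ_unit]; exact zero_mem _
      | add a b ha hb => rw [map_add]; exact add_mem ha hb
      | mul_ι a y _ =>
        rw [QAlg.comp_succ_mul_ι, h4, Finset.sum_mul]
        refine sum_mem fun s _ => ?_
        rw [mul_assoc, ← QAlg.ι_smul, coev_spec k (f s a • y), map_sum, Finset.mul_sum]
        refine sum_mem fun b _ => ?_
        rw [QAlg.ι_op_smul, ← mul_assoc, ← QAlg.op_smul_def]
        exact Submodule.smul_mem _ _ (Submodule.subset_span ⟨(s, b), rfl⟩)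

lemma exists_dualBasis (J : TwoSidedIdeal (TAlg k E)) (j : ℕ) :
    ∃ (n : ℕ) (x : Fin n → Assoc J) (f : Fin n → Assoc J →+ k),
      (∀ s a r, f s (a * unit J r) = f s a * r) ∧ (∀ s a, f s (QAlg.comp j a) = f s a) ∧
      (∀ s, x s ∈ QAlg.deg (quadIdeal (relSpace J)) j) ∧
      ∀ a, QAlg.comp j a = ∑ s, x s * unit J (f s a) :=
  exists_dualBasis_of_fg (piece_fg j)

end Assoc

/-- The element of `homSub` given by a right linear functional on `A_j`. -/
noncomputable def homSub.ofFunctional {j : ℕ} (f : Assoc J →+ k)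
    (h1 : ∀ a r, f (a * Assoc.unit J r) = f a * r) (h2 : ∀ a, f (QAlg.comp j a) = f a) :
    homSub J j :=
  ⟨(KDual.unit J).toAddMonoidHom.comp f, homSub.mem_iff.2
    ⟨fun a r => (congrArg (KDual.unit J) (h1 a r)).trans (_root_.map_mul (KDual.unit J) _ _),
      fun a => congrArg (KDual.unit J) (h2 a), 1, fun a n hn => by
        obtain ⟨m, rfl⟩ : ∃ m, n = m + 1 := ⟨n - 1, by omega⟩
        exact KDual.comp_succ_unit m _⟩⟩

variable {I : GrMod (KDual.deg J)} {n : ℤ} {j : ℕ}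

/-- The map `A ⊗ I^n → I`, `a ⊗ m ↦ ψ(a) m`. -/
noncomputable def evalHom (I : GrMod (KDual.deg J)) (n : ℤ) (ψ : homSub J j) :
    BTensor k (Assoc J) (I.deg n) →+ I.carrier :=
  BTensor.lift
    (AddMonoidHom.mk' (fun a => (DistribSMul.toAddMonoidHom I.carrier (ψ.1 a)).comp
      (I.deg n).subtype) (fun a b => by
        ext m
        change ψ.1 (a + b) • m.1 = ψ.1 a • m.1 + ψ.1 b • m.1
        rw [map_add, add_smul]))
    (fun a r m => by
      change ψ.1 (a * Assoc.unit J r) • m.1 = ψ.1 a • (r • m : I.deg n).1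
      rw [homSub.map_mul_unit, mul_smul, GrMod.coe_smul])

lemma evalHom_tmul (ψ : homSub J j) (a : Assoc J) (m : I.deg n) :
    evalHom I n ψ (tmul k a m) = ψ.1 a • m.1 := rfl

lemma evalHom_add (ψ φ : homSub J j) (w : BTensor k (Assoc J) (I.deg n)) :
    evalHom I n (ψ + φ) w = evalHom I n ψ w + evalHom I n φ w := by
  induction w using BTensor.induction_on with
  | h0 => simp
  | ha x y hx hy => rw [map_add, map_add, map_add, hx, hy, add_add_add_comm]
  | ht a m => exact add_smul (ψ.1 a) (φ.1 a) m.1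

lemma evalHom_smul (b : KDual J) (ψ : homSub J j) (w : BTensor k (Assoc J) (I.deg n)) :
    evalHom I n (b • ψ) w = b • evalHom I n ψ w := by
  induction w using BTensor.induction_on with
  | h0 => simp
  | ha x y hx hy => rw [map_add, map_add, smul_add, hx, hy]
  | ht a m => exact mul_smul b (ψ.1 a) m.1

lemma evalHom_mem {ψ : homSub J j} {q : ℤ} (hψ : ψ ∈ (homGr J j n).deg q)
    (w : BTensor k (Assoc J) (I.deg n)) : evalHom I n ψ w ∈ I.deg q := by
  induction w using BTensor.induction_on with
  | h0 => rw [map_zero]; exact zero_mem _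
  | ha x y hx hy => rw [map_add]; exact add_mem hx hy
  | ht a m =>
    rw [evalHom_tmul]
    obtain ⟨M, -, h⟩ := KDual.exists_sum_comp (ψ.1 a)
    rw [h, Finset.sum_smul]
    refine sum_mem fun p _ => ?_
    by_cases hp : (p : ℤ) + n = q
    · have := I.smul_mem (KDual.comp_mem p (ψ.1 a)) m.2
      rwa [add_comm, hp] at this
    · rw [homGr_mem_iff.1 hψ p hp, zero_smul]
      exact zero_mem _

variable [IsSemisimpleRing k] [Module.Finite kᵐᵒᵖ E]

/-- The Koszul differential `a ⊗ m ↦ ∑ a x_b ⊗ x̂_b m`. -/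
noncomputable def kosI (I : GrMod (KDual.deg J)) (n : ℤ) :
    BTensor k (Assoc J) (I.deg n) →+ BTensor k (Assoc J) (I.deg (n + 1)) :=
  BTensor.lift
    (AddMonoidHom.mk' (fun a => ∑ b, (tmulHom k (a * Assoc.ι J (coevVec k E b))).comp
      (I.act n (coevDual k E b))) (fun a a' => by
        ext m
        simp [AddMonoidHom.finsetSum_apply, add_mul, Finset.sum_add_distrib]))
    (fun a r m => by
      simp only [AddMonoidHom.mk'_apply, AddMonoidHom.finsetSum_apply, AddMonoidHom.comp_apply,
        tmulHom_apply]
      let G : E →+ RDual k E →+ BTensor k (Assoc J) (I.deg (n + 1)) :=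
        AddMonoidHom.mk' (fun x => (tmulHom k (a * Assoc.ι J x)).comp ((I.act n).flip m))
          (fun x y => by ext f; simp [mul_add])
      have hG := coev_move G (fun e s f => by
        change tmul k (a * QAlg.ι _ _) (I.act n f m) = tmul k _ (I.act n (s • f) m)
        rw [QAlg.ι_op_smul, GrMod.smul_act, ← mul_assoc, ← QAlg.op_smul_def, smul_tmul]) r
      refine (Finset.sum_congr rfl fun b _ => ?_).trans (hG.trans
        (Finset.sum_congr rfl fun b _ => ?_))
      · change _ = tmul k (a * QAlg.ι _ _) _
        rw [QAlg.ι_smul, QAlg.op_smul_def, mul_assoc]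
        rfl
      · change tmul k _ (I.act n _ m) = _
        rw [GrMod.act_smul])

lemma kosI_tmul (a : Assoc J) (m : I.deg n) :
    kosI I n (tmul k a m) = ∑ b, tmul k (a * Assoc.ι J (coevVec k E b))
      (I.act n (coevDual k E b) m) := by
  rw [kosI, lift_tmul]
  simp only [AddMonoidHom.mk'_apply, AddMonoidHom.finsetSum_apply, AddMonoidHom.comp_apply,
    tmulHom_apply]

lemma kosI_comp (i : ℕ) (x : BTensor k (Assoc J) (I.deg n)) :
    kosI I n (BTensor.comp i x) = BTensor.comp (i + 1) (kosI I n x) := by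
  induction x using BTensor.induction_on with
  | h0 => simp
  | ha x y hx hy => simp only [map_add, hx, hy]
  | ht a c => simp only [comp_tmul, kosI_tmul, map_sum, QAlg.comp_succ_mul_ι]

/-- The Koszul differential on `A ⊗ I` is the transpose of `homD` under evaluation. -/
lemma evalHom_kosI (ψ : homSub J (j + 1)) (w : BTensor k (Assoc J) (I.deg n)) :
    evalHom I (n + 1) ψ (kosI I n w) = evalHom I n (homD J j ψ) w := by
  induction w using BTensor.induction_on with
  | h0 => simp
  | ha x y hx hy => simp only [map_add, hx, hy]
  | ht a m =>
    rw [kosI_tmul, map_sum, evalHom_tmul, homD_apply, Finset.sum_smul]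
    refine Finset.sum_congr rfl fun b _ => ?_
    rw [evalHom_tmul, GrMod.coe_act, mul_smul]

/-- Functionals on `A_j` followed by `k → A^!` already extract all coordinates with respect to a
dual basis of `A_j`. Hence `A_j ⊗ I^n` embeds in the `A^!`-linear maps `Hom_{-k}(A_j, A^!) → I`. -/
lemma eq_zero_of_evalHom {w : BTensor k (Assoc J) (I.deg n)} (hw : BTensor.comp j w = w)
    (h : ∀ ψ : homSub J j, evalHom I n ψ w = 0) : w = 0 := by
  obtain ⟨N, x, f, h1, h2, -, h4⟩ := Assoc.exists_dualBasis J j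
  let ε (s : Fin N) : BTensor k (Assoc J) (I.deg n) →+ I.deg n :=
    BTensor.lift
      (AddMonoidHom.mk' (fun a => DistribSMul.toAddMonoidHom _ (f s a)) (fun a b => by
        ext m
        simp [add_smul]))
      (fun a r m => by
        change f s (a * Assoc.unit J r) • m = f s a • r • m
        rw [h1, mul_smul])
  have hε : ∀ s w, (ε s w).1 = evalHom I n (homSub.ofFunctional (f s) (h1 s) (h2 s)) w := by
    intro s w
    induction w using BTensor.induction_on with
    | h0 => simp
    | ha x y hx hy => rw [map_add, map_add, ← hx, ← hy]; rfl
    | ht a m => rfl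
  have key : ∀ w, BTensor.comp j w = ∑ s, tmul k (x s) (ε s w) := by
    intro w
    induction w using BTensor.induction_on with
    | h0 => simp [tmul_zero]
    | ha x y hx hy => simp only [map_add, tmul_add, Finset.sum_add_distrib, hx, hy]
    | ht a m =>
      rw [comp_tmul, h4, sum_tmul]
      refine Finset.sum_congr rfl fun s _ => ?_
      rw [← QAlg.op_smul_def, smul_tmul]
      rfl
  rw [← hw, key]
  refine Finset.sum_eq_zero fun s _ => ?_
  rw [show ε s w = 0 from Subtype.ext ((hε s w).trans (h _)), tmul_zero]

/-- Surjectivity onto the graded maps: the dual basis functionals generate `homSub J j` over `A^!`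
and have degree `n` in the shifted module, so their images under `h` lie in `I^n` and are the
coordinates of `y`. -/
lemma exists_evalHom_eq (h : homSub J j →ₗ[KDual J] I.carrier)
    (hh : GrMod.IsGraded (M := homGr J j n) (N := I) h) :
    ∃ y : BTensor k (Assoc J) (I.deg n), BTensor.comp j y = y ∧
      ∀ ψ : homSub J j, evalHom I n ψ y = h ψ := by
  obtain ⟨N, x, f, h1, h2, h3, h4⟩ := Assoc.exists_dualBasis J j
  let φ (s : Fin N) : homSub J j := homSub.ofFunctional (f s) (h1 s) (h2 s)
  have hφ : ∀ s, φ s ∈ (homGr J j n).deg n := fun s => homGr_mem_iff.2 fun m hm a => by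
    obtain ⟨p, rfl⟩ : ∃ p, m = p + 1 := ⟨m - 1, by
      rcases m with _ | m
      · exact absurd (by simp) hm
      · rfl⟩
    exact KDual.comp_succ_unit p _
  refine ⟨∑ s, tmul k (x s) (⟨h (φ s), hh n _ (hφ s)⟩ : I.deg n), ?_, fun ψ => ?_⟩
  · rw [map_sum]
    refine Finset.sum_congr rfl fun s _ => ?_
    rw [comp_tmul, QAlg.comp_of_mem (h3 s)]
  · have h5 : ψ = ∑ s, ψ.1 (x s) • φ s := homSub.ext fun a => by
      rw [homSub.sum_apply, ← homSub.map_comp, h4, map_sum]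
      refine Finset.sum_congr rfl fun s _ => ?_
      rw [homSub.map_mul_unit]
      rfl
    rw [map_sum]
    conv_rhs => rw [h5, map_sum]
    refine Finset.sum_congr rfl fun s _ => ?_
    rw [LinearMap.map_smul]
    rfl

/-- The Koszul complex of an injective graded module is exact in positive degrees. -/
lemma exists_kosI_eq (hK : IsKoszul (QAlg.deg (quadIdeal (relSpace J)))) (hI : I.IsInjective)
    {w : BTensor k (Assoc J) (I.deg (n + 1))} (hw : BTensor.comp (j + 1) w = w)
    (h0 : kosI I (n + 1) w = 0) : ∃ y, BTensor.comp j y = y ∧ kosI I n y = w := by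
  let g : homSub J (j + 1) →ₗ[KDual J] I.carrier :=
    { toFun := fun ψ => evalHom I (n + 1) ψ w
      map_add' := fun ψ φ => evalHom_add ψ φ w
      map_smul' := fun b ψ => evalHom_smul b ψ w }
  -- Evaluation at the cycle `w` kills the range of the preceding `homD`, which is the kernel of the
  -- next one. By injectivity it factors through `homD`, and the factor is evaluation at the
  -- required `y`.
  obtain ⟨h, hh, hg⟩ := hI.exists_factor (X := homGr J (j + 1) (n + 1)) (Y := homGr J j n)
    (homD J j) g (homD_isGraded j n) (fun q ψ hψ => evalHom_mem hψ w) (fun ψ hψ => by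
      obtain ⟨φ, rfl⟩ := exists_homD_eq hK ψ hψ
      change evalHom I (n + 1) (homD J (j + 1) φ) w = 0
      rw [← evalHom_kosI, h0, map_zero])
  obtain ⟨y, hy, hy'⟩ := exists_evalHom_eq h hh
  refine ⟨y, hy, sub_eq_zero.1 (eq_zero_of_evalHom (j := j + 1) ?_ fun ψ => ?_)⟩
  · rw [map_sub, hw, ← kosI_comp, hy]
  · rw [map_sub, evalHom_kosI, hy', sub_eq_zero]
    exact hg ψ

end KoszulInjective

/-! ## The filtration on `U ⊗ I` and its symbols -/

section Filtration

variable {k E : Type u} [Ring k] [AddCommGroup E] [Module k E] [Module kᵐᵒᵖ E]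
  {J : TwoSidedIdeal (TAlg k E)}

/-- The quotient map `T_k(E) → T_k(E)/J` as a right linear map. -/
noncomputable def QAlg.mkLin (J : TwoSidedIdeal (TAlg k E)) : TAlg k E →ₗ[kᵐᵒᵖ] QAlg J where
  toFun := QAlg.mk J
  map_add' := map_add _
  map_smul' r t := by
    induction r using MulOpposite.rec' with
    | h r => exact _root_.map_mul (QAlg.mk J) _ _

/-- All modules over a semisimple ring are projective, so elementwise preimages can be chosen
linearly. -/
lemma exists_lift_of_forall_exists {R A X Y : Type*} [Ring R] [IsSemisimpleRing R]
    [AddCommGroup A] [Module R A] [AddCommGroup X] [Module R X] [AddCommGroup Y] [Module R Y]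
    (f : X →ₗ[R] Y) (g : A →ₗ[R] Y) (h : ∀ a, ∃ x, f x = g a) :
    ∃ g' : A →ₗ[R] X, ∀ a, f (g' a) = g a := by
  have := Module.projective_of_isSemisimpleRing R A
  obtain ⟨g', hg'⟩ := Module.projective_lifting_property f.rangeRestrict
    (g.codRestrict (LinearMap.range f) h) f.surjective_rangeRestrict
  exact ⟨g', fun a => congrArg Subtype.val (LinearMap.congr_fun hg' a)⟩

/-- The filtration `F_{j-1} U ⊗ N`. -/
noncomputable def filtTensor (J : TwoSidedIdeal (TAlg k E)) (N : Type u) [AddCommGroup N]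
    [Module k N] (j : ℕ) : AddSubgroup (BTensor k (QAlg J) N) :=
  AddSubgroup.closure {x | ∃ t ∈ TAlg.low k E j, ∃ n : N, x = tmul k (QAlg.mk J t) n}

variable {N : Type u} [AddCommGroup N] [Module k N]

lemma tmul_mem_filtTensor {j : ℕ} {t : TAlg k E} (ht : t ∈ TAlg.low k E j) (n : N) :
    tmul k (QAlg.mk J t) n ∈ filtTensor J N j := AddSubgroup.subset_closure ⟨t, ht, n, rfl⟩

lemma filtTensor_le {j : ℕ} {H : AddSubgroup (BTensor k (QAlg J) N)}
    (h : ∀ t ∈ TAlg.low k E j, ∀ n, tmul k (QAlg.mk J t) n ∈ H) : filtTensor J N j ≤ H := by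
  rw [filtTensor, AddSubgroup.closure_le]
  rintro _ ⟨t, ht, n, rfl⟩
  exact h t ht n

lemma filtTensor_mono {i j : ℕ} (h : i ≤ j) : filtTensor J N i ≤ filtTensor J N j :=
  filtTensor_le fun _ ht n => tmul_mem_filtTensor (TAlg.low_mono h ht) n

lemma exists_mem_filtTensor (x : BTensor k (QAlg J) N) : ∃ j, x ∈ filtTensor J N (j + 1) := by
  induction x using BTensor.induction_on with
  | h0 => exact ⟨0, zero_mem _⟩
  | ha x y hx hy =>
    obtain ⟨i, hi⟩ := hx
    obtain ⟨j, hj⟩ := hy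
    exact ⟨max i j, add_mem (filtTensor_mono (by omega) hi) (filtTensor_mono (by omega) hj)⟩
  | ht u n =>
    obtain ⟨t, rfl⟩ := QAlg.mk_surjective J u
    obtain ⟨j, hj⟩ := TAlg.exists_mem_low t
    exact ⟨j, tmul_mem_filtTensor (TAlg.low_mono (Nat.le_succ j) hj) n⟩

lemma one_tmul_mem_filtTensor (n : N) : tmul k (1 : QAlg J) n ∈ filtTensor J N 1 := by
  have h := tmul_mem_filtTensor (J := J) (TAlg.unit_mem_low (V := E) (1 : k)) n
  rwa [map_one, map_one] at h

lemma eq_one_tmul_of_mem_filtTensor {x : BTensor k (QAlg J) N} (hx : x ∈ filtTensor J N 1) :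
    ∃ n, x = tmul k 1 n := by
  induction hx using AddSubgroup.closure_induction with
  | zero => exact ⟨0, (tmul_zero k _).symm⟩
  | add x y _ _ hx hy =>
    obtain ⟨n, rfl⟩ := hx
    obtain ⟨m, rfl⟩ := hy
    exact ⟨n + m, (tmul_add k _ _ _).symm⟩
  | neg x _ hx =>
    obtain ⟨n, rfl⟩ := hx
    exact ⟨-n, (map_neg (tmulHom k 1) n).symm⟩
  | mem x hx =>
    obtain ⟨t, ht, n, rfl⟩ := hx
    obtain ⟨r, hr⟩ := (TAlg.comp_low_degrees t).1
    have h : t = TAlg.unit k E r := by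
      rw [← hr, ← sub_eq_zero]
      exact TAlg.eq_zero_of_mem_low_zero (TAlg.sub_comp_mem_low ht)
    refine ⟨r • n, ?_⟩
    rw [← smul_tmul, h, QAlg.op_smul_def, one_mul]
    rfl

variable [SMulCommClass k kᵐᵒᵖ E] [IsSemisimpleRing k] [Module.Finite kᵐᵒᵖ E]

/-- The leading form of degree `j` is well defined on `F_j U` because leading terms of elements of
`J` are homogeneous relations. The extension to all of `U` is arbitrary; only its values on `F_j U`
are used. -/
lemma exists_symbol (hJ : IsNonhomKoszul J) (j : ℕ) :
    ∃ σ : QAlg J →ₗ[kᵐᵒᵖ] Assoc J, ∀ t ∈ TAlg.low k E (j + 1),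
      σ (QAlg.mk J t) = QAlg.mk _ (TAlg.comp j t) := by
  let c : TAlg k E →ₗ[kᵐᵒᵖ] TAlg k E :=
    { TAlg.comp j with
      map_smul' := fun r t => by
        induction r using MulOpposite.rec' with
        | h r => exact TAlg.comp_mul_unit j t r }
  obtain ⟨σ, hσ⟩ := exists_extension_of_ker_le
    (QAlg.mkLin J ∘ₗ (TAlg.low k E (j + 1)).subtype)
    (QAlg.mkLin (quadIdeal (relSpace J)) ∘ₗ c ∘ₗ (TAlg.low k E (j + 1)).subtype)
    (fun t ht => QAlg.mk_eq_zero _ (comp_mem_quadIdeal_of_mem hJ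
      ((QAlg.mk_eq_zero_iff J).1 ht) t.2))
  exact ⟨σ, fun t ht => hσ ⟨t, ht⟩⟩

/-- The symbol map `U → A_j`. -/
noncomputable def symbol (hJ : IsNonhomKoszul J) (j : ℕ) : QAlg J →ₗ[kᵐᵒᵖ] Assoc J :=
  (exists_symbol hJ j).choose

lemma symbol_mk (hJ : IsNonhomKoszul J) {j : ℕ} {t : TAlg k E} (ht : t ∈ TAlg.low k E (j + 1)) :
    symbol hJ j (QAlg.mk J t) = QAlg.mk _ (TAlg.comp j t) :=
  (exists_symbol hJ j).choose_spec t ht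

/-- The symbol map `U ⊗ N → A_j ⊗ N`. -/
noncomputable def symbolTensor (hJ : IsNonhomKoszul J) (N : Type u) [AddCommGroup N]
    [Module k N] (j : ℕ) : BTensor k (QAlg J) N →+ BTensor k (Assoc J) N :=
  BTensor.map k (symbol hJ j).toAddMonoidHom (AddMonoidHom.id N)
    (fun r u => (symbol hJ j).map_smul (MulOpposite.op r) u) (fun _ _ => rfl)

lemma symbolTensor_mk (hJ : IsNonhomKoszul J) {j : ℕ} {t : TAlg k E}
    (ht : t ∈ TAlg.low k E (j + 1)) (n : N) :
    symbolTensor hJ N j (tmul k (QAlg.mk J t) n) = tmul k (QAlg.mk _ (TAlg.comp j t)) n :=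
  congrArg (tmul k · n) (symbol_mk hJ ht)

lemma symbolTensor_eq_zero (hJ : IsNonhomKoszul J) {j : ℕ} {x : BTensor k (QAlg J) N}
    (hx : x ∈ filtTensor J N j) : symbolTensor hJ N j x = 0 := by
  refine AddMonoidHom.mem_ker.1 (filtTensor_le (fun t ht n => ?_) hx)
  rw [AddMonoidHom.mem_ker, symbolTensor_mk hJ (TAlg.low_mono (Nat.le_succ j) ht), ht j le_rfl,
    map_zero, zero_tmul]

lemma comp_symbolTensor (hJ : IsNonhomKoszul J) {j : ℕ} {x : BTensor k (QAlg J) N}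
    (hx : x ∈ filtTensor J N (j + 1)) :
    BTensor.comp j (symbolTensor hJ N j x) = symbolTensor hJ N j x := by
  refine (filtTensor_le (H := ((BTensor.comp j).comp (symbolTensor hJ N j)).eqLocus
    (symbolTensor hJ N j)) (fun t ht n => ?_) hx :)
  change BTensor.comp j (symbolTensor hJ N j (tmul k (QAlg.mk J t) n))
    = symbolTensor hJ N j (tmul k (QAlg.mk J t) n)
  rw [symbolTensor_mk hJ ht, comp_tmul, QAlg.comp_of_mem]
  exact ⟨_, TAlg.comp_mem j t, rfl⟩

lemma exists_symbolTensor_eq (hJ : IsNonhomKoszul J) {j : ℕ} (y : BTensor k (Assoc J) N) :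
    ∃ x ∈ filtTensor J N (j + 1), symbolTensor hJ N j x = BTensor.comp j y := by
  induction y using BTensor.induction_on with
  | h0 => exact ⟨0, zero_mem _, by rw [map_zero, map_zero]⟩
  | ha y y' h h' =>
    obtain ⟨x, hx, hx'⟩ := h
    obtain ⟨z, hz, hz'⟩ := h'
    exact ⟨x + z, add_mem hx hz, by rw [map_add, map_add, hx', hz']⟩
  | ht a n =>
    obtain ⟨t, rfl⟩ := QAlg.mk_surjective _ a
    have ht := TAlg.comp_mem_low (Nat.lt_succ_self j) t
    refine ⟨_, tmul_mem_filtTensor ht n, ?_⟩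
    rw [symbolTensor_mk hJ ht, comp_tmul, QAlg.comp_mk, TAlg.comp_of_mem (TAlg.comp_mem j t)]

/-- A right linear choice of elements of `U` with given leading form, so that it can be tensored
with `N`. -/
lemma exists_symbol_section (J : TwoSidedIdeal (TAlg k E)) (j : ℕ) :
    ∃ ρ : Assoc J →+ QAlg J, (∀ (r : k) a, ρ (MulOpposite.op r • a) = MulOpposite.op r • ρ a) ∧
      ∀ t : TAlg k E, ∃ s ∈ TAlg.low k E j,
        ρ (QAlg.mk _ t) = QAlg.mk J (TAlg.comp j t + s) := by
  obtain ⟨l, hl⟩ := exists_lift_of_forall_exists (QAlg.mkLin (quadIdeal (relSpace J)))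
    (LinearMap.id (R := kᵐᵒᵖ)) (fun a => QAlg.mk_surjective _ a)
  refine ⟨(QAlg.mk J).toAddMonoidHom.comp ((TAlg.comp j).comp l.toAddMonoidHom), fun r a => ?_,
    fun t => ?_⟩
  · change QAlg.mk J (TAlg.comp j (l (MulOpposite.op r • a))) = _
    rw [LinearMap.map_smul, TAlg.op_smul_def, TAlg.comp_mul_unit, _root_.map_mul (QAlg.mk J)]
    rfl
  · have h : l (QAlg.mk _ t) - t ∈ quadIdeal (relSpace J) := by
      rw [← QAlg.mk_eq_zero_iff, map_sub, sub_eq_zero]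
      exact hl _
    -- Two representatives of the same class in `A` differ in degree `j` by an element of `J` up to
    -- lower terms, so the image in `U` is controlled modulo `F_{j-1}`.
    obtain ⟨q, hq, s, hs, hqs⟩ := Submodule.mem_sup.1 (comp_mem_sup_of_mem_quadIdeal h j)
    refine ⟨s, hs, ?_⟩
    change QAlg.mk J (TAlg.comp j (l (QAlg.mk _ t))) = _
    have h2 : TAlg.comp j (l (QAlg.mk _ t)) = q + (TAlg.comp j t + s) := by
      rw [map_sub, eq_sub_iff_add_eq] at hqs
      rw [← hqs]
      abel
    rw [h2, map_add (QAlg.mk J) q, QAlg.mk_eq_zero J (relFilt_le_ideal j hq), zero_add]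

/-- On `F_j U ⊗ N`, subtracting the section of the symbol lands in `F_{j-1} U ⊗ N`. Hence the symbol
identifies the graded pieces of `U ⊗ N` with `A_j ⊗ N`. -/
lemma mem_filtTensor_of_symbolTensor_eq_zero (hJ : IsNonhomKoszul J) {j : ℕ}
    {x : BTensor k (QAlg J) N} (hx : x ∈ filtTensor J N (j + 1))
    (h : symbolTensor hJ N j x = 0) : x ∈ filtTensor J N j := by
  obtain ⟨ρ, hρ, hs⟩ := exists_symbol_section J j
  let P : BTensor k (Assoc J) N →+ BTensor k (QAlg J) N :=
    BTensor.map k ρ (AddMonoidHom.id N) hρ (fun _ _ => rfl)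
  have key : ∀ x ∈ filtTensor J N (j + 1), x - P (symbolTensor hJ N j x) ∈ filtTensor J N j := by
    refine fun x hx => filtTensor_le (H := (filtTensor J N j).comap
      (AddMonoidHom.id (BTensor k (QAlg J) N) - P.comp (symbolTensor hJ N j))) (fun t ht n => ?_) hx
    change tmul k (QAlg.mk J t) n - P (symbolTensor hJ N j (tmul k (QAlg.mk J t) n)) ∈
      filtTensor J N j
    rw [symbolTensor_mk hJ ht]
    obtain ⟨s, hs, h⟩ := hs (TAlg.comp j t)
    change tmul k (QAlg.mk J t) n - tmul k (ρ _) n ∈ filtTensor J N j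
    rw [h, TAlg.comp_of_mem (TAlg.comp_mem j t), sub_eq_add_neg, ← neg_tmul, ← add_tmul,
      ← map_neg, ← map_add]
    refine tmul_mem_filtTensor ?_ n
    rw [neg_add, ← add_assoc, ← sub_eq_add_neg, ← sub_eq_add_neg]
    exact sub_mem (TAlg.sub_comp_mem_low ht) hs
  have := key x hx
  rwa [h, map_zero, sub_zero] at this

/-- The symbol in degree zero sends `1 ⊗ n` to `1 ⊗ n` in `A ⊗ N`, where the augmentation of `A`
recovers `n`. -/
lemma one_tmul_injective (hJ : IsNonhomKoszul J) {n : N} (h : tmul k (1 : QAlg J) n = 0) :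
    n = 0 := by
  have h1 : symbolTensor hJ N 0 (tmul k (1 : QAlg J) n) = tmul k (1 : Assoc J) n := by
    have := symbolTensor_mk hJ (TAlg.unit_mem_low (V := E) (1 : k)) n
    rwa [TAlg.comp_zero_unit, map_one, map_one, map_one] at this
  rw [h, map_zero] at h1
  let ev : BTensor k (Assoc J) N →+ N := BTensor.lift
    (AddMonoidHom.mk' (fun a => DistribSMul.toAddMonoidHom N (QAlg.aug _ a)) (fun a b => by
      ext m
      simp [add_smul]))
    (fun a r m => by
      change QAlg.aug _ (a * Assoc.unit J r) • m = QAlg.aug _ a • r • m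
      rw [_root_.map_mul (QAlg.aug _), QAlg.aug_unit, mul_smul])
  have h2 := congrArg ev h1
  rw [map_zero] at h2
  change 0 = QAlg.aug _ (1 : Assoc J) • n at h2
  rw [map_one, one_smul] at h2
  exact h2.symm

end Filtration

/-! ### Cohomology of `F(I)` for graded injective `I` -/

section Cohomology

variable {k E : Type u} [Ring k] [AddCommGroup E] [Module k E] [Module kᵐᵒᵖ E]
  [SMulCommClass k kᵐᵒᵖ E] [IsSemisimpleRing k] [Module.Finite kᵐᵒᵖ E]
  {J : TwoSidedIdeal (TAlg k E)} {D : CDGA (KDual.deg J)} {I : CurvedModule D} {n : ℤ}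

lemma dF_mem_filtTensor {j : ℕ} {x : FDeg I.toGrMod n} (hx : x ∈ filtTensor J (I.deg n) j) :
    dF I n x ∈ filtTensor J (I.deg (n + 1)) (j + 1) := by
  refine filtTensor_le (H := (filtTensor J (I.deg (n + 1)) (j + 1)).comap
    (dF I n).toAddMonoidHom) (fun t ht m => ?_) hx
  change dF I n (tmul k (QAlg.mk J t) m) ∈ filtTensor J (I.deg (n + 1)) (j + 1)
  rw [dF_tmul]
  exact add_mem (sum_mem fun b _ => tmul_mem_filtTensor (TAlg.mul_ι_mem_low ht _) _)
    (tmul_mem_filtTensor (TAlg.low_mono (Nat.le_succ j) ht) _)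

/-- The summand `u ⊗ d m` stays in the same filtration degree and is invisible in the symbol of
degree `j + 1`. -/
lemma symbolTensor_dF (hJ : IsNonhomKoszul J) {j : ℕ} {x : FDeg I.toGrMod n}
    (hx : x ∈ filtTensor J (I.deg n) (j + 1)) :
    symbolTensor hJ _ (j + 1) (dF I n x) = kosI I.toGrMod n (symbolTensor hJ _ j x) := by
  refine filtTensor_le (H := ((symbolTensor hJ _ (j + 1)).comp (dF I n).toAddMonoidHom).eqLocus
    ((kosI I.toGrMod n).comp (symbolTensor hJ _ j))) (fun t ht m => ?_) hx
  change symbolTensor hJ _ (j + 1) (dF I n (tmul k (QAlg.mk J t) m))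
    = kosI I.toGrMod n (symbolTensor hJ _ j (tmul k (QAlg.mk J t) m))
  rw [dF_tmul, map_add, map_sum, symbolTensor_mk hJ ht, kosI_tmul,
    symbolTensor_eq_zero hJ (tmul_mem_filtTensor ht _), add_zero]
  refine Finset.sum_congr rfl fun b _ => ?_
  have h := symbolTensor_mk hJ (TAlg.mul_ι_mem_low ht (coevVec k E b))
    (I.act n (coevDual k E b) m)
  rw [TAlg.comp_succ_mul_ι] at h
  exact h

/-- `A^!` is generated in degree one and the `x̂_b` span `E^*`, so an element killed by them is
acted on by `A^!` through the augmentation alone. -/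
lemma mem_socle_of_act_eq_zero {I : GrMod (KDual.deg J)} {m : I.deg n}
    (h : ∀ b, I.act n (coevDual k E b) m = 0) : m ∈ socle I n := by
  have h1 : ∀ f : RDual k E, KDual.ι J f • m.1 = 0 := by
    intro f
    change (I.act n f m).1 = 0
    rw [coev_spec_dual f, map_sum, AddMonoidHom.finsetSum_apply]
    simp only [GrMod.smul_act, h, smul_zero, Finset.sum_const_zero]
    rfl
  have h2 : ∀ a : KDual J, a • m.1 = KDual.unit J (KDual.aug J a) • m.1 := by
    intro a
    induction a using QAlg.induction_right with
    | unit r => exact congrArg (fun r => KDual.unit J r • m.1) (KDual.aug_unit r).symm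
    | add a b ha hb => rw [add_smul, ha, hb, map_add, map_add, add_smul]
    | mul_ι a f _ =>
      have h3 : KDual.aug J (a * KDual.ι J f) = 0 := by
        rw [_root_.map_mul (KDual.aug J), KDual.aug_ι, mul_zero]
      refine (mul_smul a (KDual.ι J f) m.1).trans ?_
      rw [h1, smul_zero]
      exact ((congrArg (fun r => KDual.unit J r • m.1) h3).trans (by rw [map_zero, zero_smul])).symm
  intro i hi a ha
  have h4 : KDual.unit J (KDual.aug J a) = 0 := by
    rw [← KDual.comp_zero_eq, ← KDual.comp_of_mem ha]
    exact KDual.comp_comp_ne hi.ne _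
  rw [h2, h4, zero_smul]

/-- If the differential of `1 ⊗ m` stays in filtration degree zero, its symbol `∑ x_b ⊗ x̂_b m` in
`A_1 ⊗ I` vanishes; its coordinates are the elements `x̂_b m`. -/
lemma mem_socle_of_dF (hJ : IsNonhomKoszul J) {m : I.deg n}
    (h : dF I n (tmul k 1 m) ∈ filtTensor J (I.deg (n + 1)) 1) : m ∈ socle I.toGrMod n := by
  have h1 := symbolTensor_dF hJ (one_tmul_mem_filtTensor (J := J) m)
  rw [symbolTensor_eq_zero hJ h] at h1
  have h2 : symbolTensor hJ (I.deg n) 0 (tmul k (1 : QAlg J) m) = tmul k (1 : Assoc J) m := by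
    have := symbolTensor_mk hJ (TAlg.unit_mem_low (V := E) (1 : k)) m
    rwa [TAlg.comp_zero_unit, map_one, map_one, map_one] at this
  rw [h2, kosI_tmul] at h1
  refine mem_socle_of_act_eq_zero fun b => ?_
  let ev : BTensor k (Assoc J) (I.deg (n + 1)) →+ I.deg (n + 1) := BTensor.lift
    (AddMonoidHom.mk' (fun a => DistribSMul.toAddMonoidHom _ (coevDual k E b (Assoc.pr J a)))
      (fun a a' => by
        ext m : 1
        change coevDual k E b (Assoc.pr J (a + a')) • m
          = coevDual k E b (Assoc.pr J a) • m + coevDual k E b (Assoc.pr J a') • m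
        rw [map_add, map_add, add_smul]))
    (fun a r m => by
      change coevDual k E b (Assoc.pr J (a * Assoc.unit J r)) • m
        = coevDual k E b (Assoc.pr J a) • r • m
      rw [Assoc.pr_mul_unit, RDual.map_op_smul, mul_smul])
  have h3 := congrArg ev h1
  rw [map_zero, map_sum] at h3
  have h4 : ∀ c, ev (tmul k ((1 : Assoc J) * Assoc.ι J (coevVec k E c))
      (I.act n (coevDual k E c) m)) = I.act n (coevDual k E b (coevVec k E c) • coevDual k E c) m := by
    intro c
    change coevDual k E b (Assoc.pr J (1 * Assoc.ι J (coevVec k E c))) •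
      I.act n (coevDual k E c) m = _
    rw [Assoc.pr_mul_ι, map_one, one_smul, GrMod.smul_act]
  rw [Finset.sum_congr rfl fun c _ => h4 c, ← AddMonoidHom.finsetSum_apply, ← map_sum,
    ← coev_spec_dual] at h3
  exact h3.symm

/-- The symbol of `x` is a Koszul cycle in positive degree, hence the Koszul boundary of the symbol
of some `y`, and `x - d y` has smaller filtration degree. Requiring only that `d x` have filtration
degree zero, rather than vanish, lets the same descent prove both surjectivity and injectivity in
cohomology. -/
lemma exists_eq_dF_add (hJ : IsNonhomKoszul J) (hD : IsKoszulDualStructure J D)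
    (hI : I.toGrMod.IsInjective) {j : ℕ} {x : FDeg I.toGrMod (n + 1)}
    (hx : x ∈ filtTensor J (I.deg (n + 1)) (j + 1))
    (h : dF I (n + 1) x ∈ filtTensor J (I.deg (n + 1 + 1)) 1) :
    ∃ y, ∃ m ∈ socle I.toGrMod (n + 1), x = dF I n y + tmul k 1 m := by
  induction j generalizing x with
  | zero =>
    obtain ⟨m, rfl⟩ := eq_one_tmul_of_mem_filtTensor hx
    exact ⟨0, m, mem_socle_of_dF hJ h, by rw [map_zero, zero_add]⟩
  | succ j ih =>
    have h1 := symbolTensor_dF hJ hx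
    rw [symbolTensor_eq_zero hJ (filtTensor_mono (by omega) h)] at h1
    obtain ⟨w, hw, hw'⟩ := exists_kosI_eq hJ.koszul hI (comp_symbolTensor hJ hx) h1.symm
    obtain ⟨y, hy, hy'⟩ := exists_symbolTensor_eq hJ (j := j) w
    have h2 : x - dF I n y ∈ filtTensor J (I.deg (n + 1)) (j + 1) :=
      mem_filtTensor_of_symbolTensor_eq_zero hJ (sub_mem hx (dF_mem_filtTensor hy)) (by
        rw [map_sub, symbolTensor_dF hJ hy, hy', hw, hw', sub_self])
    obtain ⟨z, m, hm, hz⟩ := ih h2 (by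
      rwa [map_sub, dF_dF hJ.toIsNonhomQuadratic hD, sub_zero])
    exact ⟨y + z, m, hm, by rw [map_add, add_assoc, ← hz, add_sub_cancel]⟩

lemma dF_one_tmul {m : I.deg n} (hm : m ∈ socle I.toGrMod n) :
    dF I n (tmul k 1 m) = tmul k 1 (I.dDeg n m) := dF_socleToFDeg I n ⟨m, hm⟩

/-- Elementwise form of the statement that `S(I) → F(I)` is a quasi-isomorphism. -/
structure IsSocleResolved (I : CurvedModule D) : Prop where
  surj : ∀ (n : ℤ) (x : FDeg I.toGrMod (n + 1)), dF I (n + 1) x = 0 →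
    ∃ y, ∃ m ∈ socle I.toGrMod (n + 1), I.dDeg (n + 1) m = 0 ∧ x = dF I n y + tmul k 1 m
  inj : ∀ (n : ℤ) (x : FDeg I.toGrMod n), ∀ m ∈ socle I.toGrMod (n + 1),
    dF I n x = tmul k 1 m → ∃ m' ∈ socle I.toGrMod n, I.dDeg n m' = m

/-- Write `x = d y + 1 ⊗ m` with `m` in the socle. Applying `d` gives `d x = 1 ⊗ d m`, and
injectivity of `m ↦ 1 ⊗ m` finishes both cases. -/
lemma isSocleResolved_of_isInjective (hJ : IsNonhomKoszul J) (hD : IsKoszulDualStructure J D)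
    (hI : I.toGrMod.IsInjective) : IsSocleResolved I where
  surj n x hx := by
    obtain ⟨j, hj⟩ := exists_mem_filtTensor x
    obtain ⟨y, m, hm, h⟩ := exists_eq_dF_add hJ hD hI hj (hx ▸ zero_mem _)
    refine ⟨y, m, hm, one_tmul_injective (J := J) hJ ?_, h⟩
    rw [← dF_one_tmul hm, ← hx, h, map_add, dF_dF hJ.toIsNonhomQuadratic hD, zero_add]
  inj n x m hm hx := by
    obtain ⟨n, rfl⟩ : ∃ p, n = p + 1 := ⟨n - 1, by ring⟩
    obtain ⟨j, hj⟩ := exists_mem_filtTensor x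
    obtain ⟨y, m', hm', h⟩ := exists_eq_dF_add hJ hD hI hj (hx ▸ one_tmul_mem_filtTensor m)
    refine ⟨m', hm', sub_eq_zero.1 (one_tmul_injective (J := J) hJ ?_)⟩
    rw [← tmulHom_apply, map_sub, tmulHom_apply, tmulHom_apply, ← hx, h, map_add,
      dF_dF hJ.toIsNonhomQuadratic hD, zero_add, dF_one_tmul hm', sub_self]

end Cohomology

/-! ## Homotopy invariance -/

section Homotopy

variable {k E : Type u} [Ring k] [AddCommGroup E] [Module k E] [Module kᵐᵒᵖ E]
  [SMulCommClass k kᵐᵒᵖ E] {J : TwoSidedIdeal (TAlg k E)}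
  {D : CDGA (KDual.deg J)} {M N P : CurvedModule D}

/-- The map `U ⊗ M^i → U ⊗ N^j` induced by a `k`-linear map `M^i → N^j`. -/
noncomputable def FDeg.map {M N : GrMod (KDual.deg J)} {i j : ℤ} (φ : M.deg i →ₗ[k] N.deg j) :
    FDeg M i →+ FDeg N j :=
  BTensor.map k (AddMonoidHom.id _) φ.toAddMonoidHom (fun _ _ => rfl) (fun r m => φ.map_smul r m)

lemma FDeg.map_tmul {M N : GrMod (KDual.deg J)} {i j : ℤ} (φ : M.deg i →ₗ[k] N.deg j)
    (u : QAlg J) (m : M.deg i) : FDeg.map φ (tmul k u m) = tmul k u (φ m) := rfl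

/-- The component of degree `n` of a morphism of graded modules. -/
noncomputable def GrMod.degMap {M N : GrMod (KDual.deg J)} (f : M.carrier →ₗ[KDual J] N.carrier)
    (hf : GrMod.IsGraded f) (n : ℤ) : M.deg n →ₗ[k] N.deg n where
  toFun m := ⟨f m.1, hf n _ m.2⟩
  map_add' _ _ := Subtype.ext (map_add f _ _)
  map_smul' _ _ := Subtype.ext (f.map_smul _ _)

lemma GrMod.degMap_mem_socle {M N : GrMod (KDual.deg J)} {f : M.carrier →ₗ[KDual J] N.carrier}
    {hf : GrMod.IsGraded f} {n : ℤ} {m : M.deg n} (hm : m ∈ socle M n) :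
    GrMod.degMap f hf n m ∈ socle N n := by
  intro i hi a ha
  change a • f m.1 = 0
  rw [← LinearMap.map_smul, hm i hi a ha, map_zero]

lemma dDeg_degMap {f : M.carrier →ₗ[KDual J] N.carrier} (hf : CurvedModule.IsHom f) (n : ℤ)
    (m : M.deg n) :
    N.dDeg n (GrMod.degMap f hf.1 n m) = GrMod.degMap f hf.1 (n + 1) (M.dDeg n m) :=
  Subtype.ext (hf.2 m.1).symm

variable [IsSemisimpleRing k] [Module.Finite kᵐᵒᵖ E]

lemma dF_map_degMap {f : M.carrier →ₗ[KDual J] N.carrier} (hf : CurvedModule.IsHom f) (n : ℤ)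
    (x : FDeg M.toGrMod n) :
    dF N n (FDeg.map (GrMod.degMap f hf.1 n) x)
      = FDeg.map (GrMod.degMap f hf.1 (n + 1)) (dF M n x) := by
  induction x using BTensor.induction_on with
  | h0 => simp
  | ha x y hx hy => simp only [map_add, hx, hy]
  | ht u m =>
    rw [FDeg.map_tmul, dF_tmul, dF_tmul, map_add, map_sum, FDeg.map_tmul, dDeg_degMap hf]
    congr 1
    refine Finset.sum_congr rfl fun b _ => ?_
    rw [FDeg.map_tmul]
    congr 1
    exact Subtype.ext (f.map_smul _ _).symm

/-- The homotopy `s` anticommutes with `E^*`, so the terms `∑ u x_b ⊗ x̂_b s(m)` cancel in the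
anticommutator of `1 ⊗ s` with the differential of `F`. It also preserves the socle, so one `s`
serves both complexes. -/
lemma exists_map_degMap_eq {f : M.carrier →ₗ[KDual J] N.carrier}
    {g : N.carrier →ₗ[KDual J] M.carrier} (hf : CurvedModule.IsHom f) (hg : CurvedModule.IsHom g)
    (h : CurvedModule.NullHomotopic (M := M) (N := M) (g ∘ₗ f - LinearMap.id)) :
    ∃ s : ∀ n : ℤ, M.deg (n + 1) →ₗ[k] M.deg n,
      (∀ n, ∀ m ∈ socle M.toGrMod (n + 1), s n m ∈ socle M.toGrMod n) ∧
      (∀ n m, GrMod.degMap g hg.1 (n + 1) (GrMod.degMap f hf.1 (n + 1) m)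
        = m + M.dDeg n (s n m) + s (n + 1) (M.dDeg (n + 1) m)) ∧
      ∀ n x, FDeg.map (GrMod.degMap g hg.1 (n + 1)) (FDeg.map (GrMod.degMap f hf.1 (n + 1)) x)
        = x + dF M n (FDeg.map (s n) x) + FDeg.map (s (n + 1)) (dF M (n + 1) x) := by
  obtain ⟨s, hs1, hs2, hs3⟩ := h
  let s' (n : ℤ) : M.deg (n + 1) →ₗ[k] M.deg n :=
    { toFun := fun m => ⟨s m.1, by
        have := hs1 _ _ m.2
        rwa [add_sub_cancel_right] at this⟩
      map_add' := fun _ _ => Subtype.ext (map_add s _ _)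
      map_smul' := fun r m => Subtype.ext (by
        have := hs2 0 (KDual.unit J r) m.1 (QAlg.unit_mem r)
        rwa [pow_zero, one_mul] at this) }
  have hsι : ∀ (f : RDual k E) (m : M.carrier), s (KDual.ι J f • m) = -(KDual.ι J f • s m) := by
    intro f m
    rw [hs2 1 _ _ (QAlg.ι_mem f), pow_one, neg_one_mul, neg_smul]
  have h3 : ∀ n m, GrMod.degMap g hg.1 (n + 1) (GrMod.degMap f hf.1 (n + 1) m)
      = m + M.dDeg n (s' n m) + s' (n + 1) (M.dDeg (n + 1) m) := fun n m => Subtype.ext (by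
    have := hs3 m.1
    change g (f m.1) - m.1 = _ at this
    change g (f m.1) = m.1 + M.d (s m.1) + s (M.d m.1)
    rw [add_assoc, ← this, add_sub_cancel])
  refine ⟨s', fun n m hm i hi a ha => ?_, h3, fun n x => ?_⟩
  · change a • s m.1 = 0
    have h := hs2 i a m.1 ha
    rw [hm i hi a ha, map_zero, mul_smul] at h
    rcases Nat.even_or_odd i with hi' | hi'
    · rw [hi'.neg_one_pow, one_smul] at h
      exact h.symm
    · rw [hi'.neg_one_pow, neg_one_smul] at h
      exact neg_eq_zero.1 h.symm
  · induction x using BTensor.induction_on with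
    | h0 => simp
    | ha x y hx hy =>
      simp only [map_add, hx, hy]
      abel
    | ht u m =>
      rw [FDeg.map_tmul, FDeg.map_tmul, FDeg.map_tmul, h3, dF_tmul, dF_tmul, map_add, map_sum,
        FDeg.map_tmul, tmul_add, tmul_add]
      have h4 : ∀ b, FDeg.map (s' (n + 1)) (tmul k (u * QAlg.ι J (coevVec k E b))
          (M.act (n + 1) (coevDual k E b) m))
          = - tmul k (u * QAlg.ι J (coevVec k E b)) (M.act n (coevDual k E b) (s' n m)) := by
        intro b
        rw [FDeg.map_tmul, ← tmul_neg]
        congr 1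
        exact Subtype.ext (hsι _ _)
      rw [Finset.sum_congr rfl fun b _ => h4 b, Finset.sum_neg_distrib]
      abel

/-- Only `g f ≃ id` matters: `M` is a retract of `N` up to homotopy, compatibly with `S`, `F` and
the map between them, and a retract of an isomorphism in cohomology is an isomorphism. -/
lemma IsSocleResolved.of_homotopyEquivalent (hJ : IsNonhomKoszul J)
    (hD : IsKoszulDualStructure J D) (h : CurvedModule.HomotopyEquivalent M N)
    (hN : IsSocleResolved N) : IsSocleResolved M := by
  obtain ⟨f, g, hf, hg, hgf, -⟩ := h
  obtain ⟨s, hs, hsm, hsF⟩ := exists_map_degMap_eq hf hg hgf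
  have hcyc : ∀ {n : ℤ} {m : M.deg n}, m ∈ socle M.toGrMod n → dF M n (tmul k 1 m) = 0 →
      M.dDeg n m = 0 := fun hm h0 =>
    one_tmul_injective (J := J) hJ (by rw [← dF_one_tmul hm, h0])
  refine ⟨fun n x hx => ?_, fun n x m hm hx => ?_⟩
  · obtain ⟨y, m, hm, -, hy⟩ := hN.surj n (FDeg.map (GrMod.degMap f hf.1 (n + 1)) x) (by
      rw [dF_map_degMap hf, hx, map_zero])
    have h1 := hsF n x
    rw [hx, map_zero, add_zero, hy, map_add, ← dF_map_degMap hg, FDeg.map_tmul] at h1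
    have hm' := GrMod.degMap_mem_socle (hf := hg.1) hm
    have h2 : x = dF M n (FDeg.map (GrMod.degMap g hg.1 n) y - FDeg.map (s n) x)
        + tmul k 1 (GrMod.degMap g hg.1 (n + 1) m) := by
      rw [map_sub, sub_add_eq_add_sub, h1, add_sub_cancel_right]
    refine ⟨_, _, hm', hcyc hm' ?_, h2⟩
    rw [h2, map_add, dF_dF hJ.toIsNonhomQuadratic hD, zero_add] at hx
    exact hx
  · obtain ⟨m', hm', h1⟩ := hN.inj n (FDeg.map (GrMod.degMap f hf.1 n) x)
      (GrMod.degMap f hf.1 (n + 1) m) (GrMod.degMap_mem_socle hm) (by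
      rw [dF_map_degMap hf, hx, FDeg.map_tmul])
    have h2 := hsm n m
    rw [hcyc hm (by rw [← hx, dF_dF hJ.toIsNonhomQuadratic hD]), map_zero, add_zero, ← h1,
      ← dDeg_degMap hg] at h2
    refine ⟨GrMod.degMap g hg.1 n m' - s n m,
      sub_mem (GrMod.degMap_mem_socle hm') (hs n m hm), ?_⟩
    rw [map_sub, h2, add_sub_cancel_right]

lemma isSocleResolved_of_inKInj (hJ : IsNonhomKoszul J) (hD : IsKoszulDualStructure J D)
    (h : M.InKInj) : IsSocleResolved M := by
  obtain ⟨N, hN, hMN⟩ := h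
  exact (isSocleResolved_of_isInjective hJ hD hN).of_homotopyEquivalent hJ hD hMN

end Homotopy

/-! ### From elementwise statements to quasi-isomorphisms -/

section QuasiIso

open CategoryTheory

variable {k : Type u} [Ring k] [IsSemisimpleRing k]

/-- Monomorphisms and epimorphisms in homology are tested on generalized elements up to refinement.
Over a semisimple ring no refinement is needed, since elementwise choices can be made linear in the
test object. -/
lemma quasiIso_of_forall_exists {K L : CochainComplex (ModuleCat.{u} k) ℤ} (φ : K ⟶ L)
    (h1 : ∀ (n : ℤ) (x : L.X (n + 1)), L.d (n + 1) (n + 1 + 1) x = 0 →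
      ∃ (y : L.X n) (m : K.X (n + 1)), K.d (n + 1) (n + 1 + 1) m = 0 ∧
        φ.f (n + 1) m + L.d n (n + 1) y = x)
    (h2 : ∀ (n : ℤ) (x : L.X n) (m : K.X (n + 1)), φ.f (n + 1) m = L.d n (n + 1) x →
      ∃ m', K.d n (n + 1) m' = m) : QuasiIso φ := by
  refine ⟨fun i => ?_⟩
  obtain ⟨n, rfl⟩ : ∃ n, i = n + 1 := ⟨i - 1, by ring⟩
  rw [quasiIsoAt_iff_isIso_homologyMap]
  have hp : (ComplexShape.up ℤ).prev (n + 1) = n := by simp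
  have hn : (ComplexShape.up ℤ).next (n + 1) = n + 1 + 1 := by simp
  have hmono : Mono (HomologicalComplex.homologyMap φ (n + 1)) := by
    rw [HomologicalComplex.mono_homologyMap_iff_up_to_refinements φ _ _ _ hp hn]
    intro A x hx y hy
    obtain ⟨g, hg⟩ := exists_lift_of_forall_exists (K.d n (n + 1)).hom x.hom (fun a =>
      h2 n (y a) (x a) (ConcreteCategory.congr_hom hy a))
    refine ⟨A, 𝟙 A, inferInstance, ModuleCat.ofHom g, ?_⟩
    ext a
    exact (hg a).symm
  have hepi : Epi (HomologicalComplex.homologyMap φ (n + 1)) := by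
    rw [HomologicalComplex.epi_homologyMap_iff_up_to_refinements φ _ _ _ hp hn]
    intro A y hy
    obtain ⟨g, hg⟩ := exists_lift_of_forall_exists
      (LinearMap.coprod ((φ.f (n + 1)).hom ∘ₗ (LinearMap.ker (K.d (n + 1) (n + 1 + 1)).hom).subtype)
        (L.d n (n + 1)).hom) y.hom (fun a => by
        obtain ⟨z, m, hm, h⟩ := h1 n (y a) (ConcreteCategory.congr_hom hy a)
        exact ⟨(⟨m, hm⟩, z), h⟩)
    refine ⟨A, 𝟙 A, inferInstance, ModuleCat.ofHom
      ((LinearMap.ker (K.d (n + 1) (n + 1 + 1)).hom).subtype ∘ₗ LinearMap.fst _ _ _ ∘ₗ g), ?_,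
      ModuleCat.ofHom (LinearMap.snd _ _ _ ∘ₗ g), ?_⟩
    · ext a
      exact (g a).1.2
    · ext a
      exact (hg a).symm
  exact isIso_of_mono_of_epi _

end QuasiIso

/-! ### The main theorem -/

section Main

variable {k E : Type u} [Ring k] [AddCommGroup E] [Module k E] [Module kᵐᵒᵖ E]
  [SMulCommClass k kᵐᵒᵖ E] [IsSemisimpleRing k] [Module.Finite kᵐᵒᵖ E]
  {J : TwoSidedIdeal (TAlg k E)} {D : CDGA (KDual.deg J)} {I : CurvedModule D}

lemma IsSocleResolved.quasiIso (h : IsSocleResolved I) (hJ : IsNonhomQuadratic J)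
    (hD : IsKoszulDualStructure J D) : QuasiIso (socleToF hJ hD I) := by
  have hL : ∀ n, (FComplex hJ hD I).d n (n + 1) = ModuleCat.ofHom (dF I n) := fun n => by
    simp only [FComplex, CochainComplex.of_d]
  have hK : ∀ n, (socleComplex I).d n (n + 1)
      = ModuleCat.ofHom ((I.dDeg n).restrict (I.dDeg_mem n)) := fun n => by
    simp only [socleComplex, CochainComplex.of_d]
  refine quasiIso_of_forall_exists _ (fun n x hx => ?_) (fun n x m hm => ?_)
  · rw [hL] at hx
    obtain ⟨y, m, hm, hd, hy⟩ := h.surj n x hx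
    refine ⟨y, ⟨m, hm⟩, ?_, ?_⟩
    · rw [hK]
      exact Subtype.ext hd
    · rw [hL]
      exact (add_comm _ _).trans hy.symm
  · rw [hL] at hm
    obtain ⟨m', hm', h'⟩ := h.inj n x m.1 m.2 hm.symm
    refine ⟨⟨m', hm'⟩, ?_⟩
    rw [hK]
    exact Subtype.ext h'

end Main

end NHKoszul

theorem mainTheorem6 (𝕜 : Type v) [Field 𝕜]
    (k : Type u) [Ring k] [Algebra 𝕜 k] [FiniteDimensional 𝕜 k] [IsSemisimpleRing k]
    (E : Type u) [AddCommGroup E] [Module k E] [Module kᵐᵒᵖ E] [SMulCommClass k kᵐᵒᵖ E]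
    [Module 𝕜 E] [IsScalarTower 𝕜 k E] [IsScalarTower 𝕜 kᵐᵒᵖ E]
    [Module.Finite k E] [Module.Finite kᵐᵒᵖ E]
    (J : TwoSidedIdeal (NHKoszul.TAlg k E)) (hJ : NHKoszul.IsNonhomKoszul J) :
    (∃! D : NHKoszul.CDGA (NHKoszul.KDual.deg J), NHKoszul.IsKoszulDualStructure J D) ∧
    ∀ (D : NHKoszul.CDGA (NHKoszul.KDual.deg J)) (hD : NHKoszul.IsKoszulDualStructure J D)
      (I : NHKoszul.CurvedModule D), I.InKInj →
      QuasiIso (NHKoszul.socleToF hJ.toIsNonhomQuadratic hD I) := by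
  refine ⟨?_, fun D hD I hI => ?_⟩
  · obtain ⟨D, hD⟩ := NHKoszul.exists_isKoszulDualStructure hJ.toIsNonhomQuadratic
    exact ⟨D, hD, fun D' hD' => hD'.unique hD⟩
  · exact (NHKoszul.isSocleResolved_of_inKInj hJ hD hI).quasiIso hJ.toIsNonhomQuadratic hD
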